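/- **Notation.** Let $n,d\ge 0$, let $\lambda=(\lambda_1\ge\dots\ge\lambda_n\ge 0)$ be a partition of $d$ and let $\mu=(\mu_1,\dots,\mu_n)$ be a sequence of non-negative integers with sum $d$. Identify the standard basis of $\mathbb C^d$ with the boxes of the Young diagram of $\lambda$ (English convention); let $f_1,\dots,f_d$ be these basis vectors read along rows from the top row, and let $x^\lambda$ be the nilpotent endomorphism sending a basis vector to the one in the box immediately below, or to $0$ if there is none. Let $(\cdot,\cdot)$ be the symmetric bilinear form with $(f_i,f_j)=\delta_{i,j}$, and let $\perp$ and transposes refer to it. Let $X_\mu$ be the variety of flags $0=V_0\le V_1\le\dots\le V_n=\mathbb C^d$ with $\dim V_i/V_{i-1}=\mu_i$, and let $$X^\lambda_\mu=\{(V_0,\dots,V_n)\in X_\mu : x^\lambda V_i\subseteq V_{i-1},\ i=1,\dots,n\}$$ be the Spaltenstein variety. An *affine paving* of a variety $M$ is a partition of $M$ into disjoint subsets $M_i$ indexed by a finite poset $(I,\le)$ such that, for every $i\in I$, $\bigcup_{j\le i}M_j$ is closed in $M$ and $M_i$ is isomorphic as a variety to $\mathbb A^{d_i}$ for some $d_i\ge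 0$. For $1\le c_1<\dots<c_k\le d$ let $\gamma$ be the partition with $\gamma_{k+1-i}=c_i-i$, and let $$Y_\gamma=\{U\le\mathbb C^d:\dim U=k,\ \dim U\cap\langle f_1,\dots,f_{c_i}\rangle\ge i\text{ for }i=1,\dots,k\},\qquad Y_\gamma^\circ=Y_\gamma\setminus\bigcup_{\gamma'\subsetneq\gamma}Y_{\gamma'} .$$ Let $\operatorname{Col}^\lambda_\mu$ be the set of fillings of the boxes of $\lambda$ by integers, strictly increasing down columns, with exactly $\mu_i$ entries equal to $i$ for $i=1,\dots,n$. If $n\ge1$ and $T\in\operatorname{Col}^\lambda_\mu$, let $c_1<\dots<c_k$ $(k=\mu_n)$ be the columns of $T$ containing $n$, let $\gamma=\gamma_T$ be the associated partition, let $\overline T$ be obtained from $T$ by removing all boxes labelled $n$ and then repeatedly interchanging neighbouring columns whenever the left one has fewer boxes than the right one, let $\overline\lambda$ be the shape of $\overline T$ (it depends only on $\lambda$ and the $c_i$), regarded as a partition with $n-1$ parts, and let $\overline\mu=(\mu_1,\dots,\mu_{n-1})$. Call $c_1<\dots<c_k$ *admissible* for $\lambda$ if every $c_i\le\lambda_1$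 and each of $1,\dots,\lambda_n$ occurs among the $c_i$; for admissible $c$ define $\overline\lambda$ by removing the bottom box of each of the columns $c_1,\dots,c_k$ of $\lambda$ and reordering the columns. For all $n\ge 1$, all partitions $\lambda$ with $n$ parts and all admissible $c$, fix (independently of $T$) a linear isomorphism $\theta:\langle f_{c_1},\dots,f_{c_k}\rangle^\perp\to\mathbb C^{d-k}$ with $\theta\circ x^\lambda=x^{\overline\lambda}\circ\theta$. For $U\in Y_\gamma^\circ$ let $g(U)$ be the unique matrix such that: the vectors $g(U)f_{c_i}\in f_{c_i}+\langle f_j: j<c_i,\ j\notin\{c_1,\dots,c_k\}\rangle$ span $U$; $g(U)f_j=f_j$ for $j\in\{1,\dots,\lambda_1\}\setminus\{c_1,\dots,c_k\}$; and $g(U)x^\lambda f_j=x^\lambda g(U)f_j$ whenever $x^\lambda f_j\ne 0$. Define by recursion on $n$ an integer $\deg T$, a subset $Y_T^\circ\subseteq X^\lambda_\mu$ and a relation $\preceq$ on $\operatorname{Col}^\lambda_\mu$. For $n=0$: $\deg T=0$, $Y_T^\circ=X^\lambda_\mu$ (a point), and $T\preceq T$ for the unique (empty) tableau $T$. For $n\ge1$: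 * $\deg T=|\gamma_T|+\deg\overline T$; * $Y_T^\circ$ is the set of $(V_0,\dots,V_n)\in X^\lambda_\mu$ such that $U:=V_{n-1}^\perp\in Y^\circ_{\gamma_T}$ and $\bigl(\theta(g(U)^{T}V_0),\dots,\theta(g(U)^{T}V_{n-1})\bigr)\in Y^\circ_{\overline T}\subseteq X^{\overline\lambda}_{\overline\mu}$, where $g(U)^T$ is the transpose matrix; * $T\preceq T'$ if $\gamma_T\subsetneq\gamma_{T'}$, or $\gamma_T=\gamma_{T'}$ and $\overline T\preceq\overline{T'}$. **Theorem.** Isomorphisms $\theta$ as above exist, and for every choice of them $\preceq$ is a partial order on the finite set $\operatorname{Col}^\lambda_\mu$, and the sets $Y_T^\circ$ give an affine paving of $X^\lambda_\mu$ indexed by the poset $(\operatorname{Col}^\lambda_\mu,\preceq)$, with $Y_T^\circ\cong\mathbb A^{\deg T}$ for every $T\in\operatorname{Col}^\lambda_\mu$. Moreover, the complement $X_\mu\setminus X^\lambda_\mu$ also has an affine paving. -/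

import Mathlib

namespace SpaltensteinPaving

open scoped Topology

/-! ### Varieties as spaces with functions -/

/-- A space with functions over `ℂ`: a topological space together with, for every open set `U`,
a collection of complex valued functions on `U`, called regular on `U`.  A function on `U` is
represented by a function on the whole space of which only the values on `U` matter. -/
structure SpaceWithFunctions where
  carrier : Type
  top : TopologicalSpace carrier
  regular : Set carrier → (carrier → ℂ) → Prop

namespace SpaceWithFunctions

/-- Affine space `𝔸^ι`: the Zariski topology has the sets `p ≠ 0` as a basis, and a function is
regular on `U` if it is locally on `U` a quotient of two polynomials. -/
def affineSpace (ι : Type) : SpaceWithFunctions where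
  carrier := ι → ℂ
  top := TopologicalSpace.generateFrom
    {U | ∃ p : MvPolynomial ι ℂ, U = {x | MvPolynomial.eval x p ≠ 0}}
  regular U f := ∀ x ∈ U, ∃ p q : MvPolynomial ι ℂ, MvPolynomial.eval x q ≠ 0 ∧
    ∀ y ∈ U, MvPolynomial.eval y q ≠ 0 → f y = MvPolynomial.eval y p / MvPolynomial.eval y q

/-- The structure induced on a subset `Z` of `X` (a subvariety, when `Z` is locally closed):
the subspace topology, and the functions that extend, locally around each point,
to regular functions on open subsets of `X`. -/
def sub (X : SpaceWithFunctions) (Z : Set X.carrier) : SpaceWithFunctions where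
  carrier := Z
  top := X.top.induced Subtype.val
  regular U f := ∀ z ∈ U, ∃ (W : Set X.carrier) (F : X.carrier → ℂ),
    IsOpen[X.top] W ∧ (z : X.carrier) ∈ W ∧ X.regular W F ∧
      ∀ y : Z, y ∈ U → (y : X.carrier) ∈ W → f y = F y

/-- The quotient structure along a map `π`: a set is open (a function is regular)
if and only if its pull-back along `π` is. -/
def quotient (X : SpaceWithFunctions) {Y : Type} (π : X.carrier → Y) : SpaceWithFunctions where
  carrier := Y
  top := X.top.coinduced π
  regular U f := X.regular (π ⁻¹' U) (f ∘ π)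

/-- An isomorphism of spaces with functions: a homeomorphism under which the regular functions
on corresponding open sets correspond. -/
structure Iso (X Y : SpaceWithFunctions) where
  toEquiv : X.carrier ≃ Y.carrier
  isOpen_iff : ∀ U : Set Y.carrier, IsOpen[X.top] (toEquiv ⁻¹' U) ↔ IsOpen[Y.top] U
  regular_iff : ∀ (U : Set Y.carrier) (f : Y.carrier → ℂ), IsOpen[Y.top] U →
    (X.regular (toEquiv ⁻¹' U) (f ∘ toEquiv) ↔ Y.regular U f)

/-- The subsets `cell i` of `M`, indexed by the finite poset `(I, le)`, form an affine paving
of `M`, with `cell i` isomorphic to the affine space of dimension `dim i`. -/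
structure IsAffinePaving (M : SpaceWithFunctions) {I : Type} (le : I → I → Prop)
    (cell : I → Set M.carrier) (dim : I → ℕ) : Prop where
  finite : Finite I
  partialOrder : IsPartialOrder I le
  disjoint : ∀ i j, i ≠ j → Disjoint (cell i) (cell j)
  cover : ⋃ i, cell i = Set.univ
  closed : ∀ i, IsClosed[M.top] (⋃ j ∈ {j | le j i}, cell j)
  iso : ∀ i, Nonempty (Iso (M.sub (cell i)) (affineSpace (Fin (dim i))))

end SpaceWithFunctions

open SpaceWithFunctions

/-! ### Partial flag varieties -/

section Flags

variable {n : ℕ} (β : Type) (mu : Fin n → ℕ)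

/-- The set of partial flags `0 = V₀ ≤ V₁ ≤ ⋯ ≤ Vₙ = ℂ^β` with `dim Vᵢ / Vᵢ₋₁ = μᵢ`. -/
def partialFlags : Set (Fin (n + 1) → Submodule ℂ (β → ℂ)) :=
  {V | V 0 = ⊥ ∧ V (Fin.last n) = ⊤ ∧ ∀ i : Fin n, V i.castSucc ≤ V i.succ ∧
    Module.finrank ℂ (V i.succ) = Module.finrank ℂ (V i.castSucc) + mu i}

/-- Frames in `ℂ^β` of length `d = μ₁ + ⋯ + μₙ`, that is, `d`-tuples of linearly independent
vectors; when `β` has `d` elements this is the open subvariety `GL_d` of the affine space of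
matrices (the vectors being the columns). -/
def frames : Set (affineSpace (Fin (∑ i, mu i) × β)).carrier :=
  {g | LinearIndependent ℂ (fun (j : Fin (∑ i, mu i)) (b : β) => g (j, b))}

/-- `μ₁ + ⋯ + μᵢ` -/
def partialSum (i : ℕ) : ℕ := ∑ j with j.val < i, mu j

/-- `Vᵢ` is the span of the first `μ₁ + ⋯ + μᵢ` vectors of the frame. -/
def flagOfFrame (g : Fin (∑ i, mu i) × β → ℂ) : Fin (n + 1) → Submodule ℂ (β → ℂ) :=
  fun i => Submodule.span ℂ
    ((fun (j : Fin (∑ i, mu i)) (b : β) => g (j, b)) '' {j | j.val < partialSum mu i})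

variable {β} {mu}

theorem partialSum_le (i : ℕ) : partialSum mu i ≤ ∑ i, mu i :=
  Finset.sum_le_sum_of_subset (Finset.filter_subset _ _)

theorem partialSum_succ (i : Fin n) :
    partialSum mu (i.val + 1) = partialSum mu i.val + mu i := by
  have h : (Finset.univ.filter fun j : Fin n => j.val < i.val + 1)
      = insert i (Finset.univ.filter fun j : Fin n => j.val < i.val) := by
    ext j
    simp only [Finset.mem_filter, Finset.mem_univ, true_and, Finset.mem_insert, Fin.ext_iff]
    omega
  rw [partialSum, h, Finset.sum_insert (by simp), partialSum, add_comm]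

theorem partialSum_last : partialSum mu n = ∑ i, mu i := by
  simp [partialSum]

theorem finrank_flagOfFrame {g : Fin (∑ i, mu i) × β → ℂ} (hg : g ∈ frames β mu)
    (i : Fin (n + 1)) :
    Module.finrank ℂ (flagOfFrame β mu g i) = partialSum mu i := by
  have hg' : LinearIndependent ℂ (fun (j : Fin (∑ i, mu i)) (b : β) => g (j, b)) := hg
  have h := finrank_span_eq_card
    (hg'.comp (Subtype.val : {j : Fin (∑ i, mu i) // j.val < partialSum mu i} → _)
      Subtype.val_injective)
  rw [Set.range_comp, Subtype.range_val_subtype] at h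
  rw [flagOfFrame, h, Fintype.card_subtype, Fin.card_filter_val_lt]
  exact min_eq_right (partialSum_le _)

theorem flagOfFrame_mem [Fintype β] (h : Fintype.card β = ∑ i, mu i) {g : Fin (∑ i, mu i) × β → ℂ}
    (hg : g ∈ frames β mu) : flagOfFrame β mu g ∈ partialFlags β mu := by
  refine ⟨?_, ?_, fun i => ⟨?_, ?_⟩⟩
  · simp [flagOfFrame, partialSum]
  · apply Submodule.eq_top_of_finrank_eq
    rw [finrank_flagOfFrame hg, Fin.val_last, partialSum_last, Module.finrank_pi, h]
  · apply Submodule.span_mono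
    apply Set.image_mono
    intro j hj
    simp only [Set.mem_ofPred_eq, Fin.val_castSucc, Fin.val_succ] at hj ⊢
    rw [partialSum_succ]
    omega
  · rw [finrank_flagOfFrame hg, finrank_flagOfFrame hg, Fin.val_succ, Fin.val_castSucc,
      partialSum_succ]

variable (β) (mu)

/-- The partial flag variety of type `μ` in `ℂ^β` as the quotient of `GL_d` by the parabolic
subgroup stabilising the standard flag: two frames are identified when they span
the same flag. -/
def flagVariety [Fintype β] (h : Fintype.card β = ∑ i, mu i) : SpaceWithFunctions :=
  ((affineSpace (Fin (∑ i, mu i) × β)).sub (frames β mu)).quotient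
    (Y := partialFlags β mu) (fun g => ⟨flagOfFrame β mu g.1, flagOfFrame_mem h g.2⟩)

end Flags

/-! ### The nilpotent matrix of a partition and Spaltenstein varieties -/

section Spaltenstein

variable {n : ℕ} (lam mu : Fin n → ℕ)

/-- The boxes of the Young diagram of `lam`: the box `⟨i, j⟩` is in row `i` and column `j`
(both counted from zero, row `0` being the top row). -/
abbrev Box : Type := (i : Fin n) × Fin (lam i)

/-- The space `ℂ^d` with its basis identified with the boxes of the diagram. -/
abbrev BoxSpace : Type := Box lam → ℂ

/-- The nilpotent matrix that sends the basis vector of a box to the one of the box immediately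
below it, and to zero if the box is at the bottom of its column. -/
def nilMatrix : Matrix (Box lam) (Box lam) ℂ :=
  Matrix.of fun b b' => if b.1.val = b'.1.val + 1 ∧ b.2.val = b'.2.val then 1 else 0

/-- The nilpotent endomorphism `x^λ`. -/
def nil : BoxSpace lam →ₗ[ℂ] BoxSpace lam := (nilMatrix lam).mulVecLin

theorem card_box (h : ∑ i, mu i = ∑ i, lam i) : Fintype.card (Box lam) = ∑ i, mu i := by
  simp [h]

/-- The Spaltenstein variety, as a set of tuples of subspaces. -/
def spaltensteinSet : Set (Fin (n + 1) → Submodule ℂ (BoxSpace lam)) :=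
  {V | V ∈ partialFlags (Box lam) mu ∧
    ∀ i : Fin n, (V i.succ).map (nil lam) ≤ V i.castSucc}

/-- The variety `X_μ` of partial flags of type `μ` in `ℂ^d`. -/
def X (h : ∑ i, mu i = ∑ i, lam i) : SpaceWithFunctions :=
  flagVariety (Box lam) mu (card_box lam mu h)

/-- `X^λ_μ` as a subset of `X_μ`. -/
def spaltensteinSubset (h : ∑ i, mu i = ∑ i, lam i) : Set (X lam mu h).carrier :=
  {V : partialFlags (Box lam) mu | V.1 ∈ spaltensteinSet lam mu}

/-- The Spaltenstein variety `X^λ_μ`. -/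
def spaltenstein (h : ∑ i, mu i = ∑ i, lam i) : SpaceWithFunctions :=
  (X lam mu h).sub (spaltensteinSubset lam mu h)

/-- The complement `X_μ \ X^λ_μ`. -/
def spaltensteinCompl (h : ∑ i, mu i = ∑ i, lam i) : SpaceWithFunctions :=
  (X lam mu h).sub (spaltensteinSubset lam mu h)ᶜ

end Spaltenstein

/-! ### Column-strict tableaux -/

section Tableaux

variable {n : ℕ} (lam mu : Fin n → ℕ)

/-- The number `λ₁` of columns of the Young diagram of the partition `lam`. -/
def numCols : ℕ := Finset.univ.sup lam

/-- The number of boxes in the column `j` (counted from zero). -/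
def colHeight (j : ℕ) : ℕ := (Finset.univ.filter fun i => j < lam i).card

/-- A tableau is recorded as the list of its columns from left to right,
each of them being read from top to bottom. -/
abbrev Tableau : Type := List (List ℕ)

/-- `Col^λ_μ`: the fillings of the diagram of `lam` whose entries strictly increase down the
columns, with exactly `μᵢ` entries equal to `i` for `i = 1, …, n`. -/
def Col : Set Tableau :=
  {T | T.map List.length = (List.range (numCols lam)).map (colHeight lam) ∧
    (∀ C ∈ T, C.Pairwise (· < ·)) ∧ ∀ i : Fin n, T.flatten.count (i.val + 1) = mu i}

/-- The increasing list of the (indices, counted from zero, of the) columns of `T` that contain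
the entry `m`. -/
def colsWith (m : ℕ) (T : Tableau) : List ℕ :=
  (List.range T.length).filter fun j => m ∈ T.getD j []

/-- The tableau obtained from `T` by removing all boxes labelled by `m` and then repeatedly
interchanging neighbouring columns whenever the left one has fewer boxes than the right one
(that is, sorting the columns stably by decreasing height). -/
def bar (m : ℕ) (T : Tableau) : Tableau :=
  ((T.map fun C => C.erase m).filter fun C => C ≠ []).insertionSort
    fun C C' => C'.length ≤ C.length

/-- The partition `γ` with column sequence `c`, as the decreasing list of its parts:
`γ_{k+1-i} = cᵢ - i`. -/
def partOfCols (c : List ℕ) : List ℕ := (c.mapIdx fun i ci => ci - i).reverse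

/-- Containment of partitions. -/
def PartLE (γ γ' : List ℕ) : Prop := ∀ i, γ.getD i 0 ≤ γ'.getD i 0

/-- Proper containment of partitions. -/
def PartLT (γ γ' : List ℕ) : Prop := PartLE γ γ' ∧ ¬ PartLE γ' γ

/-- The degree of a tableau with entries in `1, …, n`. -/
def tabDeg : ℕ → Tableau → ℕ
  | 0, _ => 0
  | n + 1, T => (partOfCols (colsWith (n + 1) T)).sum + tabDeg n (bar (n + 1) T)

/-- The relation `T ⪯ T'` on tableaux with entries in `1, …, n`. -/
def TabLE : ℕ → Tableau → Tableau → Prop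
  | 0, _, _ => True
  | n + 1, T, T' =>
    PartLT (partOfCols (colsWith (n + 1) T)) (partOfCols (colsWith (n + 1) T')) ∨
      (partOfCols (colsWith (n + 1) T) = partOfCols (colsWith (n + 1) T') ∧
        TabLE n (bar (n + 1) T) (bar (n + 1) T'))

end Tableaux

/-! ### Schubert cells -/

section Schubert

variable {n : ℕ} (lam : Fin n → ℕ)

/-- The position (from zero) of a box in the reading order along rows from the top row. -/
def pos (b : Box lam) : ℕ := (∑ i with i < b.1, lam i) + b.2.val

/-- The basis vector of `ℂ^d` labelled by a box; the basis `f₁, …, f_d` consists of these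
vectors, ordered by `pos`. -/
def f (b : Box lam) : BoxSpace lam := Pi.single b 1

/-- The span of the first `m` of the vectors `f₁, …, f_d`. -/
def initialSpan (m : ℕ) : Submodule ℂ (BoxSpace lam) :=
  Submodule.span ℂ (f lam '' {b | pos lam b < m})

/-- The Schubert variety of the partition with column sequence `c` (counted from zero):
the `k`-dimensional `U` with `dim U ∩ ⟨f₁, …, f_{cᵢ}⟩ ≥ i` for `i = 1, …, k`. -/
def schubertVariety (c : List ℕ) : Set (Submodule ℂ (BoxSpace lam)) :=
  {U | Module.finrank ℂ U = c.length ∧ ∀ (i : ℕ) (hi : i < c.length),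
    i + 1 ≤ Module.finrank ℂ (U ⊓ initialSpan lam (c.get ⟨i, hi⟩ + 1) : Submodule ℂ (BoxSpace lam))}

/-- The column sequences (counted from zero) of the partitions in a `k × (d - k)`-rectangle. -/
def IsColSeq (k d : ℕ) (c : List ℕ) : Prop :=
  c.length = k ∧ c.Pairwise (· < ·) ∧ ∀ j ∈ c, j < d

/-- The Schubert cell: the Schubert variety without its proper Schubert subvarieties. -/
def schubertCell (c : List ℕ) : Set (Submodule ℂ (BoxSpace lam)) :=
  schubertVariety lam c \ ⋃ c' ∈ {c' | IsColSeq c.length (∑ i, lam i) c' ∧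
    PartLT (partOfCols c') (partOfCols c)}, schubertVariety lam c'

/-- The orthogonal complement for the symmetric bilinear form with `(fᵢ, fⱼ) = δᵢⱼ`. -/
def perp (U : Submodule ℂ (BoxSpace lam)) : Submodule ℂ (BoxSpace lam) :=
  U.orthogonalBilin (dotProductBilin ℂ ℂ)

end Schubert

/-! ### The cells -/

section Cells

/-- The partition obtained by removing one box from the bottom of each column listed in `c` and
then reordering the columns: its row `i` has as many boxes as there are
columns of height more than `i` after the removal. -/
def lamBar {n : ℕ} (lam : Fin (n + 1) → ℕ) (c : List ℕ) : Fin n → ℕ := fun i =>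
  ((Finset.range (numCols lam)).filter fun j =>
    i.val < colHeight lam j - if j ∈ c then 1 else 0).card

/-- `c` is the column sequence of a partition `γ ⊆ β`: its entries are columns of the diagram,
and it contains all columns of the maximal height `n + 1`. -/
def Admissible {n : ℕ} (lam : Fin (n + 1) → ℕ) (c : List ℕ) : Prop :=
  c.Pairwise (· < ·) ∧ (∀ j ∈ c, j < lam 0) ∧ ∀ j < lam (Fin.last n), j ∈ c

/-- The space `⟨f_{c₁}, …, f_{c_k}⟩`. -/
def colSpan {n : ℕ} (lam : Fin n → ℕ) (c : List ℕ) : Submodule ℂ (BoxSpace lam) :=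
  Submodule.span ℂ (f lam '' {b | pos lam b ∈ c})

/-- For each partition and each set of columns, a linear map `θ` (only its restriction to
`⟨f_{c₁}, …, f_{c_k}⟩^⊥` is going to matter). -/
abbrev ThetaFamily : Type :=
  ∀ (n : ℕ) (lam : Fin (n + 1) → ℕ) (c : List ℕ), BoxSpace lam →ₗ[ℂ] BoxSpace (lamBar lam c)

/-- The `θ`'s restrict to isomorphisms `⟨f_{c₁}, …, f_{c_k}⟩^⊥ ≅ ℂ^{d-k}`
that intertwine `x^λ` with the nilpotent matrix of the smaller partition. -/
def ThetaFamily.IsAdapted (θ : ThetaFamily) : Prop :=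
  ∀ (n : ℕ) (lam : Fin (n + 1) → ℕ) (c : List ℕ), Antitone lam → Admissible lam c →
    Set.BijOn (θ n lam c) (perp lam (colSpan lam c)) Set.univ ∧
    ∀ v ∈ perp lam (colSpan lam c),
      θ n lam c (nil lam v) = nil (lamBar lam c) (θ n lam c v)

/-- `g` is the matrix `g(U)` attached to a point `U` of the Schubert cell of `c`: the vectors
`g f_{cᵢ}` are the basis of `U` in reduced echelon form, `g` fixes the
other vectors of the top row, and it commutes with `x^λ` on the boxes not at the bottom. -/
def IsCellMatrix {n : ℕ} (lam : Fin n → ℕ) (c : List ℕ) (U : Submodule ℂ (BoxSpace lam))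
    (g : Matrix (Box lam) (Box lam) ℂ) : Prop :=
  U = Submodule.span ℂ (g.mulVecLin '' (f lam '' {b | pos lam b ∈ c})) ∧
  (∀ b, pos lam b ∈ c → g.mulVecLin (f lam b) - f lam b ∈
    Submodule.span ℂ (f lam '' {b' | pos lam b' < pos lam b ∧ pos lam b' ∉ c})) ∧
  (∀ b : Box lam, b.1.val = 0 → pos lam b ∉ c → g.mulVecLin (f lam b) = f lam b) ∧
  ∀ b, nil lam (f lam b) ≠ 0 →
    g.mulVecLin (nil lam (f lam b)) = nil lam (g.mulVecLin (f lam b))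

/-- The set `Y°_T` in `X^λ_μ`: the flags `V` such that `U = V_{n-1}^⊥` lies in the Schubert cell
of the columns of `T` containing `n` and the flag with terms `θ(g(U)ᵀ Vᵢ)` for
`i = 0, …, n - 1` lies in the set attached to the smaller tableau. -/
def cell (θ : ThetaFamily) : (n : ℕ) → (lam mu : Fin n → ℕ) → Tableau →
    Set (Fin (n + 1) → Submodule ℂ (BoxSpace lam))
  | 0, lam, mu, _ => spaltensteinSet lam mu
  | n + 1, lam, mu, T =>
    {V | V ∈ spaltensteinSet lam mu ∧
      perp lam (V (Fin.last n).castSucc) ∈ schubertCell lam (colsWith (n + 1) T) ∧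
      ∃ g : Matrix (Box lam) (Box lam) ℂ,
        IsCellMatrix lam (colsWith (n + 1) T) (perp lam (V (Fin.last n).castSucc)) g ∧
        (fun i : Fin (n + 1) => ((V i.castSucc).map g.transpose.mulVecLin).map
            (θ n lam (colsWith (n + 1) T))) ∈
          cell θ n (lamBar lam (colsWith (n + 1) T)) (fun i => mu i.castSucc) (bar (n + 1) T)}

/-- `Y°_T` as a subset of the Spaltenstein variety. -/
def cellSubset (θ : ThetaFamily) {n : ℕ} (lam mu : Fin n → ℕ) (h : ∑ i, mu i = ∑ i, lam i)
    (T : Tableau) : Set (spaltenstein lam mu h).carrier :=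
  {V : spaltensteinSubset lam mu h | V.1.1 ∈ cell θ n lam mu T}

end Cells

end SpaltensteinPaving

/-! Induction on n, sending a flag to its last but one term V_{n-1}, or equivalently to U =
V_{n-1}^⊥ in a Grassmannian. On the Schubert cell of c the coordinates u are the entries of the
reduced echelon basis of U, and V_{n-1} is cut out by the equations v_i + ∑ u_ij v_j = 0, i ∈ c
(`cellSpace`). The matrix A(u) = g(U)ᵀ carries V_{n-1} to the fixed space ⟨f_c⟩^⊥. It has the form 1
+ N(u) with N linear in u and N² = 0, so its inverse A(-u) is polynomial as well. Hence the flags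
over a Schubert cell form the product of that cell with the flags in a fixed space
(`Trivialization`, `Trivialization.isCell_cellOver`).

For a point of the Spaltenstein variety c is admissible: V_{n-1} contains the image of x^λ, so c
lies in the top row, and iterating x^λ V_i ⊆ V_{i-1} shows that every column of full height belongs
to c (`admissible_of_mem_spaltensteinSet`). For admissible c the matrix A(u) repeats the same
coefficients in every row of boxes and so commutes with x^λ (`boxMatrix_comm_nil`). The condition on
V_n then holds automatically, and the remaining ones become, through θ, the conditions for the
smaller partition (`mem_spaltensteinSet_iff`). So the part over an admissible cell is the cell times
a smaller Spaltenstein variety. On the combinatorial side T ↦ (c, T̄) is a bijection onto the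
corresponding pairs (`splitCol_bijective`), and the cell has dimension |γ| (`card_cellIdx`).

For the closure condition, transversality of V_{n-1} to the span of the basis vectors in c is an
open condition. Among the sets c of the right size for which it holds, the one labelling the
Schubert cell is the largest in the Bruhat order (`bruhatLE_of_isTransverse`). Hence the strata
below a given one form a closed set (`exists_flagOpen_lower`). Open sets of the fibre extend to open
sets of flags by reading the coordinates u off any transverse subspace
(`Trivialization.flagOpen_pullback`), so pavings of the fibres combine lexicographically
(`isPaving_sigma`).

The complement is treated by the same machine: over an admissible cell the fibre is the complement
of the smaller Spaltenstein variety, and over any other cell it is a whole smaller flag variety,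
which is paved in the same way.

The geometry takes place on frames, that is on GL_d: open sets are given by non-vanishing
polynomials, regular functions by local quotients, and a cell is a polynomial family of frames with
a regular inverse (`IsCell`, `IsCell.nonempty_iso`). -/

namespace SpaltensteinPaving

open SpaceWithFunctions
open scoped Topology

set_option linter.unusedSectionVars false

/-! ### Polynomial and regular functions on affine space -/

section Regular

variable {ι κ : Type}

/-- A function on affine space that is given by a polynomial. -/
def IsPoly (F : (ι → ℂ) → ℂ) : Prop :=
  ∃ p : MvPolynomial ι ℂ, ∀ x, F x = MvPolynomial.eval x p

theorem isPoly_eval (p : MvPolynomial ι ℂ) : IsPoly fun x => MvPolynomial.eval x p :=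
  ⟨p, fun _ => rfl⟩

theorem isPoly_const (a : ℂ) : IsPoly fun _ : ι → ℂ => a := ⟨MvPolynomial.C a, by simp⟩

theorem isPoly_coord (i : ι) : IsPoly fun x : ι → ℂ => x i := ⟨MvPolynomial.X i, by simp⟩

theorem IsPoly.add {F G : (ι → ℂ) → ℂ} (hF : IsPoly F) (hG : IsPoly G) :
    IsPoly fun x => F x + G x := by
  obtain ⟨p, hp⟩ := hF
  obtain ⟨q, hq⟩ := hG
  exact ⟨p + q, by simp [hp, hq]⟩

theorem IsPoly.mul {F G : (ι → ℂ) → ℂ} (hF : IsPoly F) (hG : IsPoly G) :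
    IsPoly fun x => F x * G x := by
  obtain ⟨p, hp⟩ := hF
  obtain ⟨q, hq⟩ := hG
  exact ⟨p * q, by simp [hp, hq]⟩

theorem IsPoly.neg {F : (ι → ℂ) → ℂ} (hF : IsPoly F) : IsPoly fun x => -F x := by
  obtain ⟨p, hp⟩ := hF
  exact ⟨-p, by simp [hp]⟩

theorem IsPoly.sum {σ : Type*} (s : Finset σ) {F : σ → (ι → ℂ) → ℂ}
    (hF : ∀ i, IsPoly (F i)) : IsPoly fun x => ∑ i ∈ s, F i x := by
  choose p hp using hF
  exact ⟨∑ i ∈ s, p i, by simp [hp]⟩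

theorem IsPoly.prod {σ : Type*} (s : Finset σ) {F : σ → (ι → ℂ) → ℂ}
    (hF : ∀ i, IsPoly (F i)) : IsPoly fun x => ∏ i ∈ s, F i x := by
  choose p hp using hF
  exact ⟨∏ i ∈ s, p i, by simp [hp]⟩

theorem IsPoly.comp {F : (κ → ℂ) → ℂ} (hF : IsPoly F) {Φ : (ι → ℂ) → κ → ℂ}
    (hΦ : ∀ k, IsPoly fun x => Φ x k) : IsPoly fun x => F (Φ x) := by
  obtain ⟨p, hp⟩ := hF
  choose q hq using hΦ
  refine ⟨MvPolynomial.bind₁ q p, fun x => ?_⟩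
  beta_reduce
  rw [hp, MvPolynomial.eval, MvPolynomial.eval, MvPolynomial.eval₂Hom_bind₁]
  congr 2
  funext k
  exact hq k x

theorem IsPoly.det {σ : Type*} [Fintype σ] [DecidableEq σ] {M : (ι → ℂ) → Matrix σ σ ℂ}
    (hM : ∀ i j, IsPoly fun x => M x i j) : IsPoly fun x => (M x).det := by
  simp only [Matrix.det_apply']
  exact IsPoly.sum _ fun τ => (isPoly_const _).mul (IsPoly.prod _ fun i => hM _ _)

/-- On `S`, near the point `x`, the function `F` is a quotient of two polynomials. -/
def RegAt (S : Set (ι → ℂ)) (F : (ι → ℂ) → ℂ) (x : ι → ℂ) : Prop :=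
  ∃ p q : MvPolynomial ι ℂ, MvPolynomial.eval x q ≠ 0 ∧
    ∀ y ∈ S, MvPolynomial.eval y q ≠ 0 → F y = MvPolynomial.eval y p / MvPolynomial.eval y q

theorem IsPoly.regAt {F : (ι → ℂ) → ℂ} (hF : IsPoly F) (S : Set (ι → ℂ)) (x : ι → ℂ) :
    RegAt S F x := by
  obtain ⟨p, hp⟩ := hF
  exact ⟨p, 1, by simp, by simp [hp]⟩

theorem RegAt.mono {S S' : Set (ι → ℂ)} {F : (ι → ℂ) → ℂ} {x : ι → ℂ} (h : RegAt S F x)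
    (hS : S' ⊆ S) : RegAt S' F x := by
  obtain ⟨p, q, hx, h⟩ := h
  exact ⟨p, q, hx, fun y hy => h y (hS hy)⟩

/-- Writing p / q as ps / (qs) shrinks the region where the formula must hold to s ≠ 0. The same
device absorbs every auxiliary open condition below. -/
theorem RegAt.congr {S : Set (ι → ℂ)} {F G : (ι → ℂ) → ℂ} {x : ι → ℂ} (h : RegAt S F x)
    (s : MvPolynomial ι ℂ) (hs : MvPolynomial.eval x s ≠ 0)
    (hFG : ∀ y ∈ S, MvPolynomial.eval y s ≠ 0 → G y = F y) : RegAt S G x := by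
  obtain ⟨p, q, hx, h⟩ := h
  refine ⟨p * s, q * s, by simp [hx, hs], fun y hy hq => ?_⟩
  simp only [map_mul, ne_eq, mul_eq_zero, not_or] at hq ⊢
  rw [hFG y hy hq.2, h y hy hq.1, mul_div_mul_right _ _ hq.2]

theorem RegAt.add {S : Set (ι → ℂ)} {F G : (ι → ℂ) → ℂ} {x : ι → ℂ} (hF : RegAt S F x)
    (hG : RegAt S G x) : RegAt S (fun y => F y + G y) x := by
  obtain ⟨p, q, hx, h⟩ := hF
  obtain ⟨p', q', hx', h'⟩ := hG
  refine ⟨p * q' + q * p', q * q', by simp [hx, hx'], fun y hy hq => ?_⟩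
  simp only [map_mul, map_add, ne_eq, mul_eq_zero, not_or] at hq ⊢
  rw [h y hy hq.1, h' y hy hq.2, div_add_div _ _ hq.1 hq.2]

theorem RegAt.mul {S : Set (ι → ℂ)} {F G : (ι → ℂ) → ℂ} {x : ι → ℂ} (hF : RegAt S F x)
    (hG : RegAt S G x) : RegAt S (fun y => F y * G y) x := by
  obtain ⟨p, q, hx, h⟩ := hF
  obtain ⟨p', q', hx', h'⟩ := hG
  refine ⟨p * p', q * q', by simp [hx, hx'], fun y hy hq => ?_⟩
  simp only [map_mul, ne_eq, mul_eq_zero, not_or] at hq ⊢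
  rw [h y hy hq.1, h' y hy hq.2, div_mul_div_comm]

theorem RegAt.neg {S : Set (ι → ℂ)} {F : (ι → ℂ) → ℂ} {x : ι → ℂ} (hF : RegAt S F x) :
    RegAt S (fun y => -F y) x := by
  simpa using ((isPoly_const (-1)).regAt S x).mul hF

theorem RegAt.sum {σ : Type*} (s : Finset σ) {S : Set (ι → ℂ)} {F : σ → (ι → ℂ) → ℂ} {x : ι → ℂ}
    (hF : ∀ i, RegAt S (F i) x) : RegAt S (fun y => ∑ i ∈ s, F i y) x := by
  classical
  induction s using Finset.induction_on with
  | empty => simpa using (isPoly_const 0).regAt S x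
  | insert a s ha ih => simpa [Finset.sum_insert ha] using (hF a).add ih

theorem RegAt.inv {S : Set (ι → ℂ)} {F : (ι → ℂ) → ℂ} {x : ι → ℂ} (hF : RegAt S F x)
    (hxS : x ∈ S) (hx0 : F x ≠ 0) : RegAt S (fun y => (F y)⁻¹) x := by
  obtain ⟨p, q, hx, h⟩ := hF
  have hp : MvPolynomial.eval x p ≠ 0 := fun h0 => hx0 (by rw [h x hxS hx, h0, zero_div])
  -- The extra factor q keeps the formula F = p / q available wherever the new denominator is
  -- non-zero.
  refine ⟨q * q, p * q, by simp [hx, hp], fun y hy hq => ?_⟩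
  simp only [map_mul, ne_eq, mul_eq_zero, not_or] at hq ⊢
  rw [h y hy hq.2, inv_div, mul_div_mul_right _ _ hq.2]

theorem RegAt.exists_ne_zero {S : Set (ι → ℂ)} {F : (ι → ℂ) → ℂ} {x : ι → ℂ} (hF : RegAt S F x)
    (hxS : x ∈ S) (hx0 : F x ≠ 0) : ∃ p : MvPolynomial ι ℂ, MvPolynomial.eval x p ≠ 0 ∧
      ∀ y ∈ S, MvPolynomial.eval y p ≠ 0 → F y ≠ 0 := by
  obtain ⟨p, q, hx, h⟩ := hF
  have hp : MvPolynomial.eval x p ≠ 0 := fun h0 => hx0 (by rw [h x hxS hx, h0, zero_div])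
  refine ⟨p * q, by simp [hx, hp], fun y hy hq => ?_⟩
  simp only [map_mul, ne_eq, mul_eq_zero, not_or] at hq ⊢
  rw [h y hy hq.2, div_eq_zero_iff]
  tauto

theorem RegAt.eval {S : Set (ι → ℂ)} {Φ : (ι → ℂ) → κ → ℂ} {x : ι → ℂ}
    (hΦ : ∀ k, RegAt S (fun y => Φ y k) x) (p : MvPolynomial κ ℂ) :
    RegAt S (fun y => MvPolynomial.eval (Φ y) p) x := by
  induction p using MvPolynomial.induction_on with
  | C a => simpa using (isPoly_const a).regAt S x
  | add p q hp hq => simpa using hp.add hq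
  | mul_X p k hp => simpa using hp.mul (hΦ k)

theorem IsPoly.comp_regAt {F : (κ → ℂ) → ℂ} (hF : IsPoly F) {S : Set (ι → ℂ)}
    {Φ : (ι → ℂ) → κ → ℂ} {x : ι → ℂ} (hΦ : ∀ k, RegAt S (fun y => Φ y k) x) :
    RegAt S (fun y => F (Φ y)) x := by
  obtain ⟨p, hp⟩ := hF
  simpa only [hp] using RegAt.eval hΦ p

theorem RegAt.comp {S : Set (ι → ℂ)} {T : Set (κ → ℂ)} {F : (κ → ℂ) → ℂ} {Φ : (ι → ℂ) → κ → ℂ}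
    {x : ι → ℂ} (hF : RegAt T F (Φ x)) (hΦ : ∀ k, RegAt S (fun y => Φ y k) x) (hxS : x ∈ S)
    (hT : ∀ y ∈ S, Φ y ∈ T) : RegAt S (fun y => F (Φ y)) x := by
  obtain ⟨p, q, hx, h⟩ := hF
  obtain ⟨s, hs, hs'⟩ := (RegAt.eval hΦ q).exists_ne_zero hxS hx
  refine ((RegAt.eval hΦ p).mul ((RegAt.eval hΦ q).inv hxS hx)).congr s hs fun y hy hy' => ?_
  rw [h _ (hT y hy) (hs' y hy hy'), div_eq_mul_inv]

/-- Multiplying polynomials shows that the generating sets p ≠ 0 are stable under finite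
intersections, hence form a basis. -/
theorem isOpen_affineSpace_iff (U : Set (ι → ℂ)) :
    IsOpen[(affineSpace ι).top] U ↔ ∀ x ∈ U, ∃ p : MvPolynomial ι ℂ,
      MvPolynomial.eval x p ≠ 0 ∧ ∀ y, MvPolynomial.eval y p ≠ 0 → y ∈ U := by
  constructor
  · intro h
    induction h with
    | basic s hs =>
      obtain ⟨p, rfl⟩ := hs
      exact fun x hx => ⟨p, hx, fun y hy => hy⟩
    | univ => exact fun x _ => ⟨1, by simp, by simp⟩
    | inter s t _ _ hs ht =>
      intro x hx
      obtain ⟨p, hp, hp'⟩ := hs x hx.1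
      obtain ⟨q, hq, hq'⟩ := ht x hx.2
      refine ⟨p * q, by simp [hp, hq], fun y hy => ?_⟩
      simp only [map_mul, ne_eq, mul_eq_zero, not_or] at hy
      exact ⟨hp' y hy.1, hq' y hy.2⟩
    | sUnion S _ hS =>
      rintro x ⟨s, hs, hx⟩
      obtain ⟨p, hp, hp'⟩ := hS s hs x hx
      exact ⟨p, hp, fun y hy => ⟨s, hs, hp' y hy⟩⟩
  · intro h
    choose! p hp hp' using h
    have : U = ⋃ x ∈ U, {y | MvPolynomial.eval y (p x) ≠ 0} := by
      ext y
      simp only [Set.mem_iUnion, Set.mem_ofPred_eq, exists_prop]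
      exact ⟨fun hy => ⟨y, hy, hp y hy⟩, fun ⟨x, hx, hy⟩ => hp' x hx y hy⟩
    rw [this]
    exact @isOpen_biUnion _ _ (affineSpace ι).top _ _
      fun x _ => TopologicalSpace.isOpen_generateFrom_of_mem ⟨p x, rfl⟩

end Regular

/-! ### The flag variety in terms of frames -/

section FlagSpace

variable {n : ℕ} (β : Type) (mu : Fin n → ℕ)

/-- A set of flags whose preimage in the space of frames is open. -/
def FlagOpen (W : Set (Fin (n + 1) → Submodule ℂ (β → ℂ))) : Prop :=
  ∀ h ∈ frames β mu, flagOfFrame β mu h ∈ W →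
    ∃ p : MvPolynomial (Fin (∑ i, mu i) × β) ℂ, MvPolynomial.eval h p ≠ 0 ∧
      ∀ h' ∈ frames β mu, MvPolynomial.eval h' p ≠ 0 → flagOfFrame β mu h' ∈ W

/-- A function of flags whose pull-back to the space of frames is regular over `W`. -/
def FlagReg (W : Set (Fin (n + 1) → Submodule ℂ (β → ℂ)))
    (F : (Fin (n + 1) → Submodule ℂ (β → ℂ)) → ℂ) : Prop :=
  ∀ h ∈ frames β mu, flagOfFrame β mu h ∈ W →
    RegAt {g | g ∈ frames β mu ∧ flagOfFrame β mu g ∈ W} (fun g => F (flagOfFrame β mu g)) h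

variable {β mu}

theorem FlagReg.mono {W W' : Set (Fin (n + 1) → Submodule ℂ (β → ℂ))}
    {F : (Fin (n + 1) → Submodule ℂ (β → ℂ)) → ℂ} (h : FlagReg β mu W F) (hW : W' ⊆ W) :
    FlagReg β mu W' F :=
  fun g hg hgW => (h g hg (hW hgW)).mono fun _ hy => ⟨hy.1, hW hy.2⟩

theorem FlagOpen.inter {W W' : Set (Fin (n + 1) → Submodule ℂ (β → ℂ))}
    (h : FlagOpen β mu W) (h' : FlagOpen β mu W') : FlagOpen β mu (W ∩ W') := by
  intro g hg hgW
  obtain ⟨p, hp, hp'⟩ := h g hg hgW.1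
  obtain ⟨q, hq, hq'⟩ := h' g hg hgW.2
  refine ⟨p * q, by simp [hp, hq], fun y hy hpq => ?_⟩
  simp only [map_mul, ne_eq, mul_eq_zero, not_or] at hpq
  exact ⟨hp' y hy hpq.1, hq' y hy hpq.2⟩

theorem FlagOpen.iInter {σ : Type*} [Finite σ]
    {W : σ → Set (Fin (n + 1) → Submodule ℂ (β → ℂ))} (h : ∀ i, FlagOpen β mu (W i)) :
    FlagOpen β mu (⋂ i, W i) := by
  intro g hg hgW
  cases nonempty_fintype σ
  rw [Set.mem_iInter] at hgW
  choose p hp hp' using fun i => h i g hg (hgW i)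
  refine ⟨∏ i, p i, by simp [Finset.prod_eq_zero_iff, hp], fun y hy hpy => ?_⟩
  rw [map_prod, Finset.prod_ne_zero_iff] at hpy
  exact Set.mem_iInter.2 fun i => hp' i y hy (hpy i (Finset.mem_univ i))

theorem FlagOpen.iUnion {σ : Type*}
    {W : σ → Set (Fin (n + 1) → Submodule ℂ (β → ℂ))} (h : ∀ i, FlagOpen β mu (W i)) :
    FlagOpen β mu (⋃ i, W i) := by
  intro g hg hgW
  obtain ⟨i, hi⟩ := Set.mem_iUnion.1 hgW
  obtain ⟨p, hp, hp'⟩ := h i g hg hi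
  exact ⟨p, hp, fun y hy hpy => Set.mem_iUnion.2 ⟨i, hp' y hy hpy⟩⟩

theorem FlagOpen.ne_zero {W : Set (Fin (n + 1) → Submodule ℂ (β → ℂ))}
    {F : (Fin (n + 1) → Submodule ℂ (β → ℂ)) → ℂ} (hW : FlagOpen β mu W)
    (hF : FlagReg β mu W F) : FlagOpen β mu (W ∩ {V | F V ≠ 0}) := by
  intro g hg hgW
  obtain ⟨p, hp, hp'⟩ := hW g hg hgW.1
  obtain ⟨q, hq, hq'⟩ := (hF g hg hgW.1).exists_ne_zero ⟨hg, hgW.1⟩ hgW.2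
  refine ⟨p * q, by simp [hp, hq], fun y hy hpq => ?_⟩
  simp only [map_mul, ne_eq, mul_eq_zero, not_or] at hpq
  exact ⟨hp' y hy hpq.1, hq' y ⟨hy, hp' y hy hpq.1⟩ hpq.2⟩

theorem FlagReg.eval {κ : Type} {W : Set (Fin (n + 1) → Submodule ℂ (β → ℂ))}
    {F : κ → (Fin (n + 1) → Submodule ℂ (β → ℂ)) → ℂ} (hF : ∀ k, FlagReg β mu W (F k))
    (p : MvPolynomial κ ℂ) : FlagReg β mu W fun V => MvPolynomial.eval (fun k => F k V) p :=
  fun g hg hgW => RegAt.eval (Φ := fun y k => F k (flagOfFrame β mu y))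
    (fun k => hF k g hg hgW) p

theorem FlagReg.div {W : Set (Fin (n + 1) → Submodule ℂ (β → ℂ))}
    {F G : (Fin (n + 1) → Submodule ℂ (β → ℂ)) → ℂ} (hF : FlagReg β mu W F)
    (hG : FlagReg β mu W G) (h0 : ∀ V ∈ W, G V ≠ 0) : FlagReg β mu W fun V => F V / G V := by
  intro g hg hgW
  simp only [div_eq_mul_inv]
  exact (hF g hg hgW).mul ((hG g hg hgW).inv ⟨hg, hgW⟩ (h0 _ hgW))

variable [Fintype β] (hβ : Fintype.card β = ∑ i, mu i)

theorem isOpen_flagVariety_iff (W : Set (Fin (n + 1) → Submodule ℂ (β → ℂ))) :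
    IsOpen[(flagVariety β mu hβ).top] {V : partialFlags β mu | V.1 ∈ W} ↔ FlagOpen β mu W := by
  -- Coinduced and induced topologies unfold to this by definition.
  have key : IsOpen[(flagVariety β mu hβ).top] {V : partialFlags β mu | V.1 ∈ W} ↔
      ∃ O : Set (Fin (∑ i, mu i) × β → ℂ), IsOpen[(affineSpace _).top] O ∧
        Subtype.val ⁻¹' O = {g : frames β mu | flagOfFrame β mu g.1 ∈ W} := by
    rfl
  rw [key]
  constructor
  · rintro ⟨O, hO, hOW⟩ h hh hhW
    obtain ⟨p, hp, hp'⟩ := (isOpen_affineSpace_iff O).1 hO h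
      ((Set.ext_iff.1 hOW ⟨h, hh⟩).2 hhW)
    exact ⟨p, hp, fun h' hh' hph' => (Set.ext_iff.1 hOW ⟨h', hh'⟩).1 (hp' h' hph')⟩
  · intro h
    choose! p hp hp' using h
    refine ⟨⋃ g ∈ {g | g ∈ frames β mu ∧ flagOfFrame β mu g ∈ W},
      {y | MvPolynomial.eval y (p g) ≠ 0}, ?_, ?_⟩
    · rw [isOpen_affineSpace_iff]
      intro x hx
      obtain ⟨g, hg, hx⟩ := Set.mem_iUnion₂.1 hx
      exact ⟨p g, hx, fun y hy => Set.mem_iUnion₂.2 ⟨g, hg, hy⟩⟩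
    · ext y
      simp only [Set.mem_preimage, Set.mem_iUnion, Set.mem_ofPred_eq, exists_prop]
      exact ⟨fun ⟨g, hg, hy⟩ => hp' g hg.1 hg.2 y.1 y.2 hy,
        fun hy => ⟨y.1, ⟨y.2, hy⟩, hp y.1 y.2 hy⟩⟩

theorem regular_flagVariety_iff (W : Set (Fin (n + 1) → Submodule ℂ (β → ℂ)))
    (F : (Fin (n + 1) → Submodule ℂ (β → ℂ)) → ℂ) :
    (flagVariety β mu hβ).regular {V : partialFlags β mu | V.1 ∈ W} (fun V => F V.1) ↔
      FlagReg β mu W F := by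
  constructor
  · intro h g hg hgW
    obtain ⟨O, G, hO, hgO, hG, hGF⟩ := h ⟨g, hg⟩ hgW
    obtain ⟨s, hs, hs'⟩ := (isOpen_affineSpace_iff O).1 hO g hgO
    obtain ⟨p, q, hq, hpq⟩ := hG g hgO
    refine ⟨p * s, q * s, by simp [hq, hs], fun y hy hqs => ?_⟩
    simp only [map_mul, ne_eq, mul_eq_zero, not_or] at hqs ⊢
    rw [← hpq y (hs' y hqs.2) hqs.1 |>.trans (mul_div_mul_right _ _ hqs.2).symm]
    exact hGF ⟨y, hy.1⟩ hy.2 (hs' y hqs.2)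
  · rintro h ⟨g, hg⟩ hgW
    obtain ⟨p, q, hq, hpq⟩ := h g hg hgW
    refine ⟨{y | MvPolynomial.eval y q ≠ 0},
      fun y => MvPolynomial.eval y p / MvPolynomial.eval y q, ?_, hq, ?_, ?_⟩
    · exact (isOpen_affineSpace_iff _).2 fun x hx => ⟨q, hx, fun y hy => hy⟩
    · exact fun x hx => ⟨p, q, hx, fun y _ _ => rfl⟩
    · exact fun y hy hyq => hpq y.1 ⟨y.2, hy⟩ hyq

/-- Allows arguments to be phrased for arbitrary tuples of subspaces, without carrying along a proof
that they are flags. -/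
theorem exists_flagSet (W : Set (flagVariety β mu hβ).carrier) :
    ∃ W' : Set (Fin (n + 1) → Submodule ℂ (β → ℂ)),
      W = {V : partialFlags β mu | V.1 ∈ W'} := by
  refine ⟨Subtype.val '' (show Set (partialFlags β mu) from W), ?_⟩
  ext V
  exact ⟨fun h => ⟨V, h, rfl⟩, fun ⟨V', h, hV⟩ => Subtype.ext hV ▸ h⟩

theorem exists_flagFun (F : (flagVariety β mu hβ).carrier → ℂ) :
    ∃ F' : (Fin (n + 1) → Submodule ℂ (β → ℂ)) → ℂ,
      F = fun V : partialFlags β mu => F' V.1 := by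
  classical
  refine ⟨fun V => if h : V ∈ partialFlags β mu then F ⟨V, h⟩ else 0, ?_⟩
  funext V
  have hV : V.1 ∈ partialFlags β mu := V.2
  change F V = if h : V.1 ∈ partialFlags β mu then F ⟨V.1, h⟩ else 0
  rw [dif_pos hV]
  rfl

/-- `SpaceWithFunctions` has no restriction axiom, so restriction is derived here from the
description by frames. It is what makes iterated subspaces agree. -/
theorem regular_flagVariety_mono {W W' : Set (flagVariety β mu hβ).carrier}
    {F : (flagVariety β mu hβ).carrier → ℂ} (h : (flagVariety β mu hβ).regular W F)
    (hW : W' ⊆ W) : (flagVariety β mu hβ).regular W' F := by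
  obtain ⟨W, rfl⟩ := exists_flagSet hβ W
  obtain ⟨W', rfl⟩ := exists_flagSet hβ W'
  obtain ⟨F, rfl⟩ := exists_flagFun hβ F
  refine (regular_flagVariety_iff hβ W' F).2 fun g hg hgW => ?_
  have := (regular_flagVariety_iff hβ W F).1 h g hg (hW (a := ⟨_, flagOfFrame_mem hβ hg⟩) hgW)
  exact this.mono fun y hy => ⟨hy.1, hW (a := ⟨_, flagOfFrame_mem hβ hy.1⟩) hy.2⟩

end FlagSpace

/-! ### Cells and pavings in terms of frames -/

section Cells

variable {n : ℕ} (β : Type) (mu : Fin n → ℕ)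

/-- The set of flags `C` is parametrised by the affine space `𝔸^κ`: there is a polynomial
parametrisation that lifts to frames, with a regular inverse. -/
def IsCell (C : Set (Fin (n + 1) → Submodule ℂ (β → ℂ))) (κ : Type) : Prop :=
  ∃ (φ : (κ → ℂ) → Fin (∑ i, mu i) × β → ℂ)
    (e : (Fin (n + 1) → Submodule ℂ (β → ℂ)) → κ → ℂ),
    (∀ x, IsPoly fun w => φ w x) ∧ (∀ w, φ w ∈ frames β mu) ∧
    (∀ w, flagOfFrame β mu (φ w) ∈ C) ∧ (∀ w, e (flagOfFrame β mu (φ w)) = w) ∧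
    (∀ V ∈ C, flagOfFrame β mu (φ (e V)) = V) ∧
    ∀ V ∈ C, ∀ i, ∃ (W : Set (Fin (n + 1) → Submodule ℂ (β → ℂ)))
      (F : (Fin (n + 1) → Submodule ℂ (β → ℂ)) → ℂ),
      FlagOpen β mu W ∧ V ∈ W ∧ FlagReg β mu W F ∧ ∀ V' ∈ C, V' ∈ W → e V' i = F V'

/-- The sets of flags `cell i` form an affine paving of `S`. -/
structure IsPaving (S : Set (Fin (n + 1) → Submodule ℂ (β → ℂ))) {I : Type}
    (le : I → I → Prop) (cell : I → Set (Fin (n + 1) → Submodule ℂ (β → ℂ)))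
    (dim : I → ℕ) : Prop where
  finite : Finite I
  partialOrder : IsPartialOrder I le
  disjoint : ∀ i j, i ≠ j → Disjoint (cell i) (cell j)
  cover : ⋃ i, cell i = S
  closed : ∀ i, ∃ O, FlagOpen β mu O ∧ ∀ V ∈ S, V ∈ O ↔ ∀ j, le j i → V ∉ cell j
  isCell : ∀ i, IsCell β mu (cell i) (Fin (dim i))

variable {β mu}

theorem IsCell.congr {C : Set (Fin (n + 1) → Submodule ℂ (β → ℂ))} {κ κ' : Type} (σ : κ ≃ κ')
    (h : IsCell β mu C κ) : IsCell β mu C κ' := by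
  obtain ⟨φ, e, h1, h2, h3, h4, h5, h6⟩ := h
  refine ⟨fun w => φ (w ∘ σ), fun V => e V ∘ σ.symm,
    fun x => (h1 x).comp (Φ := fun w : κ' → ℂ => w ∘ σ) fun k => isPoly_coord (σ k),
    fun w => h2 _, fun w => h3 _, fun w => ?_, fun V hV => ?_, fun V hV i => h6 V hV (σ.symm i)⟩
  · funext k
    simp [h4]
  · have : (e V ∘ σ.symm) ∘ σ = e V := by
      funext k
      simp
    beta_reduce
    rw [this, h5 V hV]

/-- Quotients of polynomials in the entries of a frame stay quotients of polynomials after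
substituting the polynomial lift φ, which handles one direction. The local regular expressions for
the coordinates e handle the other, and since κ is finite all coordinates share a neighbourhood. -/
theorem IsCell.nonempty_iso [Fintype β] (hβ : Fintype.card β = ∑ i, mu i)
    {C : Set (Fin (n + 1) → Submodule ℂ (β → ℂ))} {κ : Type} [Finite κ] (h : IsCell β mu C κ) :
    Nonempty (Iso ((flagVariety β mu hβ).sub {V : partialFlags β mu | V.1 ∈ C})
      (affineSpace κ)) := by
  obtain ⟨φ, e, h1, h2, h3, h4, h5, h6⟩ := h
  have loc : ∀ V ∈ C, ∃ (W : Set (Fin (n + 1) → Submodule ℂ (β → ℂ)))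
      (F : κ → (Fin (n + 1) → Submodule ℂ (β → ℂ)) → ℂ),
      FlagOpen β mu W ∧ V ∈ W ∧ (∀ i, FlagReg β mu W (F i)) ∧
        ∀ V' ∈ C, V' ∈ W → e V' = fun i => F i V' := by
    intro V hV
    choose W F hW hVW hF hFe using h6 V hV
    refine ⟨⋂ i, W i, F, FlagOpen.iInter hW, Set.mem_iInter.2 hVW,
      fun i => (hF i).mono (Set.iInter_subset _ _), fun V' hV' hV'W => ?_⟩
    funext i
    exact hFe i V' hV' (Set.mem_iInter.1 hV'W i)
  have hpoly : ∀ p, IsPoly fun w => MvPolynomial.eval (φ w) p := fun p =>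
    (isPoly_eval p).comp h1
  let E : {V : partialFlags β mu // V.1 ∈ C} ≃ (κ → ℂ) :=
    { toFun := fun V => e V.1.1
      invFun := fun w => ⟨⟨flagOfFrame β mu (φ w), flagOfFrame_mem hβ (h2 w)⟩, h3 w⟩
      left_inv := fun V => Subtype.ext (Subtype.ext (h5 V.1.1 V.2))
      right_inv := h4 }
  refine ⟨⟨E, fun U => ⟨?_, ?_⟩, fun U f hU => ⟨?_, ?_⟩⟩⟩
  · rintro ⟨O, hO, hOU⟩
    obtain ⟨W, rfl⟩ := exists_flagSet hβ O
    replace hO := (isOpen_flagVariety_iff hβ W).1 hO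
    refine (isOpen_affineSpace_iff (show Set (κ → ℂ) from U)).2 ?_
    have mem : ∀ w : κ → ℂ, w ∈ U ↔ flagOfFrame β mu (φ w) ∈ W := by
      intro w
      have : flagOfFrame β mu (φ w) ∈ W ↔ E (E.symm w) ∈ U := Set.ext_iff.1 hOU (E.symm w)
      rw [E.apply_symm_apply] at this
      exact this.symm
    intro w hw
    obtain ⟨p, hp, hp'⟩ := hO _ (h2 w) ((mem w).1 hw)
    obtain ⟨q, hq⟩ := hpoly p
    beta_reduce at hq
    refine ⟨q, by rwa [← hq], fun y hy => (mem y).2 (hp' _ (h2 y) (by rwa [hq]))⟩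
  · intro hU
    replace hU := (isOpen_affineSpace_iff (show Set (κ → ℂ) from U)).1 hU
    have : ∀ V : {V // V ∈ C ∧ e V ∈ U}, ∃ W, FlagOpen β mu W ∧ V.1 ∈ W ∧
        ∀ V' ∈ C, V' ∈ W → e V' ∈ U := by
      rintro ⟨V, hV, hVU⟩
      obtain ⟨W, F, hW, hVW, hF, hFe⟩ := loc V hV
      obtain ⟨p, hp, hp'⟩ := hU _ hVU
      refine ⟨W ∩ {V | MvPolynomial.eval (fun k => F k V) p ≠ 0},
        hW.ne_zero (FlagReg.eval hF p), ⟨hVW, ?_⟩, fun V' hV' hV'W => hp' _ ?_⟩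
      · rw [Set.mem_ofPred_eq, ← hFe V hV hVW]
        exact hp
      · rw [hFe V' hV' hV'W.1]
        exact hV'W.2
    choose W hW hVW hWU using this
    refine ⟨{V : partialFlags β mu | V.1 ∈ ⋃ V, W V},
      (isOpen_flagVariety_iff hβ _).2 (FlagOpen.iUnion hW), ?_⟩
    ext V
    constructor
    · intro h
      obtain ⟨V', hV'⟩ := Set.mem_iUnion.1 h
      exact hWU V' _ V.2 hV'
    · intro h
      exact Set.mem_iUnion.2 ⟨⟨V.1.1, V.2, h⟩, hVW _⟩
  · intro h w hw
    obtain ⟨O, G, hO, hwO, hG, hGf⟩ := h (E.symm w) (show E (E.symm w) ∈ U by rwa [E.apply_symm_apply])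
    obtain ⟨W, rfl⟩ := exists_flagSet hβ O
    obtain ⟨G, rfl⟩ := exists_flagFun hβ G
    replace hO := (isOpen_flagVariety_iff hβ W).1 hO
    replace hG := (regular_flagVariety_iff hβ W G).1 hG
    obtain ⟨s, hs, hs'⟩ := hO _ (h2 w) hwO
    obtain ⟨p, q, hq, hpq⟩ := hG _ (h2 w) hwO
    obtain ⟨p', hp'⟩ := hpoly (p * s)
    obtain ⟨q', hq'⟩ := hpoly (q * s)
    refine ⟨p', q', by simp [← hq', hq, hs], fun y hy hqs => ?_⟩
    rw [← hq'] at hqs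
    rw [← hq', ← hp']
    simp only [map_mul, ne_eq, mul_eq_zero, not_or] at hqs ⊢
    have hyW := hs' _ (h2 y) hqs.2
    rw [mul_div_mul_right _ _ hqs.2, ← hpq _ ⟨h2 y, hyW⟩ hqs.1]
    have := hGf (E.symm y) (show E (E.symm y) ∈ U by rwa [E.apply_symm_apply]) hyW
    exact (congrArg f (E.apply_symm_apply y)).symm.trans this
  · intro h V hVU
    obtain ⟨W, F, hW, hVW, hF, hFe⟩ := loc V.1.1 V.2
    obtain ⟨p, q, hq, hpq⟩ := h _ hVU
    refine ⟨{V' : partialFlags β mu |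
        V'.1 ∈ W ∩ {V | MvPolynomial.eval (fun k => F k V) q ≠ 0}},
      fun V' => MvPolynomial.eval (fun k => F k V'.1) p / MvPolynomial.eval (fun k => F k V'.1) q,
      (isOpen_flagVariety_iff hβ _).2 (hW.ne_zero (FlagReg.eval hF q)), ⟨hVW, ?_⟩, ?_, ?_⟩
    · rw [Set.mem_ofPred_eq, ← hFe _ V.2 hVW]
      exact hq
    · refine (regular_flagVariety_iff hβ _ fun V' => MvPolynomial.eval (fun k => F k V') p /
        MvPolynomial.eval (fun k => F k V') q).2 ?_
      exact ((FlagReg.eval hF p).mono Set.inter_subset_left).div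
        ((FlagReg.eval hF q).mono Set.inter_subset_left) fun V' hV' => hV'.2
    · intro V' hV'U hV'W
      have heq := hFe _ V'.2 hV'W.1
      have := hpq (e V'.1.1) hV'U (by rw [heq]; exact hV'W.2)
      rw [heq] at this
      exact (congrArg f heq).trans this

/-- A subset of a subset of the flag variety has the structure induced from
the flag variety. -/
theorem nonempty_iso_sub_sub [Fintype β] (hβ : Fintype.card β = ∑ i, mu i)
    (S C : Set (flagVariety β mu hβ).carrier) (hCS : C ⊆ S) :
    Nonempty (Iso (((flagVariety β mu hβ).sub S).sub {V : S | V.1 ∈ C})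
      ((flagVariety β mu hβ).sub C)) := by
  let E : {V : S // V.1 ∈ C} ≃ C :=
    { toFun := fun V => ⟨V.1.1, V.2⟩
      invFun := fun V => ⟨⟨V.1, hCS V.2⟩, V.2⟩
      left_inv := fun _ => rfl
      right_inv := fun _ => rfl }
  refine ⟨⟨E, fun U => ⟨?_, ?_⟩, fun U f hU => ⟨?_, ?_⟩⟩⟩
  · rintro ⟨O, ⟨O', hO', rfl⟩, hOU⟩
    refine ⟨O', hO', ?_⟩
    ext V
    exact Set.ext_iff.1 hOU (E.symm V)
  · rintro ⟨O, hO, rfl⟩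
    exact ⟨Subtype.val ⁻¹' O, ⟨O, hO, rfl⟩, rfl⟩
  · intro h V hV
    obtain ⟨_, F, ⟨O, hO, rfl⟩, hVO, hF, hFf⟩ := h (E.symm V) hV
    obtain ⟨W, G, hW, hVW, hG, hGF⟩ := hF _ hVO
    let _ := (flagVariety β mu hβ).top
    refine ⟨O ∩ W, G, IsOpen.inter hO hW, ⟨hVO, hVW⟩,
      regular_flagVariety_mono hβ hG Set.inter_subset_right, fun V' hV' hV'W => ?_⟩
    have h1 := hFf (E.symm V') hV' hV'W.1
    have h2 := hGF ⟨V'.1, hCS V'.2⟩ hV'W.1 hV'W.2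
    exact h1.trans h2
  · intro h V hV
    obtain ⟨W, G, hW, hVW, hG, hGf⟩ := h (E V) hV
    refine ⟨Subtype.val ⁻¹' W, fun V => G V.1, ⟨W, hW, rfl⟩, hVW,
      fun V' hV' => ⟨W, G, hW, hV', hG, fun _ _ _ => rfl⟩, fun V' hV' hV'W => ?_⟩
    exact hGf (E V') hV' hV'W

/-- The composition of isomorphisms of spaces with functions. -/
def SpaceWithFunctions.Iso.trans {X Y Z : SpaceWithFunctions} (E : Iso X Y) (E' : Iso Y Z) :
    Iso X Z where
  toEquiv := E.toEquiv.trans E'.toEquiv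
  isOpen_iff U := (E.isOpen_iff (E'.toEquiv ⁻¹' U)).trans (E'.isOpen_iff U)
  regular_iff U f hU := (E.regular_iff (E'.toEquiv ⁻¹' U) (f ∘ E'.toEquiv)
    ((E'.isOpen_iff U).2 hU)).trans (E'.regular_iff U f hU)

theorem IsPaving.isAffinePaving [Fintype β] (hβ : Fintype.card β = ∑ i, mu i)
    {S : Set (Fin (n + 1) → Submodule ℂ (β → ℂ))} {I : Type}
    {le : I → I → Prop} {cell : I → Set (Fin (n + 1) → Submodule ℂ (β → ℂ))}
    {dim : I → ℕ} (h : IsPaving β mu S le cell dim) :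
    ((flagVariety β mu hβ).sub {V : partialFlags β mu | V.1 ∈ S}).IsAffinePaving le
      (fun i => {V : {V : partialFlags β mu | V.1 ∈ S} | V.1.1 ∈ cell i}) dim := by
  have hcS : ∀ i, cell i ⊆ S := fun i => h.cover ▸ Set.subset_iUnion cell i
  refine ⟨h.finite, h.partialOrder, fun i j hij => ?_, ?_, fun i => ?_, fun i => ?_⟩
  · rw [Set.disjoint_left]
    exact fun V hV hV' => Set.disjoint_left.1 (h.disjoint i j hij) hV hV'
  · refine Set.eq_univ_of_forall fun V => ?_
    have hV := V.2
    obtain ⟨i, hi⟩ := Set.mem_iUnion.1 (show V.1.1 ∈ ⋃ i, cell i from h.cover ▸ hV)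
    exact Set.mem_iUnion.2 ⟨i, hi⟩
  · obtain ⟨O, hO, hOS⟩ := h.closed i
    let _ := ((flagVariety β mu hβ).sub {V : partialFlags β mu | V.1 ∈ S}).top
    rw [← isOpen_compl_iff]
    refine ⟨{V : partialFlags β mu | V.1 ∈ O}, (isOpen_flagVariety_iff hβ O).2 hO, ?_⟩
    ext V
    have := hOS V.1.1 V.2
    refine this.trans ?_
    rw [← not_iff_not]
    push Not
    refine ⟨fun ⟨j, hj, hV⟩ h => h (Set.mem_iUnion₂.2 ⟨j, hj, hV⟩), fun h => ?_⟩
    obtain ⟨j, hj, hV⟩ := Set.mem_iUnion₂.1 (not_not.1 h)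
    exact ⟨j, hj, hV⟩
  · obtain ⟨E⟩ := nonempty_iso_sub_sub hβ {V : partialFlags β mu | V.1 ∈ S}
      {V : partialFlags β mu | V.1 ∈ cell i} fun V hV => hcS i hV
    obtain ⟨E'⟩ := (h.isCell i).nonempty_iso hβ
    exact ⟨E.trans E'⟩

end Cells

/-! ### Fibring a flag variety over the Schubert cells of a Grassmannian -/

section FlagLemmas

variable {n : ℕ} {β γ : Type} {mu : Fin (n + 1) → ℕ}

theorem partialSum_castSucc (i : Fin (n + 1)) :
    partialSum mu i.castSucc = partialSum (fun j : Fin n => mu j.castSucc) i := by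
  simp only [partialSum, Finset.sum_filter, Fin.sum_univ_castSucc, Fin.val_castSucc,
    Fin.val_last]
  rw [if_neg (by omega), add_zero]

theorem le_of_mem_partialFlags {n : ℕ} {mu : Fin n → ℕ} {V : Fin (n + 1) → Submodule ℂ (β → ℂ)}
    (hV : V ∈ partialFlags β mu) : Monotone V :=
  Fin.monotone_iff_le_succ.2 fun i => (hV.2.2 i).1

theorem finrank_of_mem_partialFlags {n : ℕ} {mu : Fin n → ℕ}
    {V : Fin (n + 1) → Submodule ℂ (β → ℂ)}
    (hV : V ∈ partialFlags β mu) (i : Fin (n + 1)) :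
    Module.finrank ℂ (V i) = partialSum mu i := by
  induction i using Fin.induction with
  | zero =>
    rw [hV.1]
    simp [partialSum]
  | succ i ih => rw [(hV.2.2 i).2, ih, Fin.val_succ, partialSum_succ, Fin.val_castSucc]

variable (mu) in
/-- The indices of a frame, split into those of the last but one term of the flag and the rest. -/
def splitIdx : Fin (∑ i, mu i) ≃ Fin (∑ i : Fin n, mu i.castSucc) ⊕ Fin (mu (Fin.last n)) :=
  (finCongr (Fin.sum_univ_castSucc mu)).trans finSumFinEquiv.symm

theorem val_splitIdx_symm_inl (l : Fin (∑ i : Fin n, mu i.castSucc)) :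
    ((splitIdx mu).symm (Sum.inl l)).val = l.val := by
  simp [splitIdx]

theorem val_splitIdx_symm_inr (l : Fin (mu (Fin.last n))) :
    ((splitIdx mu).symm (Sum.inr l)).val = ∑ i : Fin n, mu i.castSucc + l.val := by
  simp [splitIdx]

theorem flagOfFrame_castSucc (h : Fin (∑ i, mu i) × β → ℂ) (i : Fin (n + 1)) :
    flagOfFrame β mu h i.castSucc = Submodule.span ℂ
      ((fun l b => h ((splitIdx mu).symm (Sum.inl l), b)) ''
        {l | l.val < partialSum (fun j : Fin n => mu j.castSucc) i}) := by
  rw [flagOfFrame, partialSum_castSucc]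
  congr 1
  ext v
  constructor
  · rintro ⟨j, hj, rfl⟩
    obtain ⟨l, rfl⟩ := (splitIdx mu).symm.surjective j
    rcases l with l | l
    · exact ⟨l, by simpa only [Set.mem_ofPred_eq, val_splitIdx_symm_inl] using hj, rfl⟩
    · simp only [Set.mem_ofPred_eq, val_splitIdx_symm_inr] at hj
      have := partialSum_le (mu := fun j : Fin n => mu j.castSucc) i
      omega
  · rintro ⟨l, hl, rfl⟩
    exact ⟨(splitIdx mu).symm (Sum.inl l),
      by simpa only [Set.mem_ofPred_eq, val_splitIdx_symm_inl] using hl, rfl⟩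

/-- Spans commute with linear maps, so no independence is needed before or after applying L.
Independence of the image is recovered separately by `mem_frames_of_last_eq_top`. -/
theorem flagOfFrame_map (L : (β → ℂ) →ₗ[ℂ] (γ → ℂ)) (h : Fin (∑ i, mu i) × β → ℂ)
    (i : Fin (n + 1)) :
    flagOfFrame γ (fun j : Fin n => mu j.castSucc)
      (fun x => L (fun b => h ((splitIdx mu).symm (Sum.inl x.1), b)) x.2) i =
      (flagOfFrame β mu h i.castSucc).map L := by
  rw [flagOfFrame_castSucc, Submodule.map_span, Set.image_image]
  rfl

theorem flagOfFrame_last_castSucc (h : Fin (∑ i, mu i) × β → ℂ) :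
    flagOfFrame β mu h (Fin.last n).castSucc = Submodule.span ℂ
      (Set.range fun l b => h ((splitIdx mu).symm (Sum.inl l), b)) := by
  rw [flagOfFrame_castSucc, Fin.val_last, partialSum_last, ← Set.image_univ]
  congr
  ext l
  simp

theorem mem_flagOfFrame_last_castSucc {h : Fin (∑ i, mu i) × β → ℂ} {v : β → ℂ} :
    v ∈ flagOfFrame β mu h (Fin.last n).castSucc ↔
      ∃ a : Fin (∑ i : Fin n, mu i.castSucc) → ℂ,
        ∀ b, v b = ∑ l, a l * h ((splitIdx mu).symm (Sum.inl l), b) := by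
  rw [flagOfFrame_last_castSucc, Submodule.mem_span_range_iff_exists_fun]
  refine exists_congr fun a => ?_
  rw [eq_comm, funext_iff]
  simp [Finset.sum_apply]

/-- The polynomial is the determinant of the frame. It later serves to keep the image frame in the
fibre non-degenerate near a given flag. -/
theorem exists_frames_open [Fintype β] {n : ℕ} {mu : Fin n → ℕ}
    (hβ : Fintype.card β = ∑ i, mu i) :
    ∃ q : MvPolynomial (Fin (∑ i, mu i) × β) ℂ,
      ∀ h, MvPolynomial.eval h q ≠ 0 ↔ h ∈ frames β mu := by
  classical
  let e : Fin (∑ i, mu i) ≃ β := (Fintype.equivFinOfCardEq hβ).symm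
  obtain ⟨q, hq⟩ := IsPoly.det
    (M := fun h : Fin (∑ i, mu i) × β → ℂ => Matrix.of fun j j' => h (j, e j'))
    fun i j => isPoly_coord (i, e j)
  refine ⟨q, fun h => ?_⟩
  rw [← hq, ← isUnit_iff_ne_zero, ← Matrix.isUnit_iff_isUnit_det,
    ← Matrix.linearIndependent_rows_iff_isUnit]
  let L : (β → ℂ) ≃ₗ[ℂ] (Fin (∑ i, mu i) → ℂ) := LinearEquiv.funCongrLeft ℂ ℂ e
  exact L.toLinearMap.linearIndependent_iff (LinearEquiv.ker L)
    (v := fun (j : Fin (∑ i, mu i)) (b : β) => h (j, b))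

theorem mem_frames_of_last_eq_top [Fintype β] {n : ℕ} {mu : Fin n → ℕ}
    (hβ : Fintype.card β = ∑ i, mu i) {h : Fin (∑ i, mu i) × β → ℂ}
    (ht : flagOfFrame β mu h (Fin.last n) = ⊤) : h ∈ frames β mu := by
  have hr : (fun (j : Fin (∑ i, mu i)) (b : β) => h (j, b)) ''
      {j | j.val < partialSum mu (Fin.last n)} =
      Set.range fun (j : Fin (∑ i, mu i)) (b : β) => h (j, b) := by
    rw [← Set.image_univ]
    congr
    ext l
    simp [partialSum_last]
  rw [flagOfFrame, hr] at ht
  refine linearIndependent_of_top_le_span_of_card_eq_finrank ht.ge ?_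
  simp [hβ]

end FlagLemmas

/-! ### Subspaces as graphs: coordinates near a Schubert cell -/

section Step

variable {n : ℕ} {β γ : Type} [Fintype β] [DecidableEq β] [Fintype γ]

/-- The coordinates of the Schubert cell attached to the subset `c` of the ordered basis. -/
abbrev CellIdx (pos : β → ℕ) (c : Finset β) : Type :=
  {x : β × β // x.1 ∈ c ∧ x.2 ∉ c ∧ pos x.2 < pos x.1}

/-- The orthogonal complement of the point with coordinates `u` of the Schubert cell of `c`. -/
def cellSpace (pos : β → ℕ) (c : Finset β) (u : CellIdx pos c → ℂ) : Submodule ℂ (β → ℂ) where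
  carrier := {v | ∀ i ∈ c, v i + ∑ x : CellIdx pos c, (if x.1.1 = i then u x * v x.1.2 else 0) = 0}
  zero_mem' := by simp
  add_mem' := by
    intro v w hv hw i hi
    have := congrArg₂ (· + ·) (hv i hi) (hw i hi)
    simp only [add_zero] at this
    refine Eq.trans ?_ this
    rw [add_add_add_comm, ← Finset.sum_add_distrib]
    simp only [Pi.add_apply]
    congr 1
    refine Finset.sum_congr rfl fun x _ => ?_
    split_ifs <;> ring
  smul_mem' := by
    intro a v hv i hi
    have := congrArg (a * ·) (hv i hi)
    simp only [mul_zero, mul_add, Finset.mul_sum] at this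
    refine Eq.trans ?_ this
    simp only [Pi.smul_apply, smul_eq_mul]
    congr 1
    refine Finset.sum_congr rfl fun x _ => ?_
    split_ifs <;> ring

theorem mem_cellSpace {pos : β → ℕ} {c : Finset β} {u : CellIdx pos c → ℂ} {v : β → ℂ} :
    v ∈ cellSpace pos c u ↔
      ∀ i ∈ c, v i + ∑ x : CellIdx pos c, (if x.1.1 = i then u x * v x.1.2 else 0) = 0 :=
  Iff.rfl

/-- The entries of the matrix whose graph is the subspace `K`, when `K` is
complementary to the span of the basis vectors in `c`. -/
noncomputable def graphCoord (c : Finset β) (K : Submodule ℂ (β → ℂ)) (i j : β) : ℂ :=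
  open Classical in
  -- The sign is the one in the equations of `cellSpace`. The default 0 does not occur when K is a
  -- complement of the span of the basis vectors in c.
  if h : ∃ v ∈ K, ∀ j' ∉ c, v j' = if j' = j then 1 else 0 then -(Classical.choose h) i else 0

/-- The vectors of `K` are determined by their coordinates outside `c`. -/
def IsTransverse (c : Finset β) (K : Submodule ℂ (β → ℂ)) : Prop :=
  ∀ v ∈ K, (∀ j ∉ c, v j = 0) → v = 0

theorem graphCoord_eq {c : Finset β} {K : Submodule ℂ (β → ℂ)} (hK : IsTransverse c K) {j : β}
    {v : β → ℂ} (hv : v ∈ K) (hvj : ∀ j' ∉ c, v j' = if j' = j then 1 else 0) (i : β) :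
    graphCoord c K i j = -v i := by
  have h : ∃ v ∈ K, ∀ j' ∉ c, v j' = if j' = j then 1 else 0 := ⟨v, hv, hvj⟩
  rw [graphCoord, dif_pos h]
  obtain ⟨h1, h2⟩ := Classical.choose_spec h
  have := hK _ (K.sub_mem h1 hv) fun j' hj' => by
    rw [Pi.sub_apply, h2 j' hj', hvj j' hj', sub_self]
  rw [sub_eq_zero.1 this]

theorem isTransverse_cellSpace (pos : β → ℕ) (c : Finset β) (u : CellIdx pos c → ℂ) :
    IsTransverse c (cellSpace pos c u) := by
  intro v hv h0
  funext i
  by_cases hi : i ∈ c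
  · have := hv i hi
    rwa [Finset.sum_eq_zero, add_zero] at this
    intro x _
    rw [h0 _ x.2.2.1, mul_zero, ite_self]
  · exact h0 i hi

theorem graphCoord_cellSpace (pos : β → ℕ) (c : Finset β) (u : CellIdx pos c → ℂ)
    (x : CellIdx pos c) : graphCoord c (cellSpace pos c u) x.1.1 x.1.2 = u x := by
  -- The vector of the graph over the basis vector at `x.1.2`; the equations force its entries in c.
  let v : β → ℂ := fun b =>
    if b ∈ c then -∑ y : CellIdx pos c, (if y.1.1 = b ∧ y.1.2 = x.1.2 then u y else 0)
    else if b = x.1.2 then 1 else 0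
  have hv1 : ∀ b ∉ c, v b = if b = x.1.2 then 1 else 0 := fun b hb => if_neg hb
  have hv2 : ∀ b ∈ c,
      v b = -∑ y : CellIdx pos c, (if y.1.1 = b ∧ y.1.2 = x.1.2 then u y else 0) :=
    fun b hb => if_pos hb
  rw [graphCoord_eq (isTransverse_cellSpace pos c u) (v := v) _ hv1, hv2 _ x.2.1, neg_neg,
    Finset.sum_eq_single x]
  · simp
  · intro y _ hy
    rw [if_neg]
    exact fun h => hy (Subtype.ext (Prod.ext h.1 h.2))
  · simp
  · intro i hi
    rw [hv2 i hi, neg_add_eq_zero]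
    refine Finset.sum_congr rfl fun y _ => ?_
    rw [hv1 _ y.2.2.1]
    split_ifs <;> simp_all

theorem cellSpace_injective (pos : β → ℕ) (c : Finset β) :
    Function.Injective (cellSpace pos c) := by
  intro u u' h
  funext x
  rw [← graphCoord_cellSpace pos c u x, h, graphCoord_cellSpace]

section Transverse

variable {mu : Fin (n + 1) → ℕ} (hβ : Fintype.card β = ∑ i, mu i) {c : Finset β}
  (hc : c.card = mu (Fin.last n))

include hβ hc in
theorem nonempty_equiv_compl :
    Nonempty (Fin (∑ i : Fin n, mu i.castSucc) ≃ {j // j ∉ c}) := by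
  refine ⟨(Fintype.equivFinOfCardEq ?_).symm⟩
  rw [Fintype.card_subtype_compl, hβ, Fintype.card_coe, hc, Fin.sum_univ_castSucc]
  simp

/-- The part outside the rows of `c` of the vectors in the last but one term of a flag. -/
def minorMatrix (e : Fin (∑ i : Fin n, mu i.castSucc) ≃ {j // j ∉ c})
    (h : Fin (∑ i, mu i) × β → ℂ) :
    Matrix (Fin (∑ i : Fin n, mu i.castSucc)) (Fin (∑ i : Fin n, mu i.castSucc)) ℂ :=
  Matrix.of fun l l' => h ((splitIdx mu).symm (Sum.inl l), (e l').1)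

theorem isPoly_minorMatrix (e : Fin (∑ i : Fin n, mu i.castSucc) ≃ {j // j ∉ c}) (l l') :
    IsPoly fun h : Fin (∑ i, mu i) × β → ℂ => minorMatrix e h l l' :=
  isPoly_coord _

/-- A combination of the first vectors of the frame vanishes outside c exactly when its coefficients
lie in the left kernel of the minor. -/
theorem isTransverse_iff (e : Fin (∑ i : Fin n, mu i.castSucc) ≃ {j // j ∉ c})
    {h : Fin (∑ i, mu i) × β → ℂ} (hh : h ∈ frames β mu) :
    IsTransverse c (flagOfFrame β mu h (Fin.last n).castSucc) ↔ (minorMatrix e h).det ≠ 0 := by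
  constructor
  · intro ht hdet
    obtain ⟨a, ha, haM⟩ := Matrix.exists_vecMul_eq_zero_iff.2 hdet
    have h0 := ht (fun b => ∑ l, a l * h ((splitIdx mu).symm (Sum.inl l), b))
      (mem_flagOfFrame_last_castSucc.2 ⟨a, fun b => rfl⟩) fun j hj => by
        have := congrFun haM (e.symm ⟨j, hj⟩)
        simpa [Matrix.vecMul, dotProduct, minorMatrix] using this
    have hli : LinearIndependent ℂ fun (l : Fin (∑ i : Fin n, mu i.castSucc)) (b : β) =>
        h ((splitIdx mu).symm (Sum.inl l), b) :=
      LinearIndependent.comp hh _ ((splitIdx mu).symm.injective.comp Sum.inl_injective)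
    apply ha
    funext l
    refine Fintype.linearIndependent_iff.1 hli a ?_ l
    funext b
    simpa [Finset.sum_apply] using congrFun h0 b
  · intro hdet v hv hv0
    obtain ⟨a, ha⟩ := mem_flagOfFrame_last_castSucc.1 hv
    have : a = 0 := by
      refine Matrix.eq_zero_of_vecMul_eq_zero hdet ?_
      funext l
      simpa [Matrix.vecMul, dotProduct, minorMatrix, ha] using hv0 _ (e l).2
    funext b
    simp [ha, this]

include hβ hc in
theorem flagOpen_isTransverse :
    FlagOpen β mu {V | IsTransverse c (V (Fin.last n).castSucc)} := by
  obtain ⟨e⟩ := nonempty_equiv_compl hβ hc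
  obtain ⟨p, hp⟩ := IsPoly.det (isPoly_minorMatrix (mu := mu) e)
  exact fun h hh hht => ⟨p, fun h0 => (isTransverse_iff e hh).1 hht ((hp h).trans h0),
    fun h' hh' hp' => (isTransverse_iff e hh').2 fun h0 => hp' ((hp h').symm.trans h0)⟩

include hβ hc in
-- Cramer's rule: the vector of the subspace over the basis vector at j is the combination of the
-- frame whose coefficients form a row of the inverse minor, that is, of the adjugate divided by the
-- determinant.
theorem flagReg_graphCoord (i j : β) (hj : j ∉ c) :
    FlagReg β mu {V | IsTransverse c (V (Fin.last n).castSucc)}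
      fun V => graphCoord c (V (Fin.last n).castSucc) i j := by
  obtain ⟨e⟩ := nonempty_equiv_compl hβ hc
  intro h hh hht
  set S := {g | g ∈ frames β mu ∧
    flagOfFrame β mu g ∈ {V | IsTransverse c (V (Fin.last n).castSucc)}} with hS
  have hadj : ∀ l l', IsPoly fun g : Fin (∑ i, mu i) × β → ℂ =>
      (minorMatrix e g).adjugate l l' := by
    intro l l'
    simp only [Matrix.adjugate_apply]
    refine IsPoly.det fun k k' => ?_
    simp only [Matrix.updateRow_apply]
    split_ifs
    · exact isPoly_const _
    · exact isPoly_minorMatrix e _ _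
  have hinv : RegAt S (fun g => ((minorMatrix e g).det)⁻¹) h :=
    ((IsPoly.det (isPoly_minorMatrix e)).regAt S h).inv ⟨hh, hht⟩ ((isTransverse_iff e hh).1 hht)
  have := (hinv.mul (RegAt.sum Finset.univ fun l =>
    ((hadj (e.symm ⟨j, hj⟩) l).mul
      (isPoly_coord ((splitIdx mu).symm (Sum.inl l), i))).regAt S h)).neg
  refine this.congr 1 (by simp) fun g hg _ => ?_
  have hdet := (isTransverse_iff e hg.1).1 hg.2
  have := graphCoord_eq hg.2 (j := j) (mem_flagOfFrame_last_castSucc.2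
    ⟨fun l => (minorMatrix e g).det⁻¹ * (minorMatrix e g).adjugate (e.symm ⟨j, hj⟩) l,
      fun b => rfl⟩) (fun j' hj' => ?_) i
  · refine this.trans ?_
    simp only [Finset.mul_sum, mul_assoc]
  · have h1 := congrFun (congrFun (Matrix.adjugate_mul (minorMatrix e g)) (e.symm ⟨j, hj⟩))
      (e.symm ⟨j', hj'⟩)
    simp only [Matrix.mul_apply, Matrix.smul_apply, Matrix.one_apply, smul_eq_mul,
      EmbeddingLike.apply_eq_iff_eq, Subtype.mk.injEq] at h1
    have h2 : ∀ l, minorMatrix e g l (e.symm ⟨j', hj'⟩) =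
        g ((splitIdx mu).symm (Sum.inl l), j') := by
      intro l
      simp [minorMatrix]
    simp only [h2] at h1
    simp only [mul_assoc, ← Finset.mul_sum, h1]
    rw [inv_mul_cancel_left₀ hdet]
    simp only [eq_comm]

end Transverse

end Step

/-! ### Trivialisations over a Schubert cell -/

section Step

variable {n : ℕ} {β γ : Type} [Fintype β] [DecidableEq β] [Fintype γ]

/-- A polynomial trivialisation over the Schubert cell of `c`: the matrices `A u` map the
orthogonal complement of the point with coordinates `u` to that of the origin, and `θ` identifies
the latter with `ℂ^γ`, where `θ'` is the inverse of `θ`. -/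
structure Trivialization (pos : β → ℕ) (c : Finset β) (γ : Type) where
  A : (CellIdx pos c → ℂ) → Matrix β β ℂ
  poly : ∀ b b', IsPoly fun u => A u b b'
  inv : ∀ u, A (-u) * A u = 1
  row : ∀ u v, ∀ i ∈ c,
    (A u).mulVec v i = v i + ∑ x : CellIdx pos c, if x.1.1 = i then u x * v x.1.2 else 0
  θ : (β → ℂ) →ₗ[ℂ] (γ → ℂ)
  θ' : (γ → ℂ) →ₗ[ℂ] (β → ℂ)
  θ_θ' : ∀ w, θ (θ' w) = w
  θ'_mem : ∀ w, ∀ b ∈ c, θ' w b = 0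
  θ'_θ : ∀ v, (∀ b ∈ c, v b = 0) → θ' (θ v) = v

namespace Trivialization

variable {pos : β → ℕ} {c : Finset β} (s : Trivialization pos c γ)

theorem inv' (u : CellIdx pos c → ℂ) : s.A u * s.A (-u) = 1 := by
  simpa using s.inv (-u)

theorem mem_cellSpace_iff {u : CellIdx pos c → ℂ} {v : β → ℂ} :
    v ∈ cellSpace pos c u ↔ ∀ b ∈ c, (s.A u).mulVec v b = 0 := by
  rw [mem_cellSpace]
  exact forall₂_congr fun b hb => by rw [s.row u v b hb]

/-- The linear map that identifies the point `u` of the cell with `ℂ^γ`. -/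
def toFibre (u : CellIdx pos c → ℂ) : (β → ℂ) →ₗ[ℂ] (γ → ℂ) :=
  s.θ ∘ₗ (s.A u).mulVecLin

/-- The inverse of `toFibre`. -/
def ofFibre (u : CellIdx pos c → ℂ) : (γ → ℂ) →ₗ[ℂ] (β → ℂ) :=
  (s.A (-u)).mulVecLin ∘ₗ s.θ'

theorem toFibre_ofFibre (u : CellIdx pos c → ℂ) (w : γ → ℂ) :
    s.toFibre u (s.ofFibre u w) = w := by
  simp [toFibre, ofFibre, Matrix.mulVec_mulVec, s.inv', s.θ_θ']

theorem ofFibre_mem (u : CellIdx pos c → ℂ) (w : γ → ℂ) :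
    s.ofFibre u w ∈ cellSpace pos c u := by
  rw [s.mem_cellSpace_iff]
  simpa [ofFibre, Matrix.mulVec_mulVec, s.inv'] using s.θ'_mem w

theorem ofFibre_toFibre {u : CellIdx pos c → ℂ} {v : β → ℂ} (hv : v ∈ cellSpace pos c u) :
    s.ofFibre u (s.toFibre u v) = v := by
  rw [s.mem_cellSpace_iff] at hv
  simp [toFibre, ofFibre, s.θ'_θ _ hv, Matrix.mulVec_mulVec, s.inv]

theorem map_ofFibre_map_toFibre {u : CellIdx pos c → ℂ} {K : Submodule ℂ (β → ℂ)}
    (hK : K ≤ cellSpace pos c u) : (K.map (s.toFibre u)).map (s.ofFibre u) = K := by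
  ext v
  constructor
  · rintro ⟨_, ⟨w, hw, rfl⟩, rfl⟩
    rwa [s.ofFibre_toFibre (hK hw)]
  · intro hv
    exact ⟨_, ⟨v, hv, rfl⟩, s.ofFibre_toFibre (hK hv)⟩

/-- The flag in `ℂ^γ` attached to a flag in `ℂ^β` whose last but one term belongs to the
point `u` of the cell. -/
def fibreFlag (u : CellIdx pos c → ℂ) (V : Fin (n + 2) → Submodule ℂ (β → ℂ)) :
    Fin (n + 1) → Submodule ℂ (γ → ℂ) :=
  fun i => (V i.castSucc).map (s.toFibre u)

/-- The coordinates of a subspace. -/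
noncomputable def coords (pos : β → ℕ) (c : Finset β) (K : Submodule ℂ (β → ℂ)) :
    CellIdx pos c → ℂ :=
  fun x => graphCoord c K x.1.1 x.1.2

theorem coords_cellSpace (u : CellIdx pos c → ℂ) : coords pos c (cellSpace pos c u) = u :=
  funext fun x => graphCoord_cellSpace pos c u x

variable (mu : Fin (n + 1) → ℕ)

/-- The flags in the preimage of the Schubert cell that belong to `C` in the fibre direction. -/
def cellOver (C : Set (Fin (n + 1) → Submodule ℂ (γ → ℂ))) :
    Set (Fin (n + 2) → Submodule ℂ (β → ℂ)) :=
  {V | ∃ u, V (Fin.last n).castSucc = cellSpace pos c u ∧ s.fibreFlag u V ∈ C}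

end Trivialization

end Step

/-! ### Transferring open sets, regular functions and cells from the fibre -/

section Transfer

variable {n : ℕ} {β γ : Type} [Fintype β] [DecidableEq β] [Fintype γ] {pos : β → ℕ}
  {c : Finset β} (s : Trivialization pos c γ) {mu : Fin (n + 1) → ℕ}

namespace Trivialization

/-- The frame of `fibreFlag` obtained from a frame. -/
def fibreFrame (u : CellIdx pos c → ℂ) (h : Fin (∑ i, mu i) × β → ℂ) :
    Fin (∑ i : Fin n, mu i.castSucc) × γ → ℂ :=
  fun x => s.toFibre u (fun b => h ((splitIdx mu).symm (Sum.inl x.1), b)) x.2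

theorem flagOfFrame_fibreFrame (u : CellIdx pos c → ℂ) (h : Fin (∑ i, mu i) × β → ℂ) :
    flagOfFrame γ (fun j : Fin n => mu j.castSucc) (s.fibreFrame u h) =
      s.fibreFlag u (flagOfFrame β mu h) :=
  funext fun i => flagOfFrame_map _ h i

/-- The matrix `toFibre` has polynomial entries. -/
theorem toFibre_apply (u : CellIdx pos c → ℂ) (v : β → ℂ) (k : γ) :
    s.toFibre u v k = ∑ b, (∑ b', s.A u b b' * v b') * s.θ (Pi.single b 1) k := by
  have : (s.A u).mulVec v = ∑ b, (∑ b', s.A u b b' * v b') • Pi.single b (1 : ℂ) := by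
    funext b
    simp [Matrix.mulVec, dotProduct, Finset.sum_apply, Pi.single_apply]
  rw [toFibre, LinearMap.comp_apply, Matrix.mulVecLin_apply, this, map_sum, Finset.sum_apply]
  simp

variable (hβ : Fintype.card β = ∑ i, mu i) (hc : c.card = mu (Fin.last n))

include hβ hc in
-- The coordinates u are regular on the whole open transverse locus, not only on the stratum. Using
-- them there extends the identification with the fibre to a neighbourhood.
theorem regAt_fibreFrame {h : Fin (∑ i, mu i) × β → ℂ} (hh : h ∈ frames β mu)
    (ht : IsTransverse c (flagOfFrame β mu h (Fin.last n).castSucc))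
    (x : Fin (∑ i : Fin n, mu i.castSucc) × γ) :
    RegAt {g | g ∈ frames β mu ∧ flagOfFrame β mu g ∈
        {V | IsTransverse c (V (Fin.last n).castSucc)}}
      (fun g => s.fibreFrame (coords pos c (flagOfFrame β mu g (Fin.last n).castSucc)) g x) h := by
  simp only [fibreFrame, toFibre_apply]
  refine RegAt.sum _ fun b => RegAt.mul (RegAt.sum _ fun b' => RegAt.mul ?_ ?_) ?_
  · refine (s.poly b b').comp_regAt
      (Φ := fun g => coords pos c (flagOfFrame β mu g (Fin.last n).castSucc)) fun y => ?_
    exact flagReg_graphCoord hβ hc y.1.1 y.1.2 y.2.2.1 h hh ht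
  · exact (isPoly_coord _).regAt _ _
  · exact (isPoly_const _).regAt _ _

/-- The part of the open set of transverse flags that `fibreFlag` maps to `W`. -/
def pullback (W : Set (Fin (n + 1) → Submodule ℂ (γ → ℂ))) :
    Set (Fin (n + 2) → Submodule ℂ (β → ℂ)) :=
  {V | IsTransverse c (V (Fin.last n).castSucc) ∧
    s.fibreFlag (coords pos c (V (Fin.last n).castSucc)) V ∈ W ∧
    -- Off the stratum `toFibre` may fail to map the last but one term onto the fibre. This open
    -- condition guarantees that the image of a frame is a frame.
    s.fibreFlag (coords pos c (V (Fin.last n).castSucc)) V (Fin.last n) = ⊤}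

/-- On the stratum the coordinates return u, and transversality and surjectivity onto the fibre come
for free. -/
theorem mem_pullback {W : Set (Fin (n + 1) → Submodule ℂ (γ → ℂ))}
    {V : Fin (n + 2) → Submodule ℂ (β → ℂ)} {u : CellIdx pos c → ℂ}
    (hu : V (Fin.last n).castSucc = cellSpace pos c u) :
    V ∈ s.pullback W ↔ s.fibreFlag u V ∈ W := by
  have hcu : coords pos c (V (Fin.last n).castSucc) = u := by rw [hu, coords_cellSpace]
  rw [pullback, Set.mem_ofPred_eq, hcu]
  refine ⟨fun h => h.2.1, fun h => ⟨hu ▸ isTransverse_cellSpace pos c u, h, ?_⟩⟩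
  rw [eq_top_iff, fibreFlag, hu]
  exact fun w _ => ⟨_, s.ofFibre_mem u w, s.toFibre_ofFibre u w⟩

variable (hγ : Fintype.card γ = ∑ i : Fin n, mu i.castSucc)

include hβ hc hγ in
-- Three non-vanishing conditions are multiplied: transversality, independence of the frame in the
-- fibre, and the condition defining W near that frame.
theorem flagOpen_pullback {W : Set (Fin (n + 1) → Submodule ℂ (γ → ℂ))}
    (hW : FlagOpen γ (fun j : Fin n => mu j.castSucc) W) : FlagOpen β mu (s.pullback W) := by
  intro (h : Fin (∑ i, mu i) × β → ℂ) hh hhW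
  obtain ⟨p, hp, hp'⟩ := flagOpen_isTransverse (c := c) hβ hc h hh hhW.1
  obtain ⟨q, hq⟩ := exists_frames_open (β := γ) hγ
  obtain ⟨ht, h2, h3⟩ := hhW
  rw [← s.flagOfFrame_fibreFrame] at h2
  rw [← s.flagOfFrame_fibreFrame] at h3
  have hfr := mem_frames_of_last_eq_top hγ h3
  obtain ⟨r, hr, hr'⟩ := hW _ hfr h2
  have hreg := s.regAt_fibreFrame hβ hc hh ht
  obtain ⟨q₁, hq₁, hq₁'⟩ := (RegAt.eval hreg q).exists_ne_zero ⟨hh, ht⟩ ((hq _).2 hfr)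
  obtain ⟨r₁, hr₁, hr₁'⟩ := (RegAt.eval hreg r).exists_ne_zero ⟨hh, ht⟩ hr
  refine ⟨p * q₁ * r₁, by simp [hp, hq₁, hr₁], fun (g : Fin (∑ i, mu i) × β → ℂ) hg hpg => ?_⟩
  simp only [map_mul, ne_eq, mul_eq_zero, not_or] at hpg
  have hgt := hp' g hg hpg.1.1
  have hgf := (hq _).1 (hq₁' g ⟨hg, hgt⟩ hpg.1.2)
  have hmem := hr' _ hgf (hr₁' g ⟨hg, hgt⟩ hpg.2)
  have htop := (flagOfFrame_mem hγ hgf).2.1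
  rw [s.flagOfFrame_fibreFrame] at hmem htop
  exact ⟨hgt, hmem, htop⟩

include hβ hc hγ in
theorem flagReg_pullback {W : Set (Fin (n + 1) → Submodule ℂ (γ → ℂ))}
    {F : (Fin (n + 1) → Submodule ℂ (γ → ℂ)) → ℂ}
    (hF : FlagReg γ (fun j : Fin n => mu j.castSucc) W F) :
    FlagReg β mu (s.pullback W)
      fun V => F (s.fibreFlag (coords pos c (V (Fin.last n).castSucc)) V) := by
  intro h hh hhW
  have key : ∀ g : Fin (∑ i, mu i) × β → ℂ, g ∈ frames β mu →
      flagOfFrame β mu g ∈ s.pullback W →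
      s.fibreFrame (coords pos c (flagOfFrame β mu g (Fin.last n).castSucc)) g ∈
        frames γ (fun j : Fin n => mu j.castSucc) ∧
      flagOfFrame γ (fun j : Fin n => mu j.castSucc)
        (s.fibreFrame (coords pos c (flagOfFrame β mu g (Fin.last n).castSucc)) g) ∈ W := by
    rintro g - ⟨-, h2, h3⟩
    rw [← s.flagOfFrame_fibreFrame] at h2
    rw [← s.flagOfFrame_fibreFrame] at h3
    exact ⟨mem_frames_of_last_eq_top hγ h3, h2⟩
  have := RegAt.comp (S := {g | g ∈ frames β mu ∧ flagOfFrame β mu g ∈ s.pullback W})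
    (Φ := fun g => s.fibreFrame (coords pos c (flagOfFrame β mu g (Fin.last n).castSucc)) g)
    (hF _ (key h hh hhW).1 (key h hh hhW).2)
    (fun k => (s.regAt_fibreFrame hβ hc hh hhW.1 k).mono fun g hg => ⟨hg.1, hg.2.1⟩)
    ⟨hh, hhW⟩ fun g hg => key g hg.1 hg.2
  simpa only [flagOfFrame_fibreFrame] using this

/-- The frame over the point `u` of the cell obtained from a frame in the fibre. -/
def liftFrame (ec : Fin (mu (Fin.last n)) ≃ c) (u : CellIdx pos c → ℂ)
    (g : Fin (∑ i : Fin n, mu i.castSucc) × γ → ℂ) : Fin (∑ i, mu i) × β → ℂ :=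
  fun x => Sum.elim (fun l => s.ofFibre u fun k => g (l, k))
    (fun k => (s.A (-u)).mulVec (Pi.single (ec k).1 1)) (splitIdx mu x.1) x.2

theorem fibreFrame_liftFrame (ec : Fin (mu (Fin.last n)) ≃ c) (u : CellIdx pos c → ℂ)
    (g : Fin (∑ i : Fin n, mu i.castSucc) × γ → ℂ) :
    s.fibreFrame u (s.liftFrame ec u g) = g := by
  funext x
  simp only [fibreFrame, liftFrame, Equiv.apply_symm_apply, Sum.elim_inl]
  exact congrFun (s.toFibre_ofFibre u _) x.2

/-- Before the invertible matrix A(-u) is applied, the first vectors vanish on c and the others are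
the basis vectors in c, so the two spans are disjoint. -/
theorem liftFrame_mem (ec : Fin (mu (Fin.last n)) ≃ c) (u : CellIdx pos c → ℂ)
    {g : Fin (∑ i : Fin n, mu i.castSucc) × γ → ℂ}
    (hg : g ∈ frames γ (fun j : Fin n => mu j.castSucc)) :
    s.liftFrame ec u g ∈ frames β mu := by
  have hg' : LinearIndependent ℂ fun (l : Fin (∑ i : Fin n, mu i.castSucc)) (k : γ) => g (l, k) :=
    hg
  have hθ' : LinearMap.ker s.θ' = ⊥ :=
    LinearMap.ker_eq_bot.2 (Function.LeftInverse.injective (g := s.θ) s.θ_θ')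
  have hA : LinearMap.ker (s.A (-u)).mulVecLin = ⊥ := by
    refine LinearMap.ker_eq_bot.2 (Function.LeftInverse.injective (g := (s.A u).mulVec) ?_)
    intro v
    rw [Matrix.mulVecLin_apply, Matrix.mulVec_mulVec, s.inv', Matrix.one_mulVec]
  have h1 := hg'.map' s.θ' hθ'
  have h2 : LinearIndependent ℂ fun k => (Pi.single (ec k).1 1 : β → ℂ) :=
    (Pi.linearIndependent_single_one β ℂ).comp (fun k => (ec k).1)
      (Subtype.val_injective.comp ec.injective)
  have h3 := h1.sum_type h2 ?_
  · have h4 := (h3.map' _ hA).comp _ (splitIdx mu).injective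
    refine (congrArg (fun v => LinearIndependent ℂ v) ?_ :
      LinearIndependent ℂ _ = LinearIndependent ℂ
        fun (j : Fin (∑ i, mu i)) (b : β) => s.liftFrame ec u g (j, b)).mp h4
    funext j b
    rcases hj : splitIdx mu j with l | l <;> simp [liftFrame, hj, ofFibre]
  · rw [Submodule.disjoint_def]
    intro v hv hv'
    have hvc : ∀ b ∈ c, v b = 0 := by
      intro b hb
      have : Submodule.span ℂ (Set.range (s.θ' ∘ fun l k => g (l, k))) ≤
          LinearMap.ker (LinearMap.proj b : (β → ℂ) →ₗ[ℂ] ℂ) := by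
        rw [Submodule.span_le]
        rintro _ ⟨l, rfl⟩
        exact s.θ'_mem _ b hb
      exact this hv
    have hvc' : ∀ b ∉ c, v b = 0 := by
      intro b hb
      have : Submodule.span ℂ (Set.range fun k => (Pi.single (ec k).1 1 : β → ℂ)) ≤
          LinearMap.ker (LinearMap.proj b : (β → ℂ) →ₗ[ℂ] ℂ) := by
        rw [Submodule.span_le]
        rintro _ ⟨l, rfl⟩
        have : b ≠ (ec l).1 := fun h => hb (h ▸ (ec l).2)
        simp [this]
      exact this hv'
    funext b
    by_cases hb : b ∈ c
    exacts [hvc b hb, hvc' b hb]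

theorem flagOfFrame_liftFrame_last (ec : Fin (mu (Fin.last n)) ≃ c) (u : CellIdx pos c → ℂ)
    {g : Fin (∑ i : Fin n, mu i.castSucc) × γ → ℂ}
    (ht : flagOfFrame γ (fun j : Fin n => mu j.castSucc) g (Fin.last n) = ⊤) :
    flagOfFrame β mu (s.liftFrame ec u g) (Fin.last n).castSucc = cellSpace pos c u := by
  have hle : flagOfFrame β mu (s.liftFrame ec u g) (Fin.last n).castSucc ≤ cellSpace pos c u := by
    rw [flagOfFrame_last_castSucc, Submodule.span_le]
    rintro _ ⟨l, rfl⟩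
    simp only [liftFrame, Equiv.apply_symm_apply, Sum.elim_inl]
    exact s.ofFibre_mem u _
  refine le_antisymm hle fun v hv => ?_
  have := congrFun (s.flagOfFrame_fibreFrame u (s.liftFrame ec u g)) (Fin.last n)
  rw [s.fibreFrame_liftFrame, ht, fibreFlag] at this
  rw [← s.map_ofFibre_map_toFibre hle, ← this]
  exact ⟨_, trivial, s.ofFibre_toFibre hv⟩

include hβ hc hγ in
-- Over the Schubert cell the flags form a product, with coordinates u together with those of the
-- cell in the fibre. The inverse coordinates are regular because both kinds extend to open sets of
-- flags.
theorem isCell_cellOver {C : Set (Fin (n + 1) → Submodule ℂ (γ → ℂ))} {κ : Type}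
    (h : IsCell γ (fun j : Fin n => mu j.castSucc) C κ) :
    IsCell β mu (partialFlags β mu ∩ s.cellOver C) (CellIdx pos c ⊕ κ) := by
  obtain ⟨φ, e, h1, h2, h3, h4, h5, h6⟩ := h
  let ec : Fin (mu (Fin.last n)) ≃ c := (Fintype.equivFinOfCardEq (by simp [hc])).symm
  let ψ : (CellIdx pos c ⊕ κ → ℂ) → Fin (∑ i, mu i) × β → ℂ :=
    fun w => s.liftFrame ec (w ∘ Sum.inl) (φ (w ∘ Sum.inr))
  have htop : ∀ w, flagOfFrame γ (fun j : Fin n => mu j.castSucc) (φ w) (Fin.last n) = ⊤ :=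
    fun w => (flagOfFrame_mem hγ (h2 w)).2.1
  have hlast : ∀ w, flagOfFrame β mu (ψ w) (Fin.last n).castSucc =
      cellSpace pos c (w ∘ Sum.inl) := fun w => s.flagOfFrame_liftFrame_last ec _ (htop _)
  have hfib : ∀ w, s.fibreFlag (w ∘ Sum.inl) (flagOfFrame β mu (ψ w)) =
      flagOfFrame γ (fun j : Fin n => mu j.castSucc) (φ (w ∘ Sum.inr)) := by
    intro w
    rw [← s.flagOfFrame_fibreFrame, s.fibreFrame_liftFrame]
  have hψ : ∀ w, ψ w ∈ frames β mu := fun w => s.liftFrame_mem ec _ (h2 _)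
  refine ⟨ψ, fun V => Sum.elim (coords pos c (V (Fin.last n).castSucc))
    (e (s.fibreFlag (coords pos c (V (Fin.last n).castSucc)) V)), ?_, hψ, ?_, ?_, ?_, ?_⟩
  · rintro ⟨j, b⟩
    simp only [ψ, liftFrame]
    have hA : ∀ b b', IsPoly fun w : CellIdx pos c ⊕ κ → ℂ => s.A (-(w ∘ Sum.inl)) b b' :=
      fun b b' => (s.poly b b').comp (Φ := fun w => -(w ∘ Sum.inl))
        fun k => (isPoly_coord (Sum.inl k)).neg
    classical
    have hθ' : ∀ (w : γ → ℂ) (b : β), s.θ' w b = ∑ k, w k * s.θ' (Pi.single k 1) b := by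
      intro w b
      conv_lhs => rw [← Finset.univ_sum_single w]
      rw [map_sum, Finset.sum_apply]
      refine Finset.sum_congr rfl fun k _ => ?_
      rw [show (Pi.single k (w k) : γ → ℂ) = w k • Pi.single k 1 by
        rw [← Pi.single_smul, smul_eq_mul, mul_one], map_smul, Pi.smul_apply, smul_eq_mul]
    rcases hj : splitIdx mu j with l | l
    · simp only [Sum.elim_inl, ofFibre, LinearMap.comp_apply, Matrix.mulVecLin_apply,
        Matrix.mulVec, dotProduct]
      refine IsPoly.sum _ fun b' => (hA b b').mul ?_
      simp only [hθ' (fun k => φ _ (l, k))]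
      refine IsPoly.sum _ fun k => IsPoly.mul ?_ (isPoly_const _)
      exact (h1 (l, k)).comp (Φ := fun w : CellIdx pos c ⊕ κ → ℂ => w ∘ Sum.inr)
        fun k => isPoly_coord (Sum.inr k)
    · simp only [Sum.elim_inr, Matrix.mulVec, dotProduct]
      exact IsPoly.sum _ fun b' => (hA b b').mul (isPoly_const _)
  · exact fun w => ⟨flagOfFrame_mem hβ (hψ w), w ∘ Sum.inl, hlast w, by
      rw [hfib]
      exact h3 _⟩
  · intro w
    beta_reduce
    rw [hlast, coords_cellSpace, hfib, h4]
    funext x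
    cases x <;> rfl
  · rintro V ⟨hV, u, hu, hVC⟩
    have hcu : coords pos c (V (Fin.last n).castSucc) = u := by rw [hu, coords_cellSpace]
    beta_reduce
    rw [hcu]
    set w : CellIdx pos c ⊕ κ → ℂ := Sum.elim u (e (s.fibreFlag u V)) with hw
    have hwl : w ∘ Sum.inl = u := by funext x; simp [hw]
    have hwr : w ∘ Sum.inr = e (s.fibreFlag u V) := by funext x; simp [hw]
    have hl := hlast w
    have hf := hfib w
    rw [hwl] at hl hf
    rw [hwr, h5 _ hVC] at hf
    have hVw := flagOfFrame_mem hβ (hψ w)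
    -- Below the top term both flags lie in `cellSpace pos c u`, where `ofFibre` recovers each term
    -- from its image in the fibre.
    funext i
    induction i using Fin.lastCases with
    | last => rw [hVw.2.1, hV.2.1]
    | cast i =>
      have hle : i.castSucc ≤ (Fin.last n).castSucc := Fin.castSucc_le_castSucc_iff.2 i.le_last
      have e1 := le_of_mem_partialFlags hVw hle
      have e2 := le_of_mem_partialFlags hV hle
      rw [hl] at e1
      rw [hu] at e2
      rw [← s.map_ofFibre_map_toFibre e1, ← s.map_ofFibre_map_toFibre e2]
      exact congrArg (Submodule.map (s.ofFibre u)) (congrFun hf i)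
  · rintro V ⟨hV, u, hu, hVC⟩ (x | k)
    · refine ⟨_, _, flagOpen_isTransverse hβ hc, ?_,
        flagReg_graphCoord hβ hc x.1.1 x.1.2 x.2.2.1, fun V' _ _ => rfl⟩
      rw [Set.mem_ofPred_eq, hu]
      exact isTransverse_cellSpace pos c u
    · obtain ⟨W, F, hW, hVW, hF, hFe⟩ := h6 _ hVC k
      refine ⟨s.pullback W, _, s.flagOpen_pullback hβ hc hγ hW, (s.mem_pullback hu).2 hVW,
        s.flagReg_pullback hβ hc hγ hF, ?_⟩
      rintro V' ⟨hV', u', hu', hVC'⟩ hVW'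
      have hcu : coords pos c (V' (Fin.last n).castSucc) = u' := by rw [hu', coords_cellSpace]
      simp only [Sum.elim_inr, hcu]
      exact hFe _ hVC' ((s.mem_pullback hu').1 hVW')

end Trivialization

theorem FlagOpen.union {n : ℕ} {mu : Fin n → ℕ}
    {W W' : Set (Fin (n + 1) → Submodule ℂ (β → ℂ))}
    (h : FlagOpen β mu W) (h' : FlagOpen β mu W') : FlagOpen β mu (W ∪ W') := by
  rw [Set.union_eq_iUnion]
  exact FlagOpen.iUnion fun b => by cases b <;> assumption

/-- A set of flags is paved if its parts over the Schubert cells of a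
Grassmannian are paved in the fibre direction. -/
theorem isPaving_sigma (hβ : Fintype.card β = ∑ i, mu i) {Γ : Type} [Finite Γ]
    (le : Γ → Γ → Prop) (hle : IsPartialOrder Γ le) (pos : β → ℕ) (c : Γ → Finset β)
    (hc : ∀ a, (c a).card = mu (Fin.last n)) (γ : Γ → Type) [∀ a, Fintype (γ a)]
    (hγ : ∀ a, Fintype.card (γ a) = ∑ i : Fin n, mu i.castSucc)
    (s : ∀ a, Trivialization pos (c a) (γ a))
    (S : Set (Fin (n + 2) → Submodule ℂ (β → ℂ)))
    (M : ∀ a, Set (Fin (n + 1) → Submodule ℂ (γ a → ℂ)))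
    (hS : ∀ V, V ∈ S ↔ V ∈ partialFlags β mu ∧ ∃ a, V ∈ (s a).cellOver (M a))
    (hdisj : ∀ a b u u', cellSpace pos (c a) u = cellSpace pos (c b) u' → a = b)
    (hclosed : ∀ a, ∃ O, FlagOpen β mu O ∧ ∀ V ∈ S, V ∈ O ↔
      ∀ b u, le b a → V (Fin.last n).castSucc ≠ cellSpace pos (c b) u)
    (I : Γ → Type) (leI : ∀ a, I a → I a → Prop)
    (cell : ∀ a, I a → Set (Fin (n + 1) → Submodule ℂ (γ a → ℂ))) (dim : ∀ a, I a → ℕ)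
    (hI : ∀ a, IsPaving (γ a) (fun j : Fin n => mu j.castSucc) (M a) (leI a) (cell a) (dim a)) :
    IsPaving β mu S (Sigma.Lex (fun a b => le a b ∧ a ≠ b) leI)
      (fun x : Σ a, I a => partialFlags β mu ∩ (s x.1).cellOver (cell x.1 x.2))
      (fun x => Fintype.card (CellIdx pos (c x.1)) + dim x.1 x.2) := by
  have hcM : ∀ a i, cell a i ⊆ M a := fun a i => (hI a).cover ▸ Set.subset_iUnion (cell a) i
  refine ⟨?_, ?_, ?_, ?_, ?_, ?_⟩
  · have := fun a => (hI a).finite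
    infer_instance
  · have hp := fun a => (hI a).partialOrder
    refine { refl := ?_, trans := ?_, antisymm := ?_ }
    · exact fun ⟨a, i⟩ => .right i i ((hp a).refl i)
    · rintro _ _ _ (⟨i, j, h⟩ | ⟨i, j, h⟩) (⟨_, k, h'⟩ | ⟨_, k, h'⟩)
      · refine .left _ _ ⟨hle.trans _ _ _ h.1 h'.1, ?_⟩
        rintro rfl
        exact h.2 (hle.antisymm _ _ h.1 h'.1)
      · exact .left _ _ h
      · exact .left _ _ h'
      · exact .right _ _ ((hp _).trans _ _ _ h h')
    · rintro _ _ (⟨i, j, h⟩ | ⟨i, j, h⟩) h'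
      · rcases h' with ⟨_, _, h'⟩ | ⟨_, _, h'⟩
        · exact (h.2 (hle.antisymm _ _ h.1 h'.1)).elim
        · exact (h.2 rfl).elim
      · rcases h' with ⟨_, _, h'⟩ | ⟨_, _, h'⟩
        · exact (h'.2 rfl).elim
        · rw [(hp _).antisymm _ _ h h']
  · rintro ⟨a, i⟩ ⟨b, j⟩ hne
    rw [Set.disjoint_left]
    rintro V ⟨-, u, hu, hV⟩ ⟨-, u', hu', hV'⟩
    obtain rfl := hdisj a b u u' (hu.symm.trans hu')
    obtain rfl := cellSpace_injective pos _ (hu.symm.trans hu')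
    refine Set.disjoint_left.1 ((hI a).disjoint i j ?_) hV hV'
    rintro rfl
    exact hne rfl
  · ext V
    rw [hS, Set.mem_iUnion]
    constructor
    · rintro ⟨⟨a, i⟩, hV, u, hu, hVC⟩
      exact ⟨hV, a, u, hu, hcM a i hVC⟩
    · rintro ⟨hV, a, u, hu, hVM⟩
      rw [← (hI a).cover] at hVM
      obtain ⟨i, hi⟩ := Set.mem_iUnion.1 hVM
      exact ⟨⟨a, i⟩, hV, u, hu, hi⟩
  · rintro ⟨a, i⟩
    choose O hO hOS using hclosed
    obtain ⟨P, hP, hPM⟩ := (hI a).closed i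
    -- A flag in the stratum b lies in O b' exactly when b is not below b'. So O a contains all
    -- strata not below a, the intersection removes those strictly below a, and on the stratum a
    -- itself the set is the condition P of the fibre.
    refine ⟨O a ∪ ((s a).pullback P ∩ ⋂ b : {b // le b a ∧ b ≠ a}, O b.1),
      (hO a).union (((s a).flagOpen_pullback hβ (hc a) (hγ a) hP).inter
        (FlagOpen.iInter fun b => hO b.1)), fun V hVS => ?_⟩
    obtain ⟨hV, b, u, hu, hVM⟩ := (hS V).1 hVS
    have hOV : ∀ b', V ∈ O b' ↔ ¬ le b b' := by
      intro b'
      rw [hOS b' V hVS]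
      refine ⟨fun h hb => h b u hb hu, fun h b'' u' hb'' hu' => ?_⟩
      obtain rfl := hdisj b b'' u u' (hu.symm.trans hu')
      exact h hb''
    have hcell : ∀ b' j, V ∈ partialFlags β mu ∩ (s b').cellOver (cell b' j) → b = b' := by
      rintro b' j ⟨-, u', hu', -⟩
      exact hdisj b b' u u' (hu.symm.trans hu')
    by_cases hba : b = a
    · subst hba
      have h1 : V ∉ O b := fun h => (hOV b).1 h (hle.refl b)
      have h2 : V ∈ ⋂ b' : {b' // le b' b ∧ b' ≠ b}, O b'.1 := by
        refine Set.mem_iInter.2 fun b' => (hOV b'.1).2 fun h => ?_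
        exact b'.2.2 (hle.antisymm _ _ b'.2.1 h)
      rw [Set.mem_union, Set.mem_inter_iff, (s b).mem_pullback hu, hPM _ hVM]
      constructor
      · rintro (h | ⟨h, -⟩)
        · exact (h1 h).elim
        · rintro ⟨b', j⟩ hj hVj
          obtain rfl := hcell b' j hVj
          obtain ⟨-, u', hu', hVj⟩ := hVj
          obtain rfl := cellSpace_injective pos _ (hu.symm.trans hu')
          rcases hj with ⟨_, _, hj⟩ | ⟨_, _, hj⟩
          · exact hj.2 rfl
          · exact h j hj hVj
      · refine fun h => Or.inr ⟨fun j hj hVj => ?_, h2⟩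
        exact h ⟨b, j⟩ (.right _ _ hj) ⟨hV, u, hu, hVj⟩
    · have h2 : V ∈ O a ∪ ((s a).pullback P ∩ ⋂ b : {b // le b a ∧ b ≠ a}, O b.1) ↔
          ¬ le b a := by
        rw [Set.mem_union, hOV]
        refine ⟨?_, Or.inl⟩
        rintro (h | ⟨-, h⟩)
        · exact h
        · intro hb
          exact (hOV b).1 (Set.mem_iInter.1 h ⟨b, hb, hba⟩) (hle.refl b)
      rw [h2]
      constructor
      · rintro h ⟨b', j⟩ hj hVj
        obtain rfl := hcell b' j hVj
        rcases hj with ⟨_, _, hj⟩ | ⟨_, _, hj⟩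
        · exact h hj.1
        · exact hba rfl
      · intro h hb
        rw [← (hI b).cover] at hVM
        obtain ⟨j, hj⟩ := Set.mem_iUnion.1 hVM
        exact h ⟨b, j⟩ (.left _ _ ⟨hb, hba⟩) ⟨hV, u, hu, hj⟩
  · rintro ⟨a, i⟩
    refine ((s a).isCell_cellOver hβ (hc a) (hγ a) ((hI a).isCell i)).congr ?_
    exact ((Fintype.equivFin _).sumCongr (Equiv.refl _)).trans finSumFinEquiv

/-- Transport of a paving along a bijection of index sets. -/
theorem IsPaving.reindex {n : ℕ} {mu : Fin n → ℕ}
    {S : Set (Fin (n + 1) → Submodule ℂ (β → ℂ))} {I I' : Type}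
    {le : I → I → Prop} {le' : I' → I' → Prop}
    {cell : I → Set (Fin (n + 1) → Submodule ℂ (β → ℂ))}
    {cell' : I' → Set (Fin (n + 1) → Submodule ℂ (β → ℂ))} {dim : I → ℕ} {dim' : I' → ℕ}
    (h : IsPaving β mu S le cell dim) (σ : I' ≃ I) (hle : ∀ i j, le' i j ↔ le (σ i) (σ j))
    (hcell : ∀ i, cell' i = cell (σ i)) (hdim : ∀ i, dim' i = dim (σ i)) :
    IsPaving β mu S le' cell' dim' := by
  obtain ⟨h1, h2, h3, h4, h5, h6⟩ := h
  refine ⟨Finite.of_equiv I σ.symm, ?_, ?_, ?_, ?_, ?_⟩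
  · refine { refl := ?_, trans := ?_, antisymm := ?_ }
    · exact fun i => (hle i i).2 (h2.refl _)
    · exact fun i j k hij hjk => (hle i k).2 (h2.trans _ _ _ ((hle i j).1 hij) ((hle j k).1 hjk))
    · exact fun i j hij hji => σ.injective (h2.antisymm _ _ ((hle i j).1 hij) ((hle j i).1 hji))
  · intro i j hij
    rw [hcell, hcell]
    exact h3 _ _ (σ.injective.ne hij)
  · rw [← h4]
    simp only [hcell]
    exact σ.surjective.iUnion_comp cell
  · intro i
    obtain ⟨O, hO, hOS⟩ := h5 (σ i)
    refine ⟨O, hO, fun V hV => (hOS V hV).trans ⟨fun h j hj => ?_, fun h j hj => ?_⟩⟩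
    · rw [hcell]
      exact h _ ((hle j i).1 hj)
    · have := h (σ.symm j) ((hle _ _).2 (by simpa using hj))
      rwa [hcell, σ.apply_symm_apply] at this
  · intro i
    rw [hcell, hdim]
    exact h6 _

end Transfer

/-! ### The decomposition of a Grassmannian into Schubert cells -/

section Echelon

variable {β : Type} [Fintype β] [DecidableEq β] {pos : β → ℕ}

/-- The positions of the first non-zero entries of the vectors in `K`. -/
noncomputable def leads (pos : β → ℕ) (K : Submodule ℂ (β → ℂ)) : Finset β :=
  open Classical in
  Finset.univ.filter fun b => ∃ v ∈ K, v b ≠ 0 ∧ ∀ b', pos b' < pos b → v b' = 0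

theorem mem_leads {K : Submodule ℂ (β → ℂ)} {b : β} :
    b ∈ leads pos K ↔ ∃ v ∈ K, v b ≠ 0 ∧ ∀ b', pos b' < pos b → v b' = 0 := by
  simp [leads]

/-- Otherwise the first non-zero entry of v would sit at a lead. -/
theorem eq_zero_of_leads {K : Submodule ℂ (β → ℂ)} {v : β → ℂ} (hv : v ∈ K)
    (h0 : ∀ b ∈ leads pos K, v b = 0) : v = 0 := by
  by_contra hne
  obtain ⟨b₀, hb₀⟩ := Function.ne_iff.1 hne
  obtain ⟨b, hb, hmin⟩ := Finset.exists_min_image (Finset.univ.filter fun b => v b ≠ 0) pos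
    ⟨b₀, by simpa using hb₀⟩
  have hvb : v b ≠ 0 := by simpa using hb
  refine hvb (h0 b (mem_leads.2 ⟨v, hv, hvb, fun b' hb' => ?_⟩))
  by_contra hvb'
  have := hmin b' (by simpa using hvb')
  omega

/-- The vectors of the reduced echelon basis. -/
theorem exists_reduced (hpos : Function.Injective pos) (K : Submodule ℂ (β → ℂ)) :
    ∃ w : β → β → ℂ, ∀ j ∈ leads pos K, w j ∈ K ∧ (∀ b', pos b' < pos j → w j b' = 0) ∧
      ∀ j' ∈ leads pos K, w j j' = if j' = j then 1 else 0 := by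
  suffices h : ∀ j, ∃ w : β → ℂ, j ∈ leads pos K → w ∈ K ∧ (∀ b', pos b' < pos j → w b' = 0) ∧
      ∀ j' ∈ leads pos K, w j' = if j' = j then 1 else 0 by
    choose w hw using h
    exact ⟨w, hw⟩
  obtain ⟨N, hN⟩ : ∃ N, ∀ b, pos b ≤ N := ⟨Finset.univ.sup pos, fun b =>
    Finset.le_sup (Finset.mem_univ b)⟩
  intro j
  -- Descending induction on the position: reduced vectors with later leads are available and do not
  -- disturb the entries up to j.
  induction hm : N - pos j using Nat.strong_induction_on generalizing j with
  | _ m ih =>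
  by_cases hj : j ∈ leads pos K
  swap
  · exact ⟨0, fun h => (hj h).elim⟩
  obtain ⟨v, hv, hvj, hv0⟩ := mem_leads.1 hj
  have hind : ∀ j', ∃ w : β → ℂ, pos j < pos j' → j' ∈ leads pos K →
      w ∈ K ∧ (∀ b', pos b' < pos j' → w b' = 0) ∧
      ∀ j'' ∈ leads pos K, w j'' = if j'' = j' then 1 else 0 := by
    intro j'
    by_cases hlt : pos j < pos j'
    · have := hN j'
      obtain ⟨w, hw⟩ := ih (N - pos j') (by omega) j' rfl
      exact ⟨w, fun _ => hw⟩
    · exact ⟨0, fun h => (hlt h).elim⟩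
  choose w hw using hind
  set L := (leads pos K).filter fun j' => pos j < pos j' with hL
  have hmem : ∀ j' ∈ L, pos j < pos j' ∧ j' ∈ leads pos K := by
    intro j' hj'
    rw [hL, Finset.mem_filter] at hj'
    exact ⟨hj'.2, hj'.1⟩
  have hsum : ∀ b, (∑ j' ∈ L, (v j)⁻¹ • v j' • w j') b =
      ∑ j' ∈ L, (v j)⁻¹ * (v j' * w j' b) := by
    intro b
    simp [Finset.sum_apply]
  -- Normalise v at j and clear its entries at the later leads.
  refine ⟨(v j)⁻¹ • v - ∑ j' ∈ L, (v j)⁻¹ • v j' • w j', fun _ => ⟨?_, ?_, ?_⟩⟩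
  · refine K.sub_mem (K.smul_mem _ hv) (K.sum_mem fun j' hj' => ?_)
    have := hmem j' hj'
    exact K.smul_mem _ (K.smul_mem _ (hw j' this.1 this.2).1)
  · intro b hb
    rw [Pi.sub_apply, hsum, Pi.smul_apply, hv0 b hb, smul_zero, zero_sub, neg_eq_zero]
    refine Finset.sum_eq_zero fun j' hj' => ?_
    have := hmem j' hj'
    rw [(hw j' this.1 this.2).2.1 b (hb.trans this.1), mul_zero, mul_zero]
  · intro b hb
    rw [Pi.sub_apply, hsum, Pi.smul_apply, smul_eq_mul]
    rw [Finset.sum_congr rfl fun j' hj' => by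
      rw [(hw j' (hmem j' hj').1 (hmem j' hj').2).2.2 b hb]]
    simp only [mul_ite, mul_one, mul_zero, Finset.sum_ite_eq]
    by_cases hbj : b = j
    · subst hbj
      rw [if_neg (fun h => lt_irrefl _ (hmem _ h).1), if_pos rfl, sub_zero, inv_mul_cancel₀ hvj]
    · rw [if_neg hbj]
      by_cases hlt : pos j < pos b
      · rw [if_pos (by rw [hL, Finset.mem_filter]; exact ⟨hb, hlt⟩), sub_self]
      · rw [if_neg (fun h => hlt (hmem _ h).1), hv0 b, mul_zero, sub_zero]
        have := hpos.ne hbj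
        omega

theorem exists_mem_cellSpace {c : Finset β} (u : CellIdx pos c → ℂ) {j : β} (hj : j ∉ c) :
    ∃ v ∈ cellSpace pos c u, (∀ b ∉ c, v b = if b = j then 1 else 0) ∧
      ∀ b, pos b < pos j → v b = 0 := by
  let v : β → ℂ := fun b =>
    if b ∈ c then -∑ y : CellIdx pos c, (if y.1.1 = b ∧ y.1.2 = j then u y else 0)
    else if b = j then 1 else 0
  have hv1 : ∀ b ∉ c, v b = if b = j then 1 else 0 := fun b hb => if_neg hb
  have hv2 : ∀ b ∈ c,
      v b = -∑ y : CellIdx pos c, (if y.1.1 = b ∧ y.1.2 = j then u y else 0) :=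
    fun b hb => if_pos hb
  refine ⟨v, fun i hi => ?_, hv1, fun b hb => ?_⟩
  · rw [hv2 i hi, neg_add_eq_zero]
    refine Finset.sum_congr rfl fun y _ => ?_
    rw [hv1 _ y.2.2.1]
    split_ifs <;> simp_all
  · by_cases hbc : b ∈ c
    · rw [hv2 b hbc, neg_eq_zero]
      refine Finset.sum_eq_zero fun y _ => if_neg ?_
      rintro ⟨h1, h2⟩
      have := y.2.2.2
      rw [h1, h2] at this
      omega
    · rw [hv1 b hbc, if_neg]
      rintro rfl
      omega

/-- If all entries before a position i ∈ c vanish, the equation at i gives v i = 0, so no lead lies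
in c. Thus c can be recovered from the subspace, and distinct Schubert cells are disjoint. -/
theorem leads_cellSpace (c : Finset β) (u : CellIdx pos c → ℂ) :
    leads pos (cellSpace pos c u) = cᶜ := by
  ext b
  rw [mem_leads, Finset.mem_compl]
  constructor
  · rintro ⟨v, hv, hvb, hv0⟩ hb
    have := hv b hb
    rw [Finset.sum_eq_zero, add_zero] at this
    · exact hvb this
    · intro x _
      split_ifs with hx
      · rw [hv0 _ (by rw [← hx]; exact x.2.2.2), mul_zero]
      · rfl
  · intro hb
    obtain ⟨v, hv, hv1, hv0⟩ := exists_mem_cellSpace u hb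
    exact ⟨v, hv, by rw [hv1 b hb, if_pos rfl]; exact one_ne_zero, hv0⟩

theorem cellSpace_eq_imp {c c' : Finset β} {u : CellIdx pos c → ℂ} {u' : CellIdx pos c' → ℂ}
    (h : cellSpace pos c u = cellSpace pos c' u') : c = c' := by
  have := congrArg (leads pos) h
  rwa [leads_cellSpace, leads_cellSpace, compl_inj_iff] at this

theorem sum_cellIdx {c : Finset β} {i : β} (hi : i ∈ c) (F : β → ℂ) :
    ∑ x : CellIdx pos c, (if x.1.1 = i then F x.1.2 else 0) =
      ∑ j with j ∉ c ∧ pos j < pos i, F j := by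
  rw [← Finset.sum_filter]
  refine Finset.sum_nbij (fun x => x.1.2) ?_ ?_ ?_ fun x _ => rfl
  · intro x hx
    have hx1 := (Finset.mem_filter.1 hx).2
    exact Finset.mem_filter.2 ⟨Finset.mem_univ _, x.2.2.1, hx1 ▸ x.2.2.2⟩
  · intro x hx y hy hxy
    have hx1 := (Finset.mem_filter.1 hx).2
    have hy1 := (Finset.mem_filter.1 hy).2
    exact Subtype.ext (Prod.ext (hx1.trans hy1.symm) hxy)
  · intro j hj
    have hj1 := (Finset.mem_filter.1 hj).2
    exact ⟨⟨(i, j), hi, hj1⟩, by simp, rfl⟩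

/-- Expanding v in the reduced basis w expresses its entry at a non-lead i through its entries at
the leads. Only leads before i contribute, so this is the equation of the cell with coordinates the
negatives of the entries of w. -/
theorem exists_eq_cellSpace (hpos : Function.Injective pos) (K : Submodule ℂ (β → ℂ)) :
    ∃ u, K = cellSpace pos (leads pos K)ᶜ u := by
  obtain ⟨w, hw⟩ := exists_reduced hpos K
  refine ⟨fun x => -w x.1.2 x.1.1, ?_⟩
  have hcomb : ∀ v ∈ K, v = ∑ j ∈ leads pos K, v j • w j := by
    intro v hv
    refine sub_eq_zero.1 (eq_zero_of_leads (pos := pos) (K.sub_mem hv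
      (K.sum_mem fun j hj => K.smul_mem _ (hw j hj).1)) fun b hb => ?_)
    rw [Pi.sub_apply, Finset.sum_apply, Finset.sum_congr rfl fun j hj => by
      rw [Pi.smul_apply, (hw j hj).2.2 b hb]]
    simp [hb]
  have hle : K ≤ cellSpace pos (leads pos K)ᶜ fun x => -w x.1.2 x.1.1 := by
    intro v hv i hi
    have hi' : i ∉ leads pos K := Finset.mem_compl.1 hi
    conv_lhs => enter [1]; rw [hcomb v hv]
    rw [Finset.sum_apply, add_eq_zero_iff_eq_neg, ← Finset.sum_neg_distrib]
    have h1 : ∀ x : CellIdx pos (leads pos K)ᶜ,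
        -(if x.1.1 = i then -w x.1.2 x.1.1 * v x.1.2 else 0) =
          if x.1.1 = i then v x.1.2 * w x.1.2 i else 0 := by
      intro x
      split_ifs with hx
      · rw [hx]
        ring
      · exact neg_zero
    simp only [h1]
    rw [sum_cellIdx hi fun j => v j * w j i]
    symm
    refine Finset.sum_subset_zero_on_sdiff (fun j hj => ?_) (fun j hj => ?_) fun j _ => rfl
    · simpa using (Finset.mem_filter.1 hj).2.1
    · obtain ⟨hj1, hj2⟩ := Finset.mem_sdiff.1 hj
      have hne : i ≠ j := fun h => hi' (h ▸ hj1)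
      have := hpos.ne hne
      rw [Pi.smul_apply, (hw j hj1).2.1 i, smul_zero]
      by_contra hlt
      exact hj2 (Finset.mem_filter.2 ⟨Finset.mem_univ _, by simpa using hj1, by omega⟩)
  refine le_antisymm hle fun v hv => ?_
  have hw' : ∑ j ∈ leads pos K, v j • w j ∈ K :=
    K.sum_mem fun j hj => K.smul_mem _ (hw j hj).1
  have := isTransverse_cellSpace pos _ _ _ (Submodule.sub_mem _ hv (hle hw')) fun b hb => by
    have hb' : b ∈ leads pos K := by simpa using hb
    rw [Pi.sub_apply, Finset.sum_apply, Finset.sum_congr rfl fun j hj => by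
      rw [Pi.smul_apply, (hw j hj).2.2 b hb']]
    simp [hb']
  rw [sub_eq_zero.1 this]
  exact hw'

theorem finrank_cellSpace (c : Finset β) (u : CellIdx pos c → ℂ) :
    Module.finrank ℂ (cellSpace pos c u) = (cᶜ).card := by
  let L : cellSpace pos c u →ₗ[ℂ] ({b // b ∉ c} → ℂ) :=
    (LinearMap.funLeft ℂ ℂ Subtype.val) ∘ₗ (cellSpace pos c u).subtype
  have hL : Function.Bijective L := by
    constructor
    · rw [injective_iff_map_eq_zero]
      exact fun v hv => Subtype.ext (isTransverse_cellSpace pos c u v.1 v.2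
        fun j hj => congrFun hv ⟨j, hj⟩)
    · intro g
      choose w hw hw' using fun j : {b // b ∉ c} => exists_mem_cellSpace u j.2
      refine ⟨∑ j, g j • ⟨w j, hw j⟩, ?_⟩
      funext b
      rw [map_sum, Finset.sum_apply, Finset.sum_eq_single b]
      · simp [L, LinearMap.funLeft, (hw' b).1 b.1 b.2]
      · intro j _ hj
        have : b.1 ≠ j.1 := fun h => hj (Subtype.ext h.symm)
        simp [L, LinearMap.funLeft, (hw' j).1 b.1 b.2, this]
      · simp
  rw [(LinearEquiv.ofBijective L hL).finrank_eq, Module.finrank_pi, Fintype.card_subtype_compl,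
    Finset.card_compl, Fintype.card_coe]

theorem card_leads (hpos : Function.Injective pos) (K : Submodule ℂ (β → ℂ)) :
    (leads pos K).card = Module.finrank ℂ K := by
  obtain ⟨u, hu⟩ := exists_eq_cellSpace hpos K
  conv_rhs => rw [hu]
  rw [finrank_cellSpace, compl_compl]

/-- The Bruhat order on the subsets of an ordered set. -/
def BruhatLE (pos : β → ℕ) (c c' : Finset β) : Prop :=
  ∀ m, (c'.filter fun b => pos b < m).card ≤ (c.filter fun b => pos b < m).card

theorem BruhatLE.refl (c : Finset β) : BruhatLE pos c c := fun _ => le_rfl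

theorem BruhatLE.trans {c c' c'' : Finset β} (h : BruhatLE pos c c') (h' : BruhatLE pos c' c'') :
    BruhatLE pos c c'' := fun m => (h' m).trans (h m)

theorem BruhatLE.antisymm (hpos : Function.Injective pos) {c c' : Finset β}
    (h : BruhatLE pos c c') (h' : BruhatLE pos c' c) : c = c' := by
  -- Two consecutive counts differ by the membership of the element at that position, so the counts
  -- determine the set.
  have key : ∀ (c : Finset β) (b : β), (c.filter fun b' => pos b' < pos b + 1).card =
      (c.filter fun b' => pos b' < pos b).card + if b ∈ c then 1 else 0 := by
    intro c b
    have : (c.filter fun b' => pos b' < pos b + 1) =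
        (c.filter fun b' => pos b' < pos b) ∪ (if b ∈ c then {b} else ∅) := by
      ext b'
      simp only [Finset.mem_filter, Finset.mem_union, Nat.lt_succ_iff_lt_or_eq, hpos.eq_iff]
      split_ifs with hb <;> simp only [Finset.mem_singleton, Finset.notMem_empty] <;> grind
    rw [this, Finset.card_union_of_disjoint]
    · split_ifs <;> simp
    · rw [Finset.disjoint_left]
      intro b' hb'
      split_ifs <;> grind
  ext b
  have h1 := key c b
  have h2 := key c' b
  have h3 := le_antisymm (h (pos b)) (h' (pos b))
  have h4 := le_antisymm (h (pos b + 1)) (h' (pos b + 1))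
  split_ifs at h1 h2 <;> first | tauto | omega

/-- The reduced vectors with leads at positions ≥ m vanish before m, so by transversality they stay
independent after restriction to the positions ≥ m outside c. This bounds the number of such leads.
Passing to complements and to positions < m reverses the inequality. -/
theorem bruhatLE_of_isTransverse (hpos : Function.Injective pos) {c : Finset β}
    {K : Submodule ℂ (β → ℂ)} (hK : IsTransverse c K) (hc : c.card = (leads pos K)ᶜ.card) :
    BruhatLE pos c (leads pos K)ᶜ := by
  obtain ⟨w, hw⟩ := exists_reduced hpos K
  intro m
  have key : ((leads pos K).filter fun b => ¬ pos b < m).card ≤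
      (cᶜ.filter fun b => ¬ pos b < m).card := by
    have hli : LinearIndependent ℂ fun (j : (leads pos K).filter fun b => ¬ pos b < m)
        (b : cᶜ.filter fun b => ¬ pos b < m) => w j.1 b.1 := by
      rw [Fintype.linearIndependent_iff]
      intro a ha j
      have hmem : ∀ j : (leads pos K).filter fun b => ¬ pos b < m,
          j.1 ∈ leads pos K ∧ ¬ pos j.1 < m := fun j => Finset.mem_filter.1 j.2
      have h0 := hK (∑ j, a j • w j.1)
        (K.sum_mem fun j _ => K.smul_mem _ (hw j.1 (hmem j).1).1) fun b hb => by
          by_cases hbm : pos b < m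
          · rw [Finset.sum_apply]
            refine Finset.sum_eq_zero fun j _ => ?_
            have := (hmem j).2
            rw [Pi.smul_apply, (hw j.1 (hmem j).1).2.1 b (by omega), smul_zero]
          · have := congrFun ha ⟨b, Finset.mem_filter.2 ⟨Finset.mem_compl.2 hb, hbm⟩⟩
            simpa [Finset.sum_apply] using this
      have := congrFun h0 j.1
      rw [Finset.sum_apply, Finset.sum_congr rfl fun j' _ => by
        rw [Pi.smul_apply, (hw j'.1 (hmem j').1).2.2 j.1 (hmem j).1]] at this
      simpa [Subtype.ext_iff.symm] using this
    have := hli.fintype_card_le_finrank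
    rwa [Module.finrank_pi, Fintype.card_coe, Fintype.card_coe] at this
  have h1 := Finset.card_filter_add_card_filter_not (s := c) fun b => pos b < m
  have h2 := Finset.card_filter_add_card_filter_not (s := (leads pos K)ᶜ) fun b => pos b < m
  have h3 : ∀ c : Finset β, (c.filter fun b => ¬ pos b < m).card +
      (cᶜ.filter fun b => ¬ pos b < m).card =
      ((Finset.univ : Finset β).filter fun b => ¬ pos b < m).card := by
    intro c
    rw [← Finset.card_union_of_disjoint, ← Finset.filter_union, Finset.union_compl]
    exact Finset.disjoint_filter_filter disjoint_compl_right
  have h4 := h3 c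
  have h5 := h3 (leads pos K)
  omega

variable {n : ℕ} {mu : Fin (n + 1) → ℕ} (hβ : Fintype.card β = ∑ i, mu i)

include hβ in
theorem card_compl_leads (hpos : Function.Injective pos) {V : Fin (n + 2) → Submodule ℂ (β → ℂ)}
    (hV : V ∈ partialFlags β mu) :
    (leads pos (V (Fin.last n).castSucc))ᶜ.card = mu (Fin.last n) := by
  rw [Finset.card_compl, card_leads hpos, finrank_of_mem_partialFlags hV, hβ, partialSum_castSucc,
    Fin.val_last, partialSum_last, Fin.sum_univ_castSucc, Nat.add_sub_cancel_left]

include hβ in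
-- The open set is the union of the transverse loci of all c not below a. A flag in the stratum b is
-- transverse to b, and only to sets below b among those of the same size, so it meets the union
-- exactly when b is not below a.
theorem exists_flagOpen_lower (hpos : Function.Injective pos) (a : Finset β) :
    ∃ O, FlagOpen β mu O ∧ ∀ V ∈ partialFlags β mu, V ∈ O ↔
      ∀ b u, BruhatLE pos b a → V (Fin.last n).castSucc ≠ cellSpace pos b u := by
  refine ⟨⋃ c : {c : Finset β // c.card = mu (Fin.last n) ∧ ¬ BruhatLE pos c a},
    {V | IsTransverse c.1 (V (Fin.last n).castSucc)},
    FlagOpen.iUnion fun c => flagOpen_isTransverse hβ c.2.1, fun V hV => ?_⟩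
  have hcard := card_compl_leads (pos := pos) hβ hpos hV
  rw [Set.mem_iUnion]
  constructor
  · rintro ⟨c, hc⟩ b u hb hu
    have := bruhatLE_of_isTransverse hpos hc (c.2.1.trans hcard.symm)
    rw [hu, leads_cellSpace, compl_compl] at this
    exact c.2.2 (this.trans hb)
  · intro h
    obtain ⟨u, hu⟩ := exists_eq_cellSpace hpos (V (Fin.last n).castSucc)
    refine ⟨⟨_, hcard, fun hle => h _ u hle hu⟩, ?_⟩
    rw [Set.mem_ofPred_eq]
    conv_rhs => rw [hu]
    exact isTransverse_cellSpace pos _ u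

end Echelon

/-! ### Pavings of partial flag varieties -/

section Full

variable {n : ℕ} {β γ : Type} [Fintype β] [DecidableEq β] [Fintype γ] {pos : β → ℕ}
  {c : Finset β}

theorem Trivialization.fibreFlag_mem (s : Trivialization pos c γ) {mu : Fin (n + 1) → ℕ}
    {V : Fin (n + 2) → Submodule ℂ (β → ℂ)} (hV : V ∈ partialFlags β mu)
    {u : CellIdx pos c → ℂ} (hu : V (Fin.last n).castSucc = cellSpace pos c u) :
    s.fibreFlag u V ∈ partialFlags γ fun i : Fin n => mu i.castSucc := by
  have hle : ∀ i : Fin (n + 1), V i.castSucc ≤ cellSpace pos c u := fun i =>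
    hu ▸ le_of_mem_partialFlags hV (Fin.castSucc_le_castSucc_iff.2 i.le_last)
  have hrank : ∀ i, Module.finrank ℂ (s.fibreFlag u V i) =
      Module.finrank ℂ (V (Fin.castSucc i)) := by
    intro i
    refine le_antisymm (Submodule.finrank_map_le _ _) ?_
    conv_lhs => rw [← s.map_ofFibre_map_toFibre (hle i)]
    exact Submodule.finrank_map_le _ _
  refine ⟨?_, ?_, fun i => ⟨?_, ?_⟩⟩
  · rw [fibreFlag, show Fin.castSucc (0 : Fin (n + 1)) = 0 from rfl, hV.1, Submodule.map_bot]
  · rw [eq_top_iff, fibreFlag, hu]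
    exact fun w _ => ⟨_, s.ofFibre_mem u w, s.toFibre_ofFibre u w⟩
  · exact Submodule.map_mono (le_of_mem_partialFlags hV
      (Fin.castSucc_le_castSucc_iff.2 (Fin.castSucc_lt_succ).le))
  · rw [hrank, hrank]
    exact (hV.2.2 i.castSucc).2

/-- The matrix with ones on the diagonal and some of the coordinates `u` at other places. -/
def coefMatrix (coef : β → β → Option (CellIdx pos c)) (u : CellIdx pos c → ℂ) : Matrix β β ℂ :=
  1 + Matrix.of fun b b' => (coef b b').elim 0 u

theorem isPoly_coefMatrix (coef : β → β → Option (CellIdx pos c)) (b b' : β) :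
    IsPoly fun u => coefMatrix coef u b b' := by
  simp only [coefMatrix, Matrix.add_apply, Matrix.of_apply]
  refine (isPoly_const _).add ?_
  cases coef b b' with
  | none => exact isPoly_const 0
  | some x => exact isPoly_coord x

/-- The hypothesis says that the part N off the identity has square zero. As N is linear in u, the
claim is (1 - N)(1 + N) = 1. -/
theorem coefMatrix_neg_mul {coef : β → β → Option (CellIdx pos c)}
    (h : ∀ b b' b'' x, coef b b' = some x → coef b' b'' = none) (u : CellIdx pos c → ℂ) :
    coefMatrix coef (-u) * coefMatrix coef u = 1 := by
  set N : Matrix β β ℂ := Matrix.of fun b b' => (coef b b').elim 0 u with hN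
  have hneg : (Matrix.of fun b b' => (coef b b').elim 0 (-u) : Matrix β β ℂ) = -N := by
    ext b b'
    cases hb : coef b b' <;> simp [hN, hb]
  have hNN : N * N = 0 := by
    ext b b''
    rw [Matrix.mul_apply, Matrix.zero_apply]
    refine Finset.sum_eq_zero fun b' _ => ?_
    cases hb : coef b b' with
    | none => simp [hN, hb]
    | some x => simp [hN, h b b' b'' x hb]
  rw [coefMatrix, coefMatrix, hneg, ← hN, add_mul, mul_add, mul_add, neg_mul, neg_mul, hNN]
  simp

theorem coefMatrix_mulVec {coef : β → β → Option (CellIdx pos c)} {i : β}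
    (h : ∀ j x, coef i j = some x ↔ x.1 = (i, j)) (u : CellIdx pos c → ℂ) (v : β → ℂ) :
    (coefMatrix coef u).mulVec v i =
      v i + ∑ x : CellIdx pos c, if x.1.1 = i then u x * v x.1.2 else 0 := by
  rw [coefMatrix, Matrix.add_mulVec, Matrix.one_mulVec, Pi.add_apply]
  congr 1
  simp only [Matrix.mulVec, dotProduct, Matrix.of_apply]
  have h1 : ∀ j, (coef i j).elim 0 u * v j =
      ∑ x : CellIdx pos c, if x.1 = (i, j) then u x * v j else 0 := by
    intro j
    cases hj : coef i j with
    | none =>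
      rw [Finset.sum_eq_zero, Option.elim_none, zero_mul]
      intro x _
      rw [if_neg]
      rw [← h, hj]
      simp
    | some x =>
      rw [Finset.sum_eq_single x, Option.elim_some, if_pos ((h j x).1 hj)]
      · intro y _ hy
        rw [if_neg]
        exact fun hy' => hy (Subtype.ext (hy'.trans ((h j x).1 hj).symm))
      · simp
  simp only [h1]
  rw [Finset.sum_comm]
  refine Finset.sum_congr rfl fun x _ => ?_
  simp only [Prod.ext_iff, ite_and]
  rw [Finset.sum_ite_irrel]
  simp

/-- The trivialisation over the Schubert cell given by unipotent matrices. -/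
def Trivialization.ofCoef (coef : β → β → Option (CellIdx pos c))
    (h : ∀ b b' b'' x, coef b b' = some x → coef b' b'' = none)
    (hrow : ∀ i ∈ c, ∀ j x, coef i j = some x ↔ x.1 = (i, j))
    (θ : (β → ℂ) →ₗ[ℂ] (γ → ℂ)) (θ' : (γ → ℂ) →ₗ[ℂ] (β → ℂ)) (θ_θ' : ∀ w, θ (θ' w) = w)
    (θ'_mem : ∀ w, ∀ b ∈ c, θ' w b = 0)
    (θ'_θ : ∀ v, (∀ b ∈ c, v b = 0) → θ' (θ v) = v) : Trivialization pos c γ where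
  A := coefMatrix coef
  poly := isPoly_coefMatrix coef
  inv := coefMatrix_neg_mul h
  row u v i hi := coefMatrix_mulVec (hrow i hi) u v
  θ := θ
  θ' := θ'
  θ_θ' := θ_θ'
  θ'_mem := θ'_mem
  θ'_θ := θ'_θ

/-- The trivialisation whose fibre is spanned by the basis vectors outside `c`. -/
def Trivialization.standard (pos : β → ℕ) (c : Finset β) :
    Trivialization pos c {b // b ∉ c} :=
  Trivialization.ofCoef
    (fun i j => if h : i ∈ c ∧ j ∉ c ∧ pos j < pos i then some ⟨(i, j), h⟩ else none)
    (by
      intro b b' b'' x hx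
      split_ifs at hx with h
      exact dif_neg fun h' => h.2.1 h'.1)
    (by
      intro i hi j x
      split_ifs with h
      · rw [Option.some_inj, Subtype.ext_iff, eq_comm]
      · simp only [false_iff]
        intro hx
        have := x.2
        rw [hx] at this
        exact h this)
    (LinearMap.funLeft ℂ ℂ Subtype.val)
    { toFun := fun w b => if h : b ∉ c then w ⟨b, h⟩ else 0
      map_add' := by
        intro v w
        funext b
        by_cases h : b ∈ c <;> simp [h]
      map_smul' := by
        intro a w
        funext b
        by_cases h : b ∈ c <;> simp [h] }
    (by
      intro w
      funext b
      simp [LinearMap.funLeft, b.2])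
    (by
      intro w b hb
      simp [hb])
    (by
      intro v hv
      funext b
      by_cases h : b ∈ c <;> simp [LinearMap.funLeft, h, hv])

theorem isCell_partialFlags_zero (mu : Fin 0 → ℕ) (hβ : Fintype.card β = ∑ i, mu i) :
    IsCell β mu (partialFlags β mu) (Fin 0) := by
  have hemp : IsEmpty (Fin (∑ i, mu i)) := by
    rw [Finset.univ_eq_empty, Finset.sum_empty]
    infer_instance
  have hfr : (fun _ => 0 : Fin (∑ i, mu i) × β → ℂ) ∈ frames β mu := linearIndependent_empty_type
  refine ⟨fun _ _ => 0, fun _ _ => 0, fun _ => isPoly_const _, fun _ => hfr,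
    fun _ => flagOfFrame_mem hβ hfr, fun w => Subsingleton.elim _ _, fun V hV => ?_,
    fun _ _ i => i.elim0⟩
  funext i
  have hi : i = 0 := Fin.eq_zero i
  subst hi
  exact (flagOfFrame_mem hβ hfr).1.trans hV.1.symm

theorem isPaving_partialFlags_zero (mu : Fin 0 → ℕ) (hβ : Fintype.card β = ∑ i, mu i) {I : Type}
    [Unique I] {le : I → I → Prop} (hle : IsPartialOrder I le) :
    IsPaving β mu (partialFlags β mu) le (fun _ => partialFlags β mu) (fun _ => 0) where
  finite := inferInstance
  partialOrder := hle
  disjoint i j hij := (hij (Subsingleton.elim i j)).elim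
  cover := Set.iUnion_const _
  closed i := by
    refine ⟨∅, fun _ _ h => h.elim, fun V hV => ?_⟩
    simp only [Set.mem_empty_iff_false, false_iff, not_forall, not_not]
    exact ⟨i, hle.refl i, hV⟩
  isCell _ := isCell_partialFlags_zero mu hβ

theorem isPartialOrder_bruhatLE (hpos : Function.Injective pos) {Γ : Type} {c : Γ → Finset β}
    (hc : Function.Injective c) : IsPartialOrder Γ fun a b => BruhatLE pos (c a) (c b) where
  refl _ := BruhatLE.refl _
  trans _ _ _ h h' := h.trans h'
  antisymm _ _ h h' := hc (h.antisymm hpos h')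

/-- A set of flags is paved if its parts over the Schubert cells of a
Grassmannian are paved in the fibre direction. -/
theorem isPaving_bruhat {mu : Fin (n + 1) → ℕ} (hβ : Fintype.card β = ∑ i, mu i)
    {Γ : Type} [Finite Γ] (hpos : Function.Injective pos) (c : Γ → Finset β)
    (hcinj : Function.Injective c)
    (hc : ∀ a, (c a).card = mu (Fin.last n)) (γ : Γ → Type) [∀ a, Fintype (γ a)]
    (hγ : ∀ a, Fintype.card (γ a) = ∑ i : Fin n, mu i.castSucc)
    (s : ∀ a, Trivialization pos (c a) (γ a))
    (S : Set (Fin (n + 2) → Submodule ℂ (β → ℂ)))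
    (M : ∀ a, Set (Fin (n + 1) → Submodule ℂ (γ a → ℂ)))
    (hS : ∀ V, V ∈ S ↔ V ∈ partialFlags β mu ∧ ∃ a, V ∈ (s a).cellOver (M a))
    (I : Γ → Type) (leI : ∀ a, I a → I a → Prop)
    (cell : ∀ a, I a → Set (Fin (n + 1) → Submodule ℂ (γ a → ℂ))) (dim : ∀ a, I a → ℕ)
    (hI : ∀ a, IsPaving (γ a) (fun j : Fin n => mu j.castSucc) (M a) (leI a) (cell a) (dim a)) :
    IsPaving β mu S (Sigma.Lex (fun a b => BruhatLE pos (c a) (c b) ∧ a ≠ b) leI)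
      (fun x : Σ a, I a => partialFlags β mu ∩ (s x.1).cellOver (cell x.1 x.2))
      (fun x => Fintype.card (CellIdx pos (c x.1)) + dim x.1 x.2) := by
  refine isPaving_sigma hβ (fun a b => BruhatLE pos (c a) (c b))
    (isPartialOrder_bruhatLE hpos hcinj) pos c hc γ hγ s S M hS
    (fun a b u u' h => hcinj (cellSpace_eq_imp h)) (fun a => ?_) I leI cell dim hI
  obtain ⟨O, hO, hOV⟩ := exists_flagOpen_lower (mu := mu) hβ hpos (c a)
  refine ⟨O, hO, fun V hVS => ?_⟩
  obtain ⟨hV, a', u, hu, -⟩ := (hS V).1 hVS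
  rw [hOV V hV]
  refine ⟨fun h b u hb => h (c b) u hb, fun h b u' hb hu' => ?_⟩
  obtain rfl := cellSpace_eq_imp (hu.symm.trans hu')
  exact h a' u hb hu

/-- For an arbitrary ordering of the basis, every Schubert cell of the Grassmannian carries a full
flag variety of one step less as its fibre. Needed for the complement, over cells that miss the
Spaltenstein variety. -/
theorem exists_isPaving_partialFlags (n : ℕ) (mu : Fin n → ℕ) (β : Type) [Fintype β]
    (hβ : Fintype.card β = ∑ i, mu i) :
    ∃ (I : Type) (le : I → I → Prop) (cell : I → Set (Fin (n + 1) → Submodule ℂ (β → ℂ)))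
      (dim : I → ℕ), IsPaving β mu (partialFlags β mu) le cell dim := by
  classical
  induction n generalizing β with
  | zero =>
    exact ⟨Unit, fun _ _ => True, _, _, isPaving_partialFlags_zero mu hβ
      { refl := fun _ => trivial
        trans := fun _ _ _ _ _ => trivial
        antisymm := fun _ _ _ _ => rfl }⟩
  | succ n ih =>
    let Γ := {c : Finset β // c.card = mu (Fin.last n)}
    let pos : β → ℕ := fun b => (Fintype.equivFin β b).val
    have hpos : Function.Injective pos := Fin.val_injective.comp (Fintype.equivFin β).injective
    have hγ : ∀ a : Γ, Fintype.card {b // b ∉ a.1} = ∑ i : Fin n, mu i.castSucc := by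
      intro a
      rw [Fintype.card_subtype_compl, Fintype.card_coe, hβ, a.2, Fin.sum_univ_castSucc,
        Nat.add_sub_cancel_right]
    choose I le cell dim h using fun a : Γ => ih (fun i => mu i.castSucc) {b // b ∉ a.1} (hγ a)
    refine ⟨_, _, _, _, isPaving_bruhat hβ hpos (fun a : Γ => a.1) Subtype.val_injective
      (fun a => a.2) (fun a => {b // b ∉ a.1}) hγ (fun a => Trivialization.standard pos a.1)
      (partialFlags β mu) (fun a => partialFlags _ _) (fun V => ?_) I le cell dim h⟩
    refine ⟨fun hV => ⟨hV, ?_⟩, fun hV => hV.1⟩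
    obtain ⟨u, hu⟩ := exists_eq_cellSpace hpos (V (Fin.last n).castSucc)
    exact ⟨⟨_, card_compl_leads (pos := pos) hβ hpos hV⟩, u, hu,
      Trivialization.fibreFlag_mem _ hV hu⟩

end Full

/-! ### Boxes of Young diagrams -/

section Boxes

theorem pos_lt_pos {n : ℕ} {lam : Fin n → ℕ} {b b' : Box lam} (h : b.1 < b'.1) :
    pos lam b < pos lam b' := by
  have h1 : ∑ i with i < b.1, lam i + lam b.1 ≤ ∑ i with i < b'.1, lam i := by
    rw [add_comm, ← Finset.sum_insert (by simp)]
    refine Finset.sum_le_sum_of_subset fun i hi => ?_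
    simp only [Finset.mem_insert, Finset.mem_filter, Finset.mem_univ, true_and] at hi ⊢
    rcases hi with rfl | hi
    exacts [h, hi.trans h]
  have := b.2.2
  simp only [pos]
  omega

theorem box_ext {n : ℕ} {lam : Fin n → ℕ} {b b' : Box lam} (h : b.1.val = b'.1.val)
    (h' : b.2.val = b'.2.val) : b = b' := by
  obtain ⟨i, j⟩ := b
  obtain ⟨i', j'⟩ := b'
  obtain rfl := Fin.ext h
  obtain rfl := Fin.ext h'
  rfl

theorem pos_injective {n : ℕ} (lam : Fin n → ℕ) : Function.Injective (pos lam) := by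
  intro b b' h
  rcases lt_trichotomy b.1 b'.1 with hlt | heq | hlt
  · exact absurd h (pos_lt_pos hlt).ne
  · refine box_ext (congrArg Fin.val heq) ?_
    simp only [pos, heq] at h
    omega
  · exact absurd h (pos_lt_pos hlt).ne'

theorem nil_apply {n : ℕ} {lam : Fin n → ℕ} (v : BoxSpace lam) {b b' : Box lam}
    (h : b.1.val = b'.1.val + 1) (h' : b.2.val = b'.2.val) : nil lam v b = v b' := by
  rw [nil, Matrix.mulVecLin_apply, Matrix.mulVec, dotProduct, Finset.sum_eq_single b']
  · simp [nilMatrix, h, h']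
  · intro b'' _ hne
    rw [nilMatrix, Matrix.of_apply, if_neg, zero_mul]
    exact fun h'' => hne (box_ext (by omega) (by omega))
  · simp

theorem nil_apply_eq_zero {n : ℕ} {lam : Fin n → ℕ} (v : BoxSpace lam) {b : Box lam}
    (h : b.1.val = 0) : nil lam v b = 0 := by
  rw [nil, Matrix.mulVecLin_apply, Matrix.mulVec, dotProduct]
  refine Finset.sum_eq_zero fun b'' _ => ?_
  rw [nilMatrix, Matrix.of_apply, if_neg (by omega), zero_mul]

theorem exists_above {n : ℕ} {lam : Fin n → ℕ} (hlam : Antitone lam) {b : Box lam}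
    (h : b.1.val ≠ 0) : ∃ b' : Box lam, b.1.val = b'.1.val + 1 ∧ b.2.val = b'.2.val := by
  have h1 : b.1.val - 1 < n := by omega
  refine ⟨⟨⟨b.1.val - 1, h1⟩, ⟨b.2.val, b.2.2.trans_le (hlam ?_)⟩⟩, ?_, rfl⟩
  · exact Fin.le_def.2 (Nat.sub_le _ _)
  · simp only
    omega

/-- The boxes whose positions are listed in `c`. -/
def boxesOf {n : ℕ} (lam : Fin n → ℕ) (c : List ℕ) : Finset (Box lam) :=
  Finset.univ.filter fun b => pos lam b ∈ c

theorem mem_boxesOf {n : ℕ} {lam : Fin n → ℕ} {c : List ℕ} {b : Box lam} :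
    b ∈ boxesOf lam c ↔ pos lam b ∈ c := by
  simp [boxesOf]

theorem mem_perp {n : ℕ} {lam : Fin n → ℕ} {U : Submodule ℂ (BoxSpace lam)} {v : BoxSpace lam} :
    v ∈ perp lam U ↔ ∀ u ∈ U, u ⬝ᵥ v = 0 := by
  rw [perp, Submodule.mem_orthogonalBilin_iff]
  rfl

theorem mem_perp_span {n : ℕ} {lam : Fin n → ℕ} {s : Set (BoxSpace lam)} {v : BoxSpace lam} :
    v ∈ perp lam (Submodule.span ℂ s) ↔ ∀ u ∈ s, u ⬝ᵥ v = 0 := by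
  rw [mem_perp]
  refine ⟨fun h u hu => h u (Submodule.subset_span hu), fun h u hu => ?_⟩
  induction hu using Submodule.span_induction with
  | mem u hu => exact h u hu
  | zero => simp
  | add u w _ _ hu hw => rw [add_dotProduct, hu, hw, add_zero]
  | smul a u _ hu => rw [smul_dotProduct, hu, smul_zero]

theorem mem_perp_colSpan {n : ℕ} {lam : Fin n → ℕ} {c : List ℕ} {v : BoxSpace lam} :
    v ∈ perp lam (colSpan lam c) ↔ ∀ b ∈ boxesOf lam c, v b = 0 := by
  rw [colSpan, mem_perp_span, Set.forall_mem_image]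
  refine forall_congr' fun b => ?_
  rw [mem_boxesOf, Set.mem_ofPred_eq, f, single_dotProduct, one_mul]

variable {n : ℕ} {lam : Fin (n + 1) → ℕ} {c : List ℕ}

theorem pos_of_eq_zero {b : Box lam} (h : b.1.val = 0) : pos lam b = b.2.val := by
  rw [pos, Finset.sum_eq_zero, zero_add]
  intro i hi
  have := (Finset.mem_filter.1 hi).2
  omega

theorem eq_zero_of_pos_lt {b : Box lam} (h : pos lam b < lam 0) : b.1.val = 0 := by
  by_contra hb
  have h1 : ∑ i with i < b.1, lam i ≥ lam 0 :=
    Finset.single_le_sum (f := lam) (fun _ _ => Nat.zero_le _)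
      (Finset.mem_filter.2 ⟨Finset.mem_univ _, Fin.pos_iff_ne_zero.2 fun h => hb (congrArg Fin.val h)⟩)
  simp only [pos] at h
  omega

theorem lt_of_eq_zero {b : Box lam} (h : b.1.val = 0) : b.2.val < lam 0 := by
  obtain ⟨i, j⟩ := b
  obtain rfl : i = 0 := Fin.ext h
  exact j.2

theorem Admissible.eq_zero (hc : Admissible lam c) {b : Box lam} (hb : b ∈ boxesOf lam c) :
    b.1.val = 0 :=
  eq_zero_of_pos_lt (hc.2.1 _ (mem_boxesOf.1 hb))

theorem card_boxesOf (hc : c.Nodup) (hlt : ∀ j ∈ c, j < lam 0) :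
    (boxesOf lam c).card = c.length := by
  rw [← List.toFinset_card_of_nodup hc]
  refine Finset.card_nbij (pos lam) ?_ ?_ ?_
  · intro b hb
    simpa using mem_boxesOf.1 hb
  · exact fun b _ b' _ h => pos_injective lam h
  · intro j hj
    have hj' : j ∈ c := by simpa using hj
    refine ⟨⟨0, ⟨j, hlt j hj'⟩⟩, ?_, ?_⟩
    · rw [Finset.mem_coe, mem_boxesOf, pos_of_eq_zero rfl]
      exact hj'
    · rw [pos_of_eq_zero rfl]

/-- The box at the top of the column of `b`. -/
def topBox (hlam : Antitone lam) (b : Box lam) : Box lam :=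
  ⟨0, ⟨b.2.val, b.2.2.trans_le (hlam (Fin.zero_le _))⟩⟩

theorem topBox_eq (hlam : Antitone lam) {b b' : Box lam} (h : b.2.val = b'.2.val) :
    topBox hlam b = topBox hlam b' :=
  box_ext rfl h

theorem topBox_of_eq_zero (hlam : Antitone lam) {b : Box lam} (h : b.1.val = 0) :
    topBox hlam b = b :=
  box_ext h.symm rfl

/-- The places of the coordinates of a point of the Schubert cell
in the transpose of the matrix `g(U)`. -/
def boxCoef (hlam : Antitone lam) (c : List ℕ) (b b' : Box lam) :
    Option (CellIdx (pos lam) (boxesOf lam c)) :=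
  -- The coefficient of a pair of columns is repeated in every row of boxes, which is forced by
  -- commutation with x^λ.
  if h : b.1 = b'.1 ∧ topBox hlam b ∈ boxesOf lam c ∧ topBox hlam b' ∉ boxesOf lam c ∧
      pos lam (topBox hlam b') < pos lam (topBox hlam b) then
    some ⟨(topBox hlam b, topBox hlam b'), h.2⟩ else none

theorem boxCoef_comp (hlam : Antitone lam) (b b' b'' : Box lam)
    (x : CellIdx (pos lam) (boxesOf lam c)) (h : boxCoef hlam c b b' = some x) :
    boxCoef hlam c b' b'' = none := by
  rw [boxCoef] at h
  split_ifs at h with h1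
  exact dif_neg fun h' => h1.2.2.1 h'.2.1

theorem boxCoef_eq_some (hlam : Antitone lam) (hc : Admissible lam c) {b : Box lam}
    (hb : b ∈ boxesOf lam c) (b' : Box lam) (x : CellIdx (pos lam) (boxesOf lam c)) :
    boxCoef hlam c b b' = some x ↔ x.1 = (b, b') := by
  have h0 := hc.eq_zero hb
  have hbt := topBox_of_eq_zero hlam h0
  rw [boxCoef]
  constructor
  · intro h
    split_ifs at h with h1
    have h2 : topBox hlam b' = b' := topBox_of_eq_zero hlam (by rw [← h1.1, h0])
    rw [Option.some_inj] at h
    rw [← h]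
    exact Prod.ext hbt h2
  · intro h
    have hx := x.2
    rw [h] at hx
    have hb'0 : b'.1.val = 0 :=
      eq_zero_of_pos_lt (hx.2.2.trans (hc.2.1 _ (mem_boxesOf.1 hb)))
    have hbt' := topBox_of_eq_zero hlam hb'0
    rw [dif_pos ⟨Fin.ext (h0.trans hb'0.symm), by rw [hbt, hbt']; exact hx⟩, Option.some_inj]
    exact Subtype.ext ((Prod.ext hbt hbt').trans h.symm)

/-- The transpose of the matrix `g(U)` at the point `U` with coordinates `u`. -/
abbrev boxMatrix (hlam : Antitone lam) (c : List ℕ)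
    (u : CellIdx (pos lam) (boxesOf lam c) → ℂ) : Matrix (Box lam) (Box lam) ℂ :=
  coefMatrix (boxCoef hlam c) u

theorem coefMatrix_mulVec_apply {β : Type} [Fintype β] [DecidableEq β] {pos : β → ℕ}
    {c : Finset β} (coef : β → β → Option (CellIdx pos c)) (u : CellIdx pos c → ℂ) (v : β → ℂ)
    (b : β) : (coefMatrix coef u).mulVec v b = v b + ∑ b', (coef b b').elim 0 u * v b' := by
  rw [coefMatrix, Matrix.add_mulVec, Matrix.one_mulVec]
  rfl

theorem boxCoef_below (hlam : Antitone lam) {a b d e : Box lam} (hb : b.1.val = a.1.val + 1)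
    (hb' : b.2.val = a.2.val) (hd : d.1.val = e.1.val + 1) (hd' : d.2.val = e.2.val) :
    boxCoef hlam c b d = boxCoef hlam c a e := by
  have h1 : topBox hlam b = topBox hlam a := topBox_eq hlam hb'
  have h2 : topBox hlam d = topBox hlam e := topBox_eq hlam hd'
  have h3 : b.1 = d.1 ↔ a.1 = e.1 := by
    rw [Fin.ext_iff, Fin.ext_iff]
    omega
  simp only [boxCoef, h1, h2, h3]

/-- The coefficient depends only on the two columns, so it is unchanged when both boxes move down
one row. -/
theorem boxMatrix_comm_nil (hlam : Antitone lam) (u : CellIdx (pos lam) (boxesOf lam c) → ℂ)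
    (v : BoxSpace lam) :
    (boxMatrix hlam c u).mulVec (nil lam v) = nil lam ((boxMatrix hlam c u).mulVec v) := by
  funext b
  by_cases hb : b.1.val = 0
  · rw [coefMatrix_mulVec_apply, nil_apply_eq_zero v hb, nil_apply_eq_zero _ hb, zero_add]
    refine Finset.sum_eq_zero fun b' _ => ?_
    rw [boxCoef]
    split_ifs with h
    · rw [nil_apply_eq_zero v (by rw [← h.1, hb]), mul_zero]
    · exact zero_mul _
  · obtain ⟨a, ha, ha'⟩ := exists_above hlam hb
    rw [nil_apply _ ha ha', coefMatrix_mulVec_apply, coefMatrix_mulVec_apply, nil_apply v ha ha']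
    congr 1
    have key := fun (d e : Box lam) (hde : d.1.val = e.1.val + 1) hde' =>
      boxCoef_below hlam (c := c) ha ha' hde hde'
    have hrow : ∀ b b' : Box lam, (boxCoef hlam c b b').elim 0 u ≠ 0 →
        b.1 = b'.1 ∧ b'.2.val < b.2.val := by
      intro b b' h
      rw [boxCoef] at h
      split_ifs at h with h1
      · refine ⟨h1.1, ?_⟩
        have := h1.2.2.2
        rwa [pos_of_eq_zero rfl, pos_of_eq_zero rfl] at this
      · exact (h rfl).elim
    symm
    -- The box e is sent to the one below it. That box exists because a non-zero coefficient puts e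
    -- in a column to the left of that of b.
    refine Finset.sum_bij_ne_zero (fun e he hne => ⟨b.1, ⟨e.2.val, ?_⟩⟩) ?_ ?_ ?_ ?_
    · have := (hrow _ _ (left_ne_zero_of_mul hne)).2
      have := b.2.2
      omega
    · exact fun _ _ _ => Finset.mem_univ _
    · intro e he hne e' he' hne' h
      have h1 := hrow _ _ (left_ne_zero_of_mul hne)
      have h2 := hrow _ _ (left_ne_zero_of_mul hne')
      refine box_ext (by rw [← h1.1, ← h2.1]) ?_
      simpa using h
    · intro d _ hne
      have h1 := hrow _ _ (left_ne_zero_of_mul hne)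
      have hd0 : d.1.val ≠ 0 := by rw [← h1.1]; exact hb
      obtain ⟨e, he, he'⟩ := exists_above hlam hd0
      refine ⟨e, Finset.mem_univ _, ?_, ?_⟩
      · rw [← key d e he he', ← nil_apply v he he']
        exact hne
      · exact box_ext (by rw [← h1.1]) he'.symm
    · intro e he hne
      have h1 := hrow _ _ (left_ne_zero_of_mul hne)
      have h2 : b.1.val = e.1.val + 1 := by rw [ha, h1.1]
      rw [nil_apply v (b := ⟨b.1, ⟨e.2.val, _⟩⟩) h2 rfl, key ⟨b.1, ⟨e.2.val, _⟩⟩ e h2 rfl]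

theorem exists_inverse_theta {θ : ThetaFamily} (hθ : θ.IsAdapted) (hlam : Antitone lam)
    (hc : Admissible lam c) : ∃ θ' : BoxSpace (lamBar lam c) →ₗ[ℂ] BoxSpace lam,
      (∀ w, θ n lam c (θ' w) = w) ∧ (∀ w, ∀ b ∈ boxesOf lam c, θ' w b = 0) ∧
      ∀ v, (∀ b ∈ boxesOf lam c, v b = 0) → θ' (θ n lam c v) = v := by
  obtain ⟨hbij, -⟩ := hθ n lam c hlam hc
  let L : perp lam (colSpan lam c) →ₗ[ℂ] BoxSpace (lamBar lam c) :=
    (θ n lam c).domRestrict (perp lam (colSpan lam c))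
  have hL : Function.Bijective L := by
    constructor
    · exact fun v w h => Subtype.ext (hbij.injOn v.2 w.2 h)
    · intro w
      obtain ⟨v, hv, hvw⟩ := hbij.surjOn (Set.mem_univ w)
      exact ⟨⟨v, hv⟩, hvw⟩
  let E := LinearEquiv.ofBijective L hL
  refine ⟨(perp lam (colSpan lam c)).subtype ∘ₗ E.symm.toLinearMap, fun w => ?_, fun w => ?_,
    fun v hv => ?_⟩
  · exact E.apply_symm_apply w
  · exact mem_perp_colSpan.1 (E.symm w).2
  · exact congrArg Subtype.val (E.symm_apply_apply ⟨v, mem_perp_colSpan.2 hv⟩)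

/-- The trivialisation given by an isomorphism `θ`. -/
noncomputable def boxTrivialization {θ : ThetaFamily} (hθ : θ.IsAdapted) (hlam : Antitone lam)
    (hc : Admissible lam c) :
    Trivialization (pos lam) (boxesOf lam c) (Box (lamBar lam c)) :=
  Trivialization.ofCoef (boxCoef hlam c) (boxCoef_comp hlam)
    (fun _ hi => boxCoef_eq_some hlam hc hi) (θ n lam c)
    (exists_inverse_theta hθ hlam hc).choose
    (exists_inverse_theta hθ hlam hc).choose_spec.1
    (exists_inverse_theta hθ hlam hc).choose_spec.2.1
    (exists_inverse_theta hθ hlam hc).choose_spec.2.2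

theorem boxTrivialization_toFibre {θ : ThetaFamily} (hθ : θ.IsAdapted) (hlam : Antitone lam)
    (hc : Admissible lam c) (u : CellIdx (pos lam) (boxesOf lam c) → ℂ) (v : BoxSpace lam) :
    (boxTrivialization hθ hlam hc).toFibre u v =
      θ n lam c ((boxMatrix hlam c u).mulVec v) :=
  rfl

/-- After commuting A(u) past x^λ, the vector vanishes on the top row, which contains c. Hence x^λ
V_n ⊆ V_{n-1} imposes nothing over an admissible cell. -/
theorem nil_mem_cellSpace (hlam : Antitone lam) (hc : Admissible lam c)
    (u : CellIdx (pos lam) (boxesOf lam c) → ℂ) (v : BoxSpace lam) :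
    nil lam v ∈ cellSpace (pos lam) (boxesOf lam c) u := by
  intro b hb
  rw [← coefMatrix_mulVec (boxCoef_eq_some hlam hc hb), boxMatrix_comm_nil,
    nil_apply_eq_zero _ (hc.eq_zero hb)]

theorem toFibre_nil {θ : ThetaFamily} (hθ : θ.IsAdapted) (hlam : Antitone lam)
    (hc : Admissible lam c) {u : CellIdx (pos lam) (boxesOf lam c) → ℂ} {v : BoxSpace lam}
    (hv : v ∈ cellSpace (pos lam) (boxesOf lam c) u) :
    (boxTrivialization hθ hlam hc).toFibre u (nil lam v) =
      nil (lamBar lam c) ((boxTrivialization hθ hlam hc).toFibre u v) := by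
  rw [boxTrivialization_toFibre, boxTrivialization_toFibre, boxMatrix_comm_nil]
  refine (hθ n lam c hlam hc).2 _ (mem_perp_colSpan.2 ?_)
  exact (boxTrivialization hθ hlam hc).mem_cellSpace_iff.1 hv

/-- The identification of V_{n-1} with the smaller space intertwines the two nilpotent maps, so all
conditions but the last correspond, and the last is automatic. -/
theorem mem_spaltensteinSet_iff {θ : ThetaFamily} (hθ : θ.IsAdapted) (hlam : Antitone lam)
    (hc : Admissible lam c) {mu : Fin (n + 1) → ℕ} {V : Fin (n + 2) → Submodule ℂ (BoxSpace lam)}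
    (hV : V ∈ partialFlags (Box lam) mu) {u : CellIdx (pos lam) (boxesOf lam c) → ℂ}
    (hu : V (Fin.last n).castSucc = cellSpace (pos lam) (boxesOf lam c) u) :
    V ∈ spaltensteinSet lam mu ↔ (boxTrivialization hθ hlam hc).fibreFlag u V ∈
      spaltensteinSet (lamBar lam c) fun i : Fin n => mu i.castSucc := by
  set s := boxTrivialization hθ hlam hc with hs
  have hle : ∀ i : Fin (n + 1), V i.castSucc ≤ cellSpace (pos lam) (boxesOf lam c) u := fun i =>
    hu ▸ le_of_mem_partialFlags hV (Fin.castSucc_le_castSucc_iff.2 i.le_last)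
  constructor
  · rintro ⟨-, h⟩
    refine ⟨s.fibreFlag_mem hV hu, fun i => ?_⟩
    rintro _ ⟨_, ⟨v, hv, rfl⟩, rfl⟩
    have hvK := hle i.succ hv
    refine ⟨nil lam v, h i.castSucc ⟨v, hv, rfl⟩, ?_⟩
    rw [hs, toFibre_nil hθ hlam hc hvK]
  · rintro ⟨-, h⟩
    refine ⟨hV, fun i => ?_⟩
    rintro _ ⟨v, hv, rfl⟩
    induction i using Fin.lastCases with
    | last =>
      rw [hu]
      exact nil_mem_cellSpace hlam hc u v
    | cast i =>
      have hvK := hle i.succ hv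
      obtain ⟨v', hv', hvv'⟩ := h i ⟨_, ⟨v, hv, rfl⟩, rfl⟩
      rw [hs, ← toFibre_nil hθ hlam hc hvK] at hvv'
      have := congrArg (s.ofFibre u) hvv'
      rw [s.ofFibre_toFibre (hle _ hv'), hs,
        Trivialization.ofFibre_toFibre _ (nil_mem_cellSpace hlam hc u v)] at this
      rw [← this]
      exact hv'

theorem admissible_of_mem_spaltensteinSet (hlam : Antitone lam) {mu : Fin (n + 1) → ℕ}
    {V : Fin (n + 2) → Submodule ℂ (BoxSpace lam)} (hV : V ∈ spaltensteinSet lam mu) :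
    ∃ c, Admissible lam c ∧
      boxesOf lam c = (leads (pos lam) (V (Fin.last n).castSucc))ᶜ := by
  set K := V (Fin.last n).castSucc with hK
  -- Below the top row the basis vector itself lies in the image of x^λ, hence in K.
  have htop : ∀ b : Box lam, b.1.val ≠ 0 → b ∈ leads (pos lam) K := by
    intro b hb
    obtain ⟨a, ha, ha'⟩ := exists_above hlam hb
    have hmem : nil lam (f lam a) ∈ K := by
      refine hV.2 (Fin.last n) ⟨f lam a, ?_, rfl⟩
      rw [Fin.succ_last, hV.1.2.1]
      trivial
    refine mem_leads.2 ⟨_, hmem, ?_, fun b' hb' => ?_⟩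
    · rw [nil_apply _ ha ha']
      simp [f]
    · by_cases hb'0 : b'.1.val = 0
      · exact nil_apply_eq_zero _ hb'0
      · obtain ⟨a', hd, hd'⟩ := exists_above hlam hb'0
        rw [nil_apply _ hd hd', f, Pi.single_eq_of_ne]
        rintro rfl
        rw [box_ext (b := b) (b' := b') (by omega) (by omega)] at hb'
        exact lt_irrefl _ hb'
  -- The k-th power of x^λ kills V_k, so entries that can be pushed down k times vanish. For k = n
  -- this covers the top boxes of the columns of full height n + 1.
  have hbot : ∀ (k : ℕ) (hk : k < n + 2) (v : BoxSpace lam), v ∈ V ⟨k, hk⟩ →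
      ∀ b : Box lam, b.1.val + k ≤ n → b.2.val < lam (Fin.last n) → v b = 0 := by
    intro k
    induction k with
    | zero =>
      intro hk v hv b _ _
      have : v ∈ V 0 := hv
      rw [hV.1.1] at this
      rw [(Submodule.mem_bot ℂ).1 this]
      rfl
    | succ k ih =>
      intro hk v hv b hbk hb
      have hmem : nil lam v ∈ V ⟨k, by omega⟩ := hV.2 ⟨k, by omega⟩ ⟨v, hv, rfl⟩
      let b' : Box lam := ⟨⟨b.1.val + 1, by omega⟩, ⟨b.2.val, hb.trans_le (hlam (Fin.le_last _))⟩⟩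
      rw [← nil_apply v (b := b') rfl rfl]
      exact ih _ _ hmem b' (by simp only [b']; omega) hb
  refine ⟨(((leads (pos lam) K)ᶜ).image (pos lam)).sort (· ≤ ·), ⟨?_, ?_, ?_⟩, ?_⟩
  · exact Finset.sortedLT_sort _ |>.pairwise
  · intro j hj
    simp only [Finset.mem_sort, Finset.mem_image, Finset.mem_compl] at hj
    obtain ⟨b, hb, rfl⟩ := hj
    have hb0 : b.1.val = 0 := by
      by_contra h
      exact hb (htop b h)
    rw [pos_of_eq_zero hb0]
    exact lt_of_eq_zero hb0
  · intro j hj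
    simp only [Finset.mem_sort, Finset.mem_image, Finset.mem_compl]
    refine ⟨⟨0, ⟨j, hj.trans_le (hlam (Fin.zero_le _))⟩⟩, fun h => ?_, pos_of_eq_zero rfl⟩
    obtain ⟨v, hv, hv0, -⟩ := mem_leads.1 h
    exact hv0 (hbot n (by omega) v hv _ (by simp) hj)
  · ext b
    simp only [mem_boxesOf, Finset.mem_sort, Finset.mem_image]
    exact ⟨fun ⟨b', hb', h⟩ => pos_injective lam h ▸ hb', fun h => ⟨b, h, rfl⟩⟩

theorem lamBar_antitone (lam : Fin (n + 1) → ℕ) (c : List ℕ) : Antitone (lamBar lam c) := by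
  intro i i' hii'
  refine Finset.card_le_card fun j hj => ?_
  rw [Finset.mem_filter] at hj ⊢
  exact ⟨hj.1, (Fin.le_def.1 hii').trans_lt hj.2⟩

end Boxes

/-! ### Heights of columns and the existence of `θ` -/

section Heights

theorem lt_colHeight_iff {n : ℕ} {lam : Fin n → ℕ} (hlam : Antitone lam) (i : Fin n) (j : ℕ) :
    i.val < colHeight lam j ↔ j < lam i := by
  constructor
  · intro h
    by_contra hj
    have : colHeight lam j ≤ (Finset.Iio i).card := by
      refine Finset.card_le_card fun i' hi' => ?_
      rw [Finset.mem_Iio]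
      by_contra hle
      have h1 := (Finset.mem_filter.1 hi').2
      exact hj (h1.trans_le (hlam (not_lt.1 hle)))
    rw [Fin.card_Iio] at this
    omega
  · intro h
    have : (Finset.Iic i).card ≤ colHeight lam j := by
      refine Finset.card_le_card fun i' hi' => ?_
      exact Finset.mem_filter.2 ⟨Finset.mem_univ _, h.trans_le (hlam (Finset.mem_Iic.1 hi'))⟩
    rw [Fin.card_Iic] at this
    omega

theorem colHeight_le {n : ℕ} (lam : Fin n → ℕ) (j : ℕ) : colHeight lam j ≤ n :=
  (Finset.card_filter_le _ _).trans (by simp)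

theorem lt_numCols_iff {n : ℕ} {lam : Fin n → ℕ} {j : ℕ} :
    j < numCols lam ↔ 0 < colHeight lam j := by
  rw [numCols, Finset.lt_sup_iff, colHeight, Finset.card_pos]
  simp [Finset.Nonempty]

theorem numCols_eq {n : ℕ} {lam : Fin (n + 1) → ℕ} (hlam : Antitone lam) :
    numCols lam = lam 0 :=
  le_antisymm (Finset.sup_le fun i _ => hlam (Fin.zero_le i)) (Finset.le_sup (Finset.mem_univ 0))

theorem sum_colHeight {n : ℕ} (lam : Fin n → ℕ) :
    ∑ j ∈ Finset.range (numCols lam), colHeight lam j = ∑ i, lam i := by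
  simp only [colHeight, Finset.card_filter]
  rw [Finset.sum_comm]
  refine Finset.sum_congr rfl fun i _ => ?_
  rw [← Finset.card_filter]
  have : (Finset.range (numCols lam)).filter (fun j => j < lam i) = Finset.range (lam i) := by
    ext j
    simp only [Finset.mem_filter, Finset.mem_range, and_iff_right_iff_imp]
    exact fun h => h.trans_le (Finset.le_sup (Finset.mem_univ i))
  rw [this, Finset.card_range]

/-- The height of a column after the removal of a box from each column in `c`. -/
def cutHeight {n : ℕ} (lam : Fin n → ℕ) (c : List ℕ) (j : ℕ) : ℕ :=
  colHeight lam j - if j ∈ c then 1 else 0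

variable {n : ℕ} {lam : Fin (n + 1) → ℕ} {c : List ℕ}

theorem cutHeight_le (hlam : Antitone lam) (hc : Admissible lam c) (j : ℕ) :
    cutHeight lam c j ≤ n := by
  have h1 := colHeight_le lam j
  rw [cutHeight]
  split_ifs with hj
  · omega
  · by_contra h
    have := (lt_colHeight_iff hlam (Fin.last n) j).1 (by rw [Fin.val_last]; omega)
    exact hj (hc.2.2 j this)

theorem cutHeight_add (hlam : Antitone lam) (hc : Admissible lam c) (j : ℕ) :
    cutHeight lam c j + (if j ∈ c then 1 else 0) = colHeight lam j := by
  rw [cutHeight]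
  split_ifs with hj
  · have := (lt_colHeight_iff hlam 0 j).2 (hc.2.1 j hj)
    omega
  · rfl

/-- Conjugation of partitions: for t < n both sides are the length of row t of the smaller diagram.
For larger t both vanish, which uses that c contains all columns of height n + 1. -/
theorem card_lt_colHeight_lamBar (hlam : Antitone lam) (hc : Admissible lam c) (t : ℕ) :
    ((Finset.range (numCols (lamBar lam c))).filter
        fun j => t < colHeight (lamBar lam c) j).card =
      ((Finset.range (numCols lam)).filter fun j => t < cutHeight lam c j).card := by
  by_cases ht : t < n
  · have h1 := lt_colHeight_iff (lamBar_antitone lam c) ⟨t, ht⟩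
    have : (Finset.range (numCols (lamBar lam c))).filter
        (fun j => t < colHeight (lamBar lam c) j) = Finset.range (lamBar lam c ⟨t, ht⟩) := by
      ext j
      simp only [Finset.mem_filter, Finset.mem_range]
      refine ⟨fun h => (h1 j).1 h.2, fun h => ⟨h.trans_le ?_, (h1 j).2 h⟩⟩
      exact Finset.le_sup (Finset.mem_univ _)
    rw [this, Finset.card_range]
    rfl
  · rw [Finset.filter_false_of_mem, Finset.filter_false_of_mem]
    · intro j _
      have := cutHeight_le hlam hc j
      omega
    · intro j _
      have := colHeight_le (lamBar lam c) j
      omega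

/-- Columns of height t are those higher than t - 1 but not higher than t. The case t = 0 is
excluded because emptied columns disappear from the smaller diagram. -/
theorem card_eq_colHeight_lamBar (hlam : Antitone lam) (hc : Admissible lam c) {t : ℕ}
    (ht : 0 < t) :
    ((Finset.range (numCols (lamBar lam c))).filter
        fun j => colHeight (lamBar lam c) j = t).card =
      ((Finset.range (numCols lam)).filter fun j => cutHeight lam c j = t).card := by
  have key : ∀ (N : ℕ) (h : ℕ → ℕ), ((Finset.range N).filter fun j => t - 1 < h j).card =
      ((Finset.range N).filter fun j => h j = t).card +
        ((Finset.range N).filter fun j => t < h j).card := by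
    intro N h
    rw [← Finset.card_union_of_disjoint, ← Finset.filter_or]
    · congr 1
      refine Finset.filter_congr fun j _ => ?_
      omega
    · refine Finset.disjoint_filter.2 fun j _ h1 h2 => ?_
      omega
  have h1 := key (numCols (lamBar lam c)) (colHeight (lamBar lam c))
  have h2 := key (numCols lam) (cutHeight lam c)
  have h3 := card_lt_colHeight_lamBar hlam hc t
  have h4 := card_lt_colHeight_lamBar hlam hc (t - 1)
  omega

/-- The columns of the smaller diagram correspond to the columns that are not removed. -/
theorem exists_column_bijection (hlam : Antitone lam) (hc : Admissible lam c) :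
    ∃ τ : ℕ → ℕ, (∀ j < numCols (lamBar lam c), τ j < numCols lam ∧
        cutHeight lam c (τ j) = colHeight (lamBar lam c) j) ∧
      (∀ j < numCols (lamBar lam c), ∀ j' < numCols (lamBar lam c), τ j = τ j' → j = j') ∧
      ∀ k < numCols lam, 0 < cutHeight lam c k → ∃ j < numCols (lamBar lam c), τ j = k := by
  let A := {j // j < numCols (lamBar lam c)}
  let B := {j // j < numCols lam ∧ 0 < cutHeight lam c j}
  have hfin : Finite A := (Set.finite_lt_nat _).to_subtype
  have hfin' : Finite B := ((Set.finite_lt_nat (numCols lam)).subset fun j hj => hj.1).to_subtype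
  have hfib : ∀ t, Nonempty ({a : A // colHeight (lamBar lam c) a.1 = t} ≃
      {b : B // cutHeight lam c b.1 = t}) := by
    intro t
    rcases Nat.eq_zero_or_pos t with rfl | ht
    · have h1 : IsEmpty {a : A // colHeight (lamBar lam c) a.1 = 0} :=
        ⟨fun a => (lt_numCols_iff.1 a.1.2).ne' a.2⟩
      have h2 : IsEmpty {b : B // cutHeight lam c b.1 = 0} := ⟨fun b => b.1.2.2.ne' b.2⟩
      exact ⟨Equiv.equivOfIsEmpty _ _⟩
    · let E1 : {a : A // colHeight (lamBar lam c) a.1 = t} ≃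
          {j // j ∈ (Finset.range (numCols (lamBar lam c))).filter
            fun j => colHeight (lamBar lam c) j = t} :=
        { toFun := fun a => ⟨a.1.1, by simpa using ⟨a.1.2, a.2⟩⟩
          invFun := fun j => ⟨⟨j.1, by simpa using (Finset.mem_filter.1 j.2).1⟩,
            (Finset.mem_filter.1 j.2).2⟩
          left_inv := fun _ => rfl
          right_inv := fun _ => rfl }
      let E2 : {b : B // cutHeight lam c b.1 = t} ≃
          {j // j ∈ (Finset.range (numCols lam)).filter fun j => cutHeight lam c j = t} :=
        { toFun := fun b => ⟨b.1.1, by simpa using ⟨b.1.2.1, b.2⟩⟩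
          invFun := fun j => ⟨⟨j.1, by simpa using (Finset.mem_filter.1 j.2).1,
            by rw [(Finset.mem_filter.1 j.2).2]; exact ht⟩, (Finset.mem_filter.1 j.2).2⟩
          left_inv := fun _ => rfl
          right_inv := fun _ => rfl }
      exact ⟨E1.trans ((Finset.equivOfCardEq (card_eq_colHeight_lamBar hlam hc ht)).trans
        E2.symm)⟩
  -- Equally many columns of each height on both sides glue to a height-preserving bijection.
  obtain ⟨E, hE⟩ : ∃ E : A ≃ B, ∀ a, cutHeight lam c (E a).1 = colHeight (lamBar lam c) a.1 :=
    ⟨Equiv.ofFiberEquiv (f := fun a : A => colHeight (lamBar lam c) a.1)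
      (g := fun b : B => cutHeight lam c b.1) fun t => (hfib t).some,
      Equiv.ofFiberEquiv_map (f := fun a : A => colHeight (lamBar lam c) a.1)
      (g := fun b : B => cutHeight lam c b.1) fun t => (hfib t).some⟩
  refine ⟨fun j => if h : j < numCols (lamBar lam c) then (E ⟨j, h⟩).1 else 0, ?_, ?_, ?_⟩
  · intro j hj
    simp only [dif_pos hj]
    exact ⟨(E ⟨j, hj⟩).2.1, hE _⟩
  · intro j hj j' hj' h
    simp only [dif_pos hj, dif_pos hj'] at h
    exact congrArg Subtype.val (E.injective (Subtype.ext h))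
  · intro k hk hk'
    refine ⟨(E.symm ⟨k, hk, hk'⟩).1, (E.symm ⟨k, hk, hk'⟩).2, ?_⟩
    simp only [dif_pos (E.symm ⟨k, hk, hk'⟩).2]
    simp

theorem box_lt_numCols {n : ℕ} {lam : Fin n → ℕ} (b : Box lam) : b.2.val < numCols lam :=
  b.2.2.trans_le (Finset.le_sup (Finset.mem_univ b.1))

/-- The map θ relabels boxes: ⟨f_c⟩^⊥ has as basis the boxes other than the top boxes of the columns
in c. A column that loses its top box is a column shortened by one, shifted down by one row, so
relabelling columns by τ respects x^λ. -/
theorem exists_theta (hlam : Antitone lam) (hc : Admissible lam c) :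
    ∃ θ : BoxSpace lam →ₗ[ℂ] BoxSpace (lamBar lam c),
      Set.BijOn θ (perp lam (colSpan lam c)) Set.univ ∧
      ∀ v ∈ perp lam (colSpan lam c), θ (nil lam v) = nil (lamBar lam c) (θ v) := by
  obtain ⟨τ, hτ, hinj, hsurj⟩ := exists_column_bijection hlam hc
  have hbar := lamBar_antitone lam c
  let s : ℕ → ℕ := fun j => if j ∈ c then 1 else 0
  have hs : ∀ j, cutHeight lam c j + s j = colHeight lam j := cutHeight_add hlam hc
  have hex : ∀ b : Box (lamBar lam c), ∃ b' : Box lam,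
      b'.1.val = b.1.val + s (τ b.2.val) ∧ b'.2.val = τ b.2.val := by
    intro b
    have h1 := (lt_colHeight_iff hbar b.1 b.2.val).2 b.2.2
    have h2 := (hτ _ (box_lt_numCols b)).2
    have h3 := hs (τ b.2.val)
    have h4 := colHeight_le lam (τ b.2.val)
    have h5 : b.1.val + s (τ b.2.val) < n + 1 := by omega
    exact ⟨⟨⟨_, h5⟩, ⟨τ b.2.val, (lt_colHeight_iff hlam ⟨_, h5⟩ _).1 (by simp only; omega)⟩⟩,
      rfl, rfl⟩
  choose e he1 he2 using hex
  have hs01 : ∀ j, s j = 0 ∨ s j = 1 := by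
    intro j
    simp only [s]
    split_ifs <;> simp
  have hsc : ∀ j, s j = 1 ↔ j ∈ c := by
    intro j
    simp only [s]
    split_ifs with h <;> simp [h]
  have hmem : ∀ b : Box lam, b ∈ boxesOf lam c ↔ b.1.val = 0 ∧ b.2.val ∈ c := by
    intro b
    constructor
    · intro hb
      have h0 := hc.eq_zero hb
      refine ⟨h0, ?_⟩
      rw [← pos_of_eq_zero h0]
      exact mem_boxesOf.1 hb
    · rintro ⟨h0, hb⟩
      rw [mem_boxesOf, pos_of_eq_zero h0]
      exact hb
  have hnot : ∀ b, e b ∉ boxesOf lam c := by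
    intro b hb
    rw [hmem, he1, he2] at hb
    have := (hsc _).2 hb.2
    omega
  have heinj : Function.Injective e := by
    intro b b' h
    have h2 : b.2.val = b'.2.val := by
      refine hinj _ (box_lt_numCols b) _ (box_lt_numCols b') ?_
      rw [← he2, ← he2, h]
    have h1 := he1 b
    rw [h, he1 b', h2] at h1
    exact box_ext (by omega) h2
  have hesurj : ∀ b : Box lam, b ∉ boxesOf lam c → ∃ b', e b' = b := by
    intro b hb
    have h1 := (lt_colHeight_iff hlam b.1 b.2.val).2 b.2.2
    have h2 := hs b.2.val
    have h3 : s b.2.val ≤ b.1.val := by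
      rcases hs01 b.2.val with h | h
      · omega
      · rw [hmem, ← hsc] at hb
        omega
    obtain ⟨j, hj, hjk⟩ := hsurj b.2.val (box_lt_numCols b) (by omega)
    have h4 := (hτ j hj).2
    rw [hjk] at h4
    have h5 := colHeight_le (lamBar lam c) j
    have h6 : b.1.val - s b.2.val < n := by omega
    refine ⟨⟨⟨_, h6⟩, ⟨j, (lt_colHeight_iff hbar ⟨_, h6⟩ _).1 (by simp only; omega)⟩⟩, ?_⟩
    refine box_ext ?_ ?_
    · rw [he1]
      simp only [hjk]
      omega
    · rw [he2]
      exact hjk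
  refine ⟨LinearMap.funLeft ℂ ℂ e, ⟨fun _ _ => trivial, ?_, ?_⟩, ?_⟩
  · intro v hv w hw h
    funext b
    by_cases hb : b ∈ boxesOf lam c
    · rw [mem_perp_colSpan.1 hv b hb, mem_perp_colSpan.1 hw b hb]
    · obtain ⟨b', rfl⟩ := hesurj b hb
      exact congrFun h b'
  · intro w _
    refine ⟨fun b => if h : ∃ b', e b' = b then w h.choose else 0, ?_, ?_⟩
    · refine mem_perp_colSpan.2 fun b hb => dif_neg ?_
      rintro ⟨b', rfl⟩
      exact hnot b' hb
    · funext b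
      have h : ∃ b', e b' = e b := ⟨b, rfl⟩
      rw [LinearMap.funLeft_apply, dif_pos h, heinj h.choose_spec]
  · intro v hv
    funext b
    rw [LinearMap.funLeft_apply]
    by_cases h0 : b.1.val = 0
    · rw [nil_apply_eq_zero _ h0]
      have h1 := he1 b
      -- A top box of the smaller diagram comes from the top row, or from the second row of a column
      -- in c. In the latter case the box above it belongs to c, where v vanishes.
      rcases hs01 (τ b.2.val) with h | h
      · exact nil_apply_eq_zero _ (by omega)
      · obtain ⟨a, ha, ha'⟩ := exists_above hlam (b := e b) (by omega)
        rw [nil_apply v ha ha', mem_perp_colSpan.1 hv]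
        rw [hmem, ← ha', he2, ← hsc]
        omega
    · obtain ⟨a, ha, ha'⟩ := exists_above hbar h0
      rw [nil_apply _ ha ha', LinearMap.funLeft_apply]
      refine nil_apply v ?_ ?_
      · rw [he1, he1, ha', ha]
        omega
      · rw [he2, he2, ha']

theorem exists_isAdapted : ∃ θ : ThetaFamily, θ.IsAdapted := by
  classical
  refine ⟨fun n lam c => if h : Antitone lam ∧ Admissible lam c then
    (exists_theta h.1 h.2).choose else 0, fun n lam c hlam hc => ?_⟩
  simp only [dif_pos (show Antitone lam ∧ Admissible lam c from ⟨hlam, hc⟩)]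
  exact (exists_theta hlam hc).choose_spec

end Heights

/-! ### Recursion for tableaux -/

/-! ### Inverting the stable sort of the columns -/

section Lists

/-- The order by which the columns of a tableau are sorted. -/
abbrev LongerEq (C C' : List ℕ) : Prop := C'.length ≤ C.length

theorem exists_orderedInsert {a : ℕ} {l : List ℕ} {R : List (List ℕ)}
    (h : R.map List.length = l.orderedInsert (· ≥ ·) a) :
    ∃ (C : List ℕ) (R' : List (List ℕ)), C.length = a ∧ R'.map List.length = l ∧
      R'.orderedInsert LongerEq C = R := by
  induction l generalizing R with
  | nil =>
    obtain ⟨C, R', rfl, rfl, hR⟩ := List.map_eq_cons_iff.1 h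
    rw [List.map_eq_nil_iff.1 hR]
    exact ⟨C, [], rfl, rfl, rfl⟩
  | cons b l ih =>
    rw [List.orderedInsert_cons] at h
    split_ifs at h with hab
    · obtain ⟨C, R', rfl, rfl, hR⟩ := List.map_eq_cons_iff.1 h
      obtain ⟨D, R'', rfl, rfl, hR'⟩ := List.map_eq_cons_iff.1 hR
      refine ⟨C, D :: R'', rfl, hR, ?_⟩
      rw [List.orderedInsert_cons, if_pos hab]
    · obtain ⟨D, R', rfl, rfl, hR⟩ := List.map_eq_cons_iff.1 h
      obtain ⟨C, R'', rfl, rfl, rfl⟩ := ih hR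
      refine ⟨C, D :: R'', rfl, rfl, ?_⟩
      rw [List.orderedInsert_cons, if_neg hab]

theorem orderedInsert_inj {C C' : List ℕ} {R R' : List (List ℕ)} (hC : C.length = C'.length)
    (hR : R.map List.length = R'.map List.length)
    (h : R.orderedInsert LongerEq C = R'.orderedInsert LongerEq C') : C = C' ∧ R = R' := by
  induction R generalizing R' with
  | nil =>
    rw [List.map_eq_nil_iff.1 hR.symm] at h ⊢
    simpa using h
  | cons D R ih =>
    obtain ⟨D', R'', rfl, hD, hR'⟩ := List.map_eq_cons_iff.1 hR.symm
    rw [List.orderedInsert_cons, List.orderedInsert_cons] at h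
    have hiff : LongerEq C D ↔ LongerEq C' D' := by rw [LongerEq, LongerEq, hC, hD]
    by_cases hCD : LongerEq C D
    · rw [if_pos hCD, if_pos (hiff.1 hCD)] at h
      simpa using h
    · rw [if_neg hCD, if_neg (mt hiff.2 hCD), List.cons.injEq] at h
      obtain ⟨h1, h2⟩ := ih hR'.symm h.2
      exact ⟨h1, by rw [h.1, h2]⟩

theorem map_length_insertionSort (L : List (List ℕ)) :
    (L.insertionSort LongerEq).map List.length = (L.map List.length).insertionSort (· ≥ ·) :=
  List.map_insertionSort _ _ _ _ fun _ _ _ _ => Iff.rfl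

/-- Sorting compares only lengths, so the permutation it performs is determined by the list of
lengths before sorting and can be undone once that list is known. `insertionSort_inj` is the
uniqueness counterpart. -/
theorem exists_insertionSort {l : List ℕ} {R : List (List ℕ)}
    (h : R.map List.length = l.insertionSort (· ≥ ·)) :
    ∃ L : List (List ℕ), L.map List.length = l ∧ L.insertionSort LongerEq = R := by
  induction l generalizing R with
  | nil => exact ⟨[], rfl, (List.map_eq_nil_iff.1 h).symm⟩
  | cons a l ih =>
    rw [List.insertionSort_cons] at h
    obtain ⟨C, R', rfl, hR', rfl⟩ := exists_orderedInsert h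
    obtain ⟨L, rfl, rfl⟩ := ih hR'
    exact ⟨C :: L, rfl, rfl⟩

theorem insertionSort_inj {L L' : List (List ℕ)} (hL : L.map List.length = L'.map List.length)
    (h : L.insertionSort LongerEq = L'.insertionSort LongerEq) : L = L' := by
  induction L generalizing L' with
  | nil => exact (List.map_eq_nil_iff.1 hL.symm).symm
  | cons C L ih =>
    obtain ⟨C', L'', rfl, hC, hL'⟩ := List.map_eq_cons_iff.1 hL.symm
    rw [List.insertionSort_cons, List.insertionSort_cons] at h
    obtain ⟨h1, h2⟩ := orderedInsert_inj hC.symm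
      (by rw [map_length_insertionSort, map_length_insertionSort, hL']) h
    rw [h1, ih hL'.symm h2]

theorem map_length_filter (L : List (List ℕ)) :
    (L.filter fun C => C ≠ []).map List.length = (L.map List.length).filter fun t => t ≠ 0 := by
  rw [List.filter_map]
  congr 1
  refine List.filter_congr fun C _ => ?_
  simp [List.length_eq_zero_iff]

theorem exists_filter {l : List ℕ} {R : List (List ℕ)}
    (h : R.map List.length = l.filter fun t => t ≠ 0) :
    ∃ L : List (List ℕ), L.map List.length = l ∧ (L.filter fun C => C ≠ []) = R := by
  induction l generalizing R with
  | nil => exact ⟨[], rfl, (List.map_eq_nil_iff.1 h).symm⟩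
  | cons a l ih =>
    by_cases ha : a = 0
    · subst ha
      obtain ⟨L, rfl, rfl⟩ := ih (R := R) (by simpa using h)
      exact ⟨[] :: L, rfl, by simp⟩
    · rw [List.filter_cons_of_pos (by simpa using ha)] at h
      obtain ⟨C, R', rfl, rfl, hR⟩ := List.map_eq_cons_iff.1 h
      obtain ⟨L, rfl, rfl⟩ := ih hR
      refine ⟨C :: L, rfl, ?_⟩
      rw [List.filter_cons_of_pos]
      simpa [List.length_eq_zero_iff] using ha

theorem filter_inj {L L' : List (List ℕ)} (hL : L.map List.length = L'.map List.length)
    (h : (L.filter fun C => C ≠ []) = L'.filter fun C => C ≠ []) : L = L' := by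
  induction L generalizing L' with
  | nil => exact (List.map_eq_nil_iff.1 hL.symm).symm
  | cons C L ih =>
    obtain ⟨C', L'', rfl, hC, hL'⟩ := List.map_eq_cons_iff.1 hL.symm
    by_cases h0 : C = []
    · subst h0
      rw [List.length_eq_zero_iff.1 hC] at h ⊢
      rw [ih hL'.symm (by simpa using h)]
    · have h0' : C' ≠ [] := fun h1 =>
        h0 (List.length_eq_zero_iff.1 (by rw [← hC, h1]; rfl))
      rw [List.filter_cons_of_pos (by simpa using h0),
        List.filter_cons_of_pos (by simpa using h0'), List.cons.injEq] at h
      rw [h.1, ih hL'.symm h.2]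

theorem count_map_range (N : ℕ) (h : ℕ → ℕ) (t : ℕ) :
    ((List.range N).map h).count t = ((Finset.range N).filter fun j => h j = t).card := by
  rw [List.count, List.countP_map, List.countP_eq_length_filter, Finset.card_def]
  simp only [Finset.filter_val, Finset.range_val, Multiset.range, Multiset.filter_coe,
    Multiset.coe_card]
  congr 1

/-- A strictly increasing column with largest possible entry `m` is its part without `m`,
followed by `m` if necessary. -/
theorem erase_append {C : List ℕ} (hC : C.Pairwise (· < ·)) {m : ℕ} (hm : ∀ x ∈ C, x ≤ m) :
    C.erase m ++ (if m ∈ C then [m] else []) = C := by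
  induction C with
  | nil => simp
  | cons a C ih =>
    rw [List.pairwise_cons] at hC
    have ih := ih hC.2 fun x hx => hm x (List.mem_cons_of_mem _ hx)
    by_cases ha : a = m
    · subst ha
      have : C = [] := List.eq_nil_iff_forall_not_mem.2 fun x hx =>
        absurd (hC.1 x hx) (not_lt.2 (hm x (List.mem_cons_of_mem _ hx)))
      simp [this]
    · rw [List.erase_cons_tail (by simpa using ha), List.cons_append]
      simp only [List.mem_cons, Ne.symm ha, false_or, ih]

theorem eq_map_range (T : Tableau) : T = (List.range T.length).map fun j => T.getD j [] := by
  refine List.ext_getElem (by simp) fun i h1 h2 => ?_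
  simp [h1]

end Lists

/-! ### Removing the largest entry from a tableau -/

section Recursion

theorem length_of_mem_col {n : ℕ} {lam mu : Fin n → ℕ} {T : Tableau} (hT : T ∈ Col lam mu) :
    T.length = numCols lam := by
  simpa using congrArg List.length hT.1

theorem length_getD_of_mem_col {n : ℕ} {lam mu : Fin n → ℕ} {T : Tableau} (hT : T ∈ Col lam mu)
    {j : ℕ} (hj : j < numCols lam) : (T.getD j []).length = colHeight lam j := by
  have h1 : j < T.length := by rwa [length_of_mem_col hT]
  have h2 : (T.map List.length)[j]? = ((List.range (numCols lam)).map (colHeight lam))[j]? := by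
    rw [hT.1]
  simpa [h1, hj] using h2

theorem getD_mem_of_mem_col {n : ℕ} {lam mu : Fin n → ℕ} {T : Tableau} (hT : T ∈ Col lam mu)
    {j : ℕ} (hj : j < numCols lam) : T.getD j [] ∈ T := by
  have h1 : j < T.length := by rwa [length_of_mem_col hT]
  simp [h1]

/-- The prescribed multiplicities of 1, …, n already exhaust all boxes, leaving no room for another
entry. -/
theorem mem_col_le {n : ℕ} {lam mu : Fin n → ℕ} (hsum : ∑ i, mu i = ∑ i, lam i) {T : Tableau}
    (hT : T ∈ Col lam mu) {C : List ℕ} (hC : C ∈ T) {x : ℕ} (hx : x ∈ C) : 1 ≤ x ∧ x ≤ n := by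
  set S : Finset ℕ := Finset.univ.image fun i : Fin n => i.val + 1
  by_contra hcon
  have hxS : x ∉ S := by
    intro h
    obtain ⟨i, _, rfl⟩ := Finset.mem_image.1 h
    omega
  have h1 : ∑ a ∈ S, T.flatten.count a = ∑ i, mu i := by
    rw [Finset.sum_image fun i _ i' _ h => Fin.ext (by simpa using h)]
    exact Finset.sum_congr rfl fun i _ => hT.2.2 i
  have h2 : T.flatten.length = ∑ i, lam i := by
    rw [List.length_flatten, hT.1, ← sum_colHeight]
    rfl
  have h3 : ∑ a ∈ insert x S, T.flatten.count a ≤ T.flatten.length := by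
    rw [← List.sum_toFinset_count_eq_length]
    refine Finset.sum_le_sum_of_ne_zero fun a _ ha => ?_
    rw [List.mem_toFinset]
    exact List.count_pos_iff.1 (Nat.pos_of_ne_zero ha)
  rw [Finset.sum_insert hxS, h1, h2, hsum] at h3
  have : 0 < T.flatten.count x := List.count_pos_iff.2 (List.mem_flatten.2 ⟨C, hC, hx⟩)
  omega

variable {n : ℕ} {lam mu : Fin (n + 1) → ℕ}

/-- The heights of the columns of the smaller diagram. -/
theorem sort_cutHeight (hlam : Antitone lam) {c : List ℕ} (hc : Admissible lam c) :
    (((List.range (numCols lam)).map (cutHeight lam c)).filter fun t => t ≠ 0).insertionSort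
      (· ≥ ·) = (List.range (numCols (lamBar lam c))).map (colHeight (lamBar lam c)) := by
  -- Both lists are weakly decreasing, so only multiplicities have to be compared.
  refine List.Perm.eq_of_pairwise' (r := (· ≥ ·)) (List.pairwise_insertionSort _ _) ?_ ?_
  · rw [List.pairwise_map]
    refine List.pairwise_lt_range.imp fun {i j} hij => ?_
    exact Finset.card_le_card (Finset.monotone_filter_right _ fun a _ h => hij.trans h)
  · refine (List.perm_insertionSort _ _).trans (List.perm_iff_count.2 fun t => ?_)
    rw [count_map_range]
    rcases Nat.eq_zero_or_pos t with rfl | ht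
    · rw [List.count_eq_zero_of_not_mem (by simp), Finset.filter_false_of_mem, Finset.card_empty]
      intro j hj
      exact (lt_numCols_iff.1 (Finset.mem_range.1 hj)).ne'
    · rw [List.count_filter (by simpa using ht.ne'), count_map_range,
        card_eq_colHeight_lamBar hlam hc ht]

theorem sum_lamBar (hlam : Antitone lam) {c : List ℕ} (hc : Admissible lam c) :
    ∑ i, lamBar lam c i + c.length = ∑ i, lam i := by
  rw [← sum_colHeight, ← sum_colHeight lam]
  have h1 : ∑ j ∈ Finset.range (numCols (lamBar lam c)), colHeight (lamBar lam c) j =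
      ((List.range (numCols (lamBar lam c))).map (colHeight (lamBar lam c))).sum := rfl
  have h2 : ∀ l : List ℕ, (l.filter fun t => t ≠ 0).sum = l.sum := by
    intro l
    induction l with
    | nil => rfl
    | cons a l ih => by_cases ha : a = 0 <;> simp_all
  rw [h1, ← sort_cutHeight hlam hc, (List.perm_insertionSort _ _).sum_eq, h2]
  have h3 : ((List.range (numCols lam)).map (cutHeight lam c)).sum =
      ∑ j ∈ Finset.range (numCols lam), cutHeight lam c j := rfl
  have h4 : c.length = ∑ j ∈ Finset.range (numCols lam), if j ∈ c then 1 else 0 := by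
    rw [← Finset.card_filter, ← List.toFinset_card_of_nodup (hc.1.imp fun h => h.ne)]
    congr 1
    ext j
    simp only [List.mem_toFinset, Finset.mem_filter, Finset.mem_range]
    refine ⟨fun h => ⟨?_, h⟩, fun h => h.2⟩
    rw [numCols_eq hlam]
    exact hc.2.1 j h
  rw [h3, h4, ← Finset.sum_add_distrib]
  exact Finset.sum_congr rfl fun j _ => cutHeight_add hlam hc j

theorem mem_colsWith {m : ℕ} {T : Tableau} {j : ℕ} :
    j ∈ colsWith m T ↔ j < T.length ∧ m ∈ T.getD j [] := by
  simp [colsWith]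

theorem pairwise_colsWith (m : ℕ) (T : Tableau) : (colsWith m T).Pairwise (· < ·) :=
  List.pairwise_lt_range.filter _

theorem bar_perm (m : ℕ) (T : Tableau) :
    (bar m T).Perm ((T.map fun C => C.erase m).filter fun C => C ≠ []) :=
  List.perm_insertionSort _ _

theorem bar_flatten_perm (m : ℕ) (T : Tableau) :
    (bar m T).flatten.Perm (T.map fun C => C.erase m).flatten := by
  refine (bar_perm m T).flatten.trans ?_
  rw [List.flatten_filter_ne_nil]

theorem count_flatten_bar {m x : ℕ} (hx : x ≠ m) (T : Tableau) :
    (bar m T).flatten.count x = T.flatten.count x := by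
  rw [(bar_flatten_perm _ _).count_eq, List.count_flatten, List.map_map, List.count_flatten]
  congr 1
  exact List.map_congr_left fun C _ => List.count_erase_of_ne hx

theorem count_flatten_eq {T : Tableau} (hT : ∀ C ∈ T, C.Pairwise (· < ·)) (m : ℕ) :
    T.flatten.count m = (colsWith m T).length := by
  rw [List.count_flatten, colsWith, ← List.countP_eq_length_filter]
  conv_lhs => rw [eq_map_range T, List.map_map]
  have h1 : ∀ j ∈ List.range T.length, ((List.count m) ∘ fun j => T.getD j []) j =
      if m ∈ T.getD j [] then 1 else 0 := by
    intro j hj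
    refine List.Nodup.count ((hT _ ?_).imp fun h => h.ne)
    have : j < T.length := List.mem_range.1 hj
    simp [this]
  rw [List.map_congr_left h1]
  generalize List.range T.length = l
  induction l with
  | nil => rfl
  | cons a l ih =>
    rw [List.map_cons, List.sum_cons, ih, List.countP_cons, add_comm]
    simp

variable (hlam : Antitone lam) (hsum : ∑ i, mu i = ∑ i, lam i)
include hlam hsum

/-- A strictly increasing column of height n + 1 with entries in 1, …, n + 1 must contain n + 1. -/
theorem admissible_colsWith {T : Tableau} (hT : T ∈ Col lam mu) :
    Admissible lam (colsWith (n + 1) T) := by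
  refine ⟨pairwise_colsWith _ _, fun j hj => ?_, fun j hj => ?_⟩
  · rw [mem_colsWith, length_of_mem_col hT, numCols_eq hlam] at hj
    exact hj.1
  · have hj' : j < numCols lam := hj.trans_le (Finset.le_sup (Finset.mem_univ _))
    rw [mem_colsWith, length_of_mem_col hT]
    refine ⟨hj', ?_⟩
    by_contra hmem
    have h1 := (lt_colHeight_iff hlam (Fin.last n) j).2 hj
    rw [← length_getD_of_mem_col hT hj', Fin.val_last] at h1
    have hC := getD_mem_of_mem_col hT hj'
    rw [← List.toFinset_card_of_nodup ((hT.2.1 _ hC).imp fun h => h.ne)] at h1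
    have h2 : (T.getD j []).toFinset ⊆ Finset.Icc 1 n := by
      intro x hx
      rw [List.mem_toFinset] at hx
      have h3 := mem_col_le hsum hT hC hx
      have h4 : x ≠ n + 1 := fun h => hmem (h ▸ hx)
      rw [Finset.mem_Icc]
      omega
    have := Finset.card_le_card h2
    rw [Nat.card_Icc] at this
    omega

omit hlam hsum in
theorem length_colsWith {T : Tableau} (hT : T ∈ Col lam mu) :
    (colsWith (n + 1) T).length = mu (Fin.last n) := by
  rw [← count_flatten_eq hT.2.1, ← hT.2.2 (Fin.last n), Fin.val_last]

omit hlam hsum in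
theorem map_length_erase {T : Tableau} (hT : T ∈ Col lam mu) :
    (T.map fun C => C.erase (n + 1)).map List.length =
      (List.range (numCols lam)).map (cutHeight lam (colsWith (n + 1) T)) := by
  conv_lhs => rw [eq_map_range T, List.map_map, List.map_map, length_of_mem_col hT]
  refine List.map_congr_left fun j hj => ?_
  have hj' : j < numCols lam := List.mem_range.1 hj
  simp only [Function.comp_apply, List.length_erase, cutHeight, mem_colsWith,
    length_getD_of_mem_col hT hj', length_of_mem_col hT, hj', true_and]
  split_ifs <;> rfl

theorem bar_mem_col {T : Tableau} (hT : T ∈ Col lam mu) :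
    bar (n + 1) T ∈ Col (lamBar lam (colsWith (n + 1) T)) (fun i => mu i.castSucc) := by
  refine ⟨?_, fun C hC => ?_, fun i => ?_⟩
  · rw [bar, map_length_insertionSort, map_length_filter, map_length_erase hT,
      sort_cutHeight hlam (admissible_colsWith hlam hsum hT)]
  · have := (bar_perm _ _).mem_iff.1 hC
    obtain ⟨D, hD, rfl⟩ := List.mem_map.1 (List.mem_filter.1 this).1
    exact (hT.2.1 D hD).sublist List.erase_sublist
  · rw [count_flatten_bar]
    · exact hT.2.2 i.castSucc
    · have := i.2
      omega

omit hlam in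
-- The columns containing n + 1 fix the lengths after removal, so the sorting and the deletion of
-- empty columns can be undone. The entry n + 1 then returns to the bottom of the listed columns.
theorem col_ext {T T' : Tableau} (hT : T ∈ Col lam mu) (hT' : T' ∈ Col lam mu)
    (hc : colsWith (n + 1) T = colsWith (n + 1) T') (hbar : bar (n + 1) T = bar (n + 1) T') :
    T = T' := by
  have h1 : (T.map fun C => C.erase (n + 1)).map List.length =
      (T'.map fun C => C.erase (n + 1)).map List.length := by
    rw [map_length_erase hT, map_length_erase hT', hc]
  have h2 := filter_inj h1 (insertionSort_inj
    (by rw [map_length_filter, map_length_filter, h1]) hbar)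
  rw [eq_map_range T, eq_map_range T', length_of_mem_col hT, length_of_mem_col hT']
  refine List.map_congr_left fun j hj => ?_
  have hj' : j < numCols lam := List.mem_range.1 hj
  have hC := getD_mem_of_mem_col hT hj'
  have hC' := getD_mem_of_mem_col hT' hj'
  rw [← erase_append (hT.2.1 _ hC) fun x hx => (mem_col_le hsum hT hC hx).2,
    ← erase_append (hT'.2.1 _ hC') fun x hx => (mem_col_le hsum hT' hC' hx).2]
  have h3 : (n + 1 ∈ T.getD j []) ↔ (n + 1 ∈ T'.getD j []) := by
    have h4 : j ∈ colsWith (n + 1) T ↔ j ∈ colsWith (n + 1) T' := by rw [hc]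
    simpa only [mem_colsWith, length_of_mem_col hT, length_of_mem_col hT', hj', true_and]
      using h4
  have h5 : (T.getD j []).erase (n + 1) = (T'.getD j []).erase (n + 1) := by
    have h6 := congrArg (fun L : List (List ℕ) => L.getD j []) h2
    have h7 : j < T.length := by rwa [length_of_mem_col hT]
    have h8 : j < T'.length := by rwa [length_of_mem_col hT']
    simpa [h7, h8] using h6
  rw [h5]
  simp only [h3]

/-- Unsort R and restore empty columns so that the lengths become those of lam with c cut off, then
append n + 1 to the columns in c. Strictness holds because all entries of R are at most n. -/
theorem exists_mem_col {c : List ℕ} (hc : Admissible lam c) (hlen : c.length = mu (Fin.last n))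
    {R : Tableau} (hR : R ∈ Col (lamBar lam c) (fun i => mu i.castSucc)) :
    ∃ T ∈ Col lam mu, colsWith (n + 1) T = c ∧ bar (n + 1) T = R := by
  have hsum' : ∑ i : Fin n, mu i.castSucc = ∑ i, lamBar lam c i := by
    have := sum_lamBar hlam hc
    rw [← hsum, Fin.sum_univ_castSucc, hlen] at this
    omega
  obtain ⟨L', hL', rfl⟩ := exists_insertionSort (hR.1.trans (sort_cutHeight hlam hc).symm)
  obtain ⟨L, hL, rfl⟩ := exists_filter hL'
  have hlenL : L.length = numCols lam := by simpa using congrArg List.length hL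
  have hLj : ∀ j < numCols lam, (L.getD j []).length = cutHeight lam c j := by
    intro j hj
    have h1 : j < L.length := by rwa [hlenL]
    have h2 : (L.map List.length)[j]? = ((List.range (numCols lam)).map (cutHeight lam c))[j]? := by
      rw [hL]
    simpa [h1, hj] using h2
  have hLR : ∀ C ∈ L, C ≠ [] →
      C ∈ (L.filter fun C => C ≠ []).insertionSort LongerEq := by
    intro C hC h0
    rw [(List.perm_insertionSort _ _).mem_iff]
    exact List.mem_filter.2 ⟨hC, by simpa using h0⟩
  have hLle : ∀ C ∈ L, ∀ x ∈ C, x ≤ n := fun C hC x hx =>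
    (mem_col_le hsum' hR (hLR C hC (List.ne_nil_of_mem hx)) hx).2
  have hLlt : ∀ C ∈ L, C.Pairwise (· < ·) := by
    intro C hC
    by_cases h0 : C = []
    · simp [h0]
    · exact hR.2.1 C (hLR C hC h0)
  have hmem : ∀ j < numCols lam, L.getD j [] ∈ L := by
    intro j hj
    have h1 : j < L.length := by rwa [hlenL]
    simp [h1]
  have hnot : ∀ j < numCols lam, n + 1 ∉ L.getD j [] := fun j hj hx => by
    have := hLle _ (hmem j hj) _ hx
    omega
  set t : ℕ → List ℕ := fun j => L.getD j [] ++ if j ∈ c then [n + 1] else [] with ht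
  set T : Tableau := (List.range (numCols lam)).map t with hTdef
  have hTlen : T.length = numCols lam := by simp [hTdef]
  have hTj : ∀ j < numCols lam, T.getD j [] = t j := by
    intro j hj
    simp [hTdef, hj]
  have hmt : ∀ j < numCols lam, (n + 1 ∈ t j ↔ j ∈ c) := by
    intro j hj
    have := hnot j hj
    simp only [ht, List.mem_append, this, false_or]
    split_ifs with h <;> simp [h]
  have hcols : colsWith (n + 1) T = c := by
    refine List.Pairwise.eq_of_mem_iff (r := (· < ·)) (pairwise_colsWith _ _) hc.1 fun j => ?_
    rw [mem_colsWith, hTlen]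
    constructor
    · rintro ⟨h1, h2⟩
      rwa [hTj j h1, hmt j h1] at h2
    · intro h
      have h1 : j < numCols lam := by
        rw [numCols_eq hlam]
        exact hc.2.1 j h
      refine ⟨h1, ?_⟩
      rwa [hTj j h1, hmt j h1]
  have herase : (T.map fun C => C.erase (n + 1)) = L := by
    rw [eq_map_range L, hTdef, List.map_map, hlenL]
    refine List.map_congr_left fun j hj => ?_
    have h1 := hnot j (List.mem_range.1 hj)
    simp only [Function.comp_apply, ht]
    rw [List.erase_append_right _ h1]
    split_ifs <;> simp
  have hbar : bar (n + 1) T = (L.filter fun C => C ≠ []).insertionSort LongerEq := by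
    rw [bar, herase]
  have hpair : ∀ C ∈ T, C.Pairwise (· < ·) := by
    intro C hC
    obtain ⟨j, hj, rfl⟩ := List.mem_map.1 hC
    have hj' := List.mem_range.1 hj
    refine List.pairwise_append.2 ⟨hLlt _ (hmem j hj'), by split_ifs <;> simp, ?_⟩
    intro x hx y hy
    have h1 := hLle _ (hmem j hj') x hx
    split_ifs at hy
    · rw [List.mem_singleton] at hy
      omega
    · simp at hy
  refine ⟨T, ⟨?_, hpair, fun i => ?_⟩, hcols, hbar⟩
  · rw [hTdef, List.map_map]
    refine List.map_congr_left fun j hj => ?_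
    rw [← cutHeight_add hlam hc j, ← hLj j (List.mem_range.1 hj)]
    simp only [Function.comp_apply, ht, List.length_append]
    split_ifs <;> simp
  · refine Fin.lastCases ?_ (fun i => ?_) i
    · rw [Fin.val_last, count_flatten_eq hpair, hcols, hlen]
    · refine Eq.trans ?_ (hR.2.2 i)
      rw [← hbar, count_flatten_bar, Fin.val_castSucc]
      have := i.2
      omega

end Recursion

/-! ### Column sequences and the Bruhat order -/

section ColumnSequences

theorem lt_countP_iff {l : List ℕ} (hc : l.Pairwise (· < ·)) (i m : ℕ) :
    i < l.countP (· < m) ↔ ∃ h : i < l.length, l[i] < m := by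
  induction l generalizing i with
  | nil => simp
  | cons a l ih =>
    rw [List.pairwise_cons] at hc
    rw [List.countP_cons]
    by_cases ha : a < m
    · cases i with
      | zero => simp [ha]
      | succ i => simpa [ha] using ih hc.2 i
    · have h0 : l.countP (· < m) = 0 := by
        rw [List.countP_eq_zero]
        intro x hx
        have := hc.1 x hx
        simp only [decide_eq_true_eq]
        omega
      simp only [h0, ha, decide_false, Bool.false_eq_true, if_false]
      refine iff_of_false (by omega) ?_
      rintro ⟨h, h'⟩
      cases i with
      | zero => exact ha h'
      | succ i =>
        have := hc.1 _ (List.getElem_mem (l := l) (n := i) (by simpa using h))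
        simp only [List.getElem_cons_succ] at h'
        omega

theorem countP_lt_getElem {l : List ℕ} (hc : l.Pairwise (· < ·)) (i : ℕ) (hi : i < l.length) :
    l.countP (· < l[i]) = i := by
  have h1 := (lt_countP_iff hc i l[i]).not.2 fun ⟨_, h⟩ => lt_irrefl _ h
  rcases Nat.eq_zero_or_pos i with rfl | hpos
  · omega
  · have h2 := (lt_countP_iff hc (i - 1) l[i]).2
      ⟨by omega, List.pairwise_iff_getElem.1 hc _ _ _ _ (by omega)⟩
    omega

theorem le_getElem {l : List ℕ} (hc : l.Pairwise (· < ·)) (i : ℕ) (hi : i < l.length) :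
    i ≤ l[i] := by
  induction i with
  | zero => exact Nat.zero_le _
  | succ i ih =>
    have h1 := ih (by omega)
    have h2 := List.pairwise_iff_getElem.1 hc i (i + 1) (by omega) hi (Nat.lt_succ_self i)
    omega

/-- Both sides say l[i] ≤ l'[i] for all i. The parts are l[i] - i, where truncated subtraction is
harmless since i ≤ l[i]. In the form with counts the condition is the Bruhat order. -/
theorem partLE_iff {l l' : List ℕ} (hc : l.Pairwise (· < ·)) (hc' : l'.Pairwise (· < ·))
    (hlen : l.length = l'.length) :
    PartLE (partOfCols l) (partOfCols l') ↔
      ∀ m, l'.countP (· < m) ≤ l.countP (· < m) := by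
  have key : ∀ (l : List ℕ) (i : ℕ) (hi : i < l.length),
      (partOfCols l).getD i 0 = l[l.length - 1 - i] - (l.length - 1 - i) := by
    intro l i hi
    simp [partOfCols, hi]
  have h1 : PartLE (partOfCols l) (partOfCols l') ↔
      ∀ (i : ℕ) (hi : i < l.length), l[i] ≤ l'[i]'(hlen ▸ hi) := by
    constructor
    · intro h i hi
      have h2 := h (l.length - 1 - i)
      have h3 : l.length - 1 - (l.length - 1 - i) = i := by omega
      rw [key l _ (by omega), key l' _ (by omega)] at h2
      simp only [← hlen, h3] at h2
      have h4 := le_getElem hc i hi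
      have h5 := le_getElem hc' i (hlen ▸ hi)
      omega
    · intro h i
      rcases Nat.lt_or_ge i l.length with hi | hi
      · rw [key l _ hi, key l' _ (by omega)]
        simp only [← hlen]
        exact Nat.sub_le_sub_right (h _ _) _
      · have : (partOfCols l).length ≤ i := by simpa [partOfCols] using hi
        simp [this]
  rw [h1]
  constructor
  · intro h m
    by_contra hcon
    obtain ⟨hi, h2⟩ := (lt_countP_iff hc' _ m).1 (not_le.1 hcon)
    have h3 : l.countP (· < m) < l.length := hlen ▸ hi
    exact lt_irrefl _ ((lt_countP_iff hc _ m).2 ⟨h3, (h _ h3).trans_lt h2⟩)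
  · intro h i hi
    have h2 := (lt_countP_iff hc' i (l'[i]'(hlen ▸ hi) + 1)).2 ⟨hlen ▸ hi, Nat.lt_succ_self _⟩
    obtain ⟨_, h3⟩ := (lt_countP_iff hc _ _).1 (h2.trans_le (h _))
    omega

theorem eq_of_countP_eq {l l' : List ℕ} (hc : l.Pairwise (· < ·)) (hc' : l'.Pairwise (· < ·))
    (h : ∀ m, l.countP (· < m) = l'.countP (· < m)) : l = l' := by
  have hmem : ∀ (l : List ℕ) x, l.countP (· < x + 1) = l.countP (· < x) + l.count x := by
    intro l x
    induction l with
    | nil => rfl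
    | cons a l ih =>
      rw [List.countP_cons, List.countP_cons, List.count_cons, ih]
      rcases lt_trichotomy a x with h | h | h
      · simp [h, h.ne, h.trans (Nat.lt_succ_self x)]
        omega
      · simp [h]
        omega
      · have : ¬ a < x + 1 := by omega
        simp [this, h.ne', h.not_gt]
  refine List.Pairwise.eq_of_mem_iff (r := (· < ·)) hc hc' fun x => ?_
  rw [← List.count_pos_iff, ← List.count_pos_iff]
  have h1 := hmem l x
  have h2 := hmem l' x
  have h3 := h x
  have h4 := h (x + 1)
  omega

theorem partLT_iff {l l' : List ℕ} (hc : l.Pairwise (· < ·)) (hc' : l'.Pairwise (· < ·))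
    (hlen : l.length = l'.length) :
    PartLT (partOfCols l) (partOfCols l') ↔
      (∀ m, l'.countP (· < m) ≤ l.countP (· < m)) ∧ l ≠ l' := by
  rw [PartLT, partLE_iff hc hc' hlen, partLE_iff hc' hc hlen.symm]
  refine and_congr_right fun h => not_congr ⟨fun h' => ?_, fun h' m => h' ▸ le_rfl⟩
  exact eq_of_countP_eq hc hc' fun m => le_antisymm (h' m) (h m)

theorem partOfCols_inj {l l' : List ℕ} (hc : l.Pairwise (· < ·)) (hc' : l'.Pairwise (· < ·))
    (hlen : l.length = l'.length) : partOfCols l = partOfCols l' ↔ l = l' := by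
  refine ⟨fun h => ?_, fun h => h ▸ rfl⟩
  have h1 := (partLE_iff hc hc' hlen).1 fun i => h ▸ le_rfl
  have h2 := (partLE_iff hc' hc hlen.symm).1 fun i => h ▸ le_rfl
  exact eq_of_countP_eq hc hc' fun m => le_antisymm (h2 m) (h1 m)

/-- In an increasing list the index of an entry is the number of smaller entries. -/
theorem sum_partOfCols {l : List ℕ} (hc : l.Pairwise (· < ·)) :
    (partOfCols l).sum = ∑ x ∈ l.toFinset, (x - l.countP (· < x)) := by
  rw [List.sum_toFinset _ (hc.imp fun h => h.ne), partOfCols, List.sum_reverse]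
  congr 1
  refine List.ext_getElem (by simp) fun i h1 h2 => ?_
  have hi : i < l.length := by simpa using h2
  simp [countP_lt_getElem hc i hi]

variable {n : ℕ} {lam : Fin (n + 1) → ℕ} {c c' : List ℕ}

theorem card_filter_boxesOf (hc : c.Nodup) (hlt : ∀ j ∈ c, j < lam 0) (m : ℕ) :
    ((boxesOf lam c).filter fun b => pos lam b < m).card = c.countP (· < m) := by
  rw [List.countP_eq_length_filter, ← card_boxesOf (lam := lam) (hc.filter _)
    fun j hj => hlt j (List.mem_filter.1 hj).1]
  congr 1
  ext b
  simp [mem_boxesOf]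

theorem card_pos_lt {m : ℕ} (hm : m ≤ lam 0) :
    (Finset.univ.filter fun b => pos lam b < m).card = m := by
  have h := card_boxesOf (lam := lam) (c := List.range m) List.nodup_range
    fun j hj => (List.mem_range.1 hj).trans_le hm
  rw [List.length_range] at h
  refine Eq.trans (congrArg _ ?_) h
  ext b
  simp [mem_boxesOf]

theorem bruhatLE_boxesOf (hc : Admissible lam c) (hc' : Admissible lam c') :
    BruhatLE (pos lam) (boxesOf lam c) (boxesOf lam c') ↔
      ∀ m, c'.countP (· < m) ≤ c.countP (· < m) := by
  refine forall_congr' fun m => ?_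
  rw [card_filter_boxesOf (hc.1.imp fun h => h.ne) hc.2.1,
    card_filter_boxesOf (hc'.1.imp fun h => h.ne) hc'.2.1]

theorem boxesOf_inj (hc : Admissible lam c) (hc' : Admissible lam c')
    (h : boxesOf lam c = boxesOf lam c') : c = c' := by
  refine eq_of_countP_eq hc.1 hc'.1 fun m => ?_
  rw [← card_filter_boxesOf (hc.1.imp fun h => h.ne) hc.2.1,
    ← card_filter_boxesOf (hc'.1.imp fun h => h.ne) hc'.2.1, h]

/-- Each element of c contributes one coordinate for every earlier position outside c. As c lies in
the top row, every earlier position is occupied by a box, so this number is the corresponding part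
of γ. -/
theorem card_cellIdx (hc : Admissible lam c) :
    Fintype.card (CellIdx (pos lam) (boxesOf lam c)) = (partOfCols c).sum := by
  have hnd : c.Nodup := hc.1.imp fun h => h.ne
  let E : CellIdx (pos lam) (boxesOf lam c) ≃
      Σ i : boxesOf lam c, {j // j ∉ boxesOf lam c ∧ pos lam j < pos lam i.1} :=
    { toFun := fun x => ⟨⟨x.1.1, x.2.1⟩, ⟨x.1.2, x.2.2⟩⟩
      invFun := fun y => ⟨(y.1.1, y.2.1), y.1.2, y.2.2⟩
      left_inv := fun _ => rfl
      right_inv := fun _ => rfl }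
  rw [Fintype.card_congr E, Fintype.card_sigma, sum_partOfCols hc.1]
  have h1 : c.toFinset = (boxesOf lam c).image (pos lam) := by
    ext j
    simp only [List.mem_toFinset, Finset.mem_image, mem_boxesOf]
    refine ⟨fun hj => ⟨⟨0, ⟨j, hc.2.1 j hj⟩⟩, ?_, pos_of_eq_zero rfl⟩, fun ⟨b, hb, h⟩ => h ▸ hb⟩
    rwa [pos_of_eq_zero rfl]
  rw [h1, Finset.sum_image ((pos_injective lam).injOn),
    ← Finset.sum_coe_sort (boxesOf lam c)]
  refine Finset.sum_congr rfl fun i _ => ?_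
  have hi : pos lam i.1 ≤ lam 0 := (hc.2.1 _ (mem_boxesOf.1 i.2)).le
  rw [← card_filter_boxesOf hnd hc.2.1, Fintype.card_subtype]
  refine Nat.eq_sub_of_add_eq ?_
  conv_rhs => rw [← card_pos_lt hi]
  rw [← Finset.card_union_of_disjoint]
  · congr 1
    ext b
    simp only [Finset.mem_union, Finset.mem_filter, Finset.mem_univ, true_and]
    tauto
  · rw [Finset.disjoint_left]
    intro b h1 h2
    simp only [Finset.mem_filter] at h1 h2
    exact h1.2.1 h2.1

end ColumnSequences

/-! ### Schubert cells and the matrices `g(U)` -/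

section Coordinates

variable {n : ℕ} {lam : Fin n → ℕ}

theorem mem_span_f {s : Set (Box lam)} {v : BoxSpace lam} :
    v ∈ Submodule.span ℂ (f lam '' s) ↔ ∀ b ∉ s, v b = 0 := by
  constructor
  · intro hv b hb
    induction hv using Submodule.span_induction with
    | mem u hu =>
      obtain ⟨b', hb', rfl⟩ := hu
      refine Pi.single_eq_of_ne ?_ _
      rintro rfl
      exact hb hb'
    | zero => rfl
    | add u w _ _ hu hw => rw [Pi.add_apply, hu, hw, add_zero]
    | smul a u _ hu => rw [Pi.smul_apply, hu, smul_zero]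
  · intro h
    have hv : v = ∑ b, v b • f lam b := by
      simp only [f, ← Pi.single_smul, smul_eq_mul, mul_one]
      exact (Finset.univ_sum_single v).symm
    rw [hv]
    refine Submodule.sum_mem _ fun b _ => ?_
    by_cases hb : b ∈ s
    · exact Submodule.smul_mem _ _ (Submodule.subset_span ⟨b, hb, rfl⟩)
    · rw [h b hb, zero_smul]
      exact Submodule.zero_mem _

theorem finrank_span_f {t : Set (Box lam)} (s : Finset (Box lam)) (hts : ∀ b, b ∈ t ↔ b ∈ s) :
    Module.finrank ℂ (Submodule.span ℂ (f lam '' t)) = s.card := by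
  obtain rfl : t = Set.range (Subtype.val : s → Box lam) := by
    ext b
    rw [hts, Subtype.range_val]
    rfl
  have hli : LinearIndependent ℂ (f lam) := by
    have h := (Pi.basisFun ℂ (Box lam)).linearIndependent
    convert h using 1
    funext b
    simp [f]
  have h := finrank_span_eq_card (hli.comp (Subtype.val : s → Box lam) Subtype.val_injective)
  rwa [Set.range_comp, Fintype.card_coe] at h

theorem perp_perp (U : Submodule ℂ (BoxSpace lam)) : perp lam (perp lam U) = U := by
  refine LinearMap.BilinForm.orthogonal_orthogonal
    (B := (dotProductBilin ℂ ℂ : LinearMap.BilinForm ℂ (BoxSpace lam))) ?_ ?_ U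
  · constructor
    · intro v hv
      exact dotProduct_eq_zero v hv
    · intro v hv
      exact dotProduct_eq_zero v fun w => (dotProduct_comm v w).trans (hv w)
  · exact fun v w h => (dotProduct_comm w v).trans h

theorem mulVec_f (g : Matrix (Box lam) (Box lam) ℂ) (b j : Box lam) :
    g.mulVecLin (f lam b) j = g j b := by
  simp [f]

theorem nil_f {a b : Box lam} (h : b.1.val = a.1.val + 1) (h' : b.2.val = a.2.val)
    : nil lam (f lam a) = f lam b := by
  funext d
  rw [nil, mulVec_f, nilMatrix, Matrix.of_apply, f, Pi.single_apply]
  refine if_congr ⟨fun hd => box_ext (by omega) (by omega), ?_⟩ rfl rfl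
  rintro rfl
  exact ⟨h, h'⟩

theorem exists_below_of_nil_f_ne_zero {a : Box lam} (h : nil lam (f lam a) ≠ 0) :
    ∃ b : Box lam, b.1.val = a.1.val + 1 ∧ b.2.val = a.2.val := by
  by_contra hcon
  push Not at hcon
  refine h (funext fun d => ?_)
  rw [nil, mulVec_f, nilMatrix, Matrix.of_apply, if_neg fun hd => hcon d hd.1 hd.2]
  rfl

theorem initialSpan_inf_span {s : Set (Box lam)} (m : ℕ) :
    Submodule.span ℂ (f lam '' s) ⊓ initialSpan lam m =
      Submodule.span ℂ (f lam '' {b | b ∈ s ∧ pos lam b < m}) := by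
  ext v
  rw [initialSpan, Submodule.mem_inf, mem_span_f, mem_span_f, mem_span_f, ← forall_and]
  refine forall_congr' fun b => ?_
  simp only [Set.mem_ofPred_eq]
  tauto

end Coordinates

/-! ### The matrices g(U) as transposes of the trivialising matrices -/

section CellMatrix

theorem coefMatrix_apply {β : Type} [Fintype β] [DecidableEq β] {pos : β → ℕ} {c : Finset β}
    (coef : β → β → Option (CellIdx pos c)) (u : CellIdx pos c → ℂ) (b b' : β) :
    coefMatrix coef u b b' = (if b = b' then 1 else 0) + (coef b b').elim 0 u := by
  rw [coefMatrix, Matrix.add_apply, Matrix.one_apply, Matrix.of_apply]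

variable {n : ℕ} {lam : Fin (n + 1) → ℕ} {c : List ℕ} (hlam : Antitone lam)

/-- The matrix `g(U)` as a linear map. -/
abbrev cellMap (c : List ℕ) (u : CellIdx (pos lam) (boxesOf lam c) → ℂ) :
    BoxSpace lam →ₗ[ℂ] BoxSpace lam :=
  (boxMatrix hlam c u).transpose.mulVecLin

theorem boxMatrix_neg_mul (u : CellIdx (pos lam) (boxesOf lam c) → ℂ) :
    boxMatrix hlam c (-u) * boxMatrix hlam c u = 1 :=
  coefMatrix_neg_mul (boxCoef_comp hlam) u

theorem cellMap_neg_cellMap (u : CellIdx (pos lam) (boxesOf lam c) → ℂ) (v : BoxSpace lam) :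
    cellMap hlam c u (cellMap hlam c (-u) v) = v := by
  simp only [cellMap, Matrix.mulVecLin_apply, Matrix.mulVec_mulVec, ← Matrix.transpose_mul,
    boxMatrix_neg_mul, Matrix.transpose_one, Matrix.one_mulVec]

theorem cellMap_f_apply (u : CellIdx (pos lam) (boxesOf lam c) → ℂ) (b j : Box lam) :
    cellMap hlam c u (f lam b) j = (if b = j then 1 else 0) + (boxCoef hlam c b j).elim 0 u :=
  (mulVec_f _ b j).trans (coefMatrix_apply _ u b j)

theorem cellMap_injective (u : CellIdx (pos lam) (boxesOf lam c) → ℂ) :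
    Function.Injective (cellMap hlam c u) := by
  refine Function.LeftInverse.injective (g := cellMap hlam c (-u)) fun v => ?_
  simpa using cellMap_neg_cellMap hlam (-u) v

theorem finrank_map_cellMap (u : CellIdx (pos lam) (boxesOf lam c) → ℂ)
    (U : Submodule ℂ (BoxSpace lam)) :
    Module.finrank ℂ (U.map (cellMap hlam c u)) = Module.finrank ℂ U :=
  (Submodule.equivMapOfInjective _ (cellMap_injective hlam u) U).finrank_eq.symm

theorem dotProduct_cellMap (u : CellIdx (pos lam) (boxesOf lam c) → ℂ) (v w : BoxSpace lam) :
    v ⬝ᵥ cellMap hlam c u w = (boxMatrix hlam c u).mulVec v ⬝ᵥ w := by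
  rw [cellMap, Matrix.mulVecLin_apply, Matrix.dotProduct_mulVec, Matrix.vecMul_transpose]

theorem mem_cellSpace_boxMatrix (hc : Admissible lam c)
    {u : CellIdx (pos lam) (boxesOf lam c) → ℂ} {v : BoxSpace lam} :
    v ∈ cellSpace (pos lam) (boxesOf lam c) u ↔
      ∀ b ∈ boxesOf lam c, (boxMatrix hlam c u).mulVec v b = 0 := by
  rw [mem_cellSpace]
  exact forall₂_congr fun b hb => by rw [coefMatrix_mulVec (boxCoef_eq_some hlam hc hb)]

/-- The subspace consists of the v for which A(u)v is orthogonal to ⟨f_c⟩. Since A(u) is invertible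
with transpose g(U), the orthogonal complement is the image of ⟨f_c⟩ under g(U). -/
theorem perp_cellSpace (hc : Admissible lam c) (u : CellIdx (pos lam) (boxesOf lam c) → ℂ) :
    perp lam (cellSpace (pos lam) (boxesOf lam c) u) = (colSpan lam c).map (cellMap hlam c u) := by
  have hcol : ∀ w : BoxSpace lam, w ∈ colSpan lam c ↔ ∀ b ∉ boxesOf lam c, w b = 0 := by
    intro w
    rw [colSpan, mem_span_f]
    simp only [mem_boxesOf, Set.mem_ofPred_eq]
  ext v
  constructor
  · intro hv
    refine ⟨cellMap hlam c (-u) v, (hcol _).2 fun b hb => ?_, cellMap_neg_cellMap hlam u v⟩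
    have h1 : f lam b ⬝ᵥ cellMap hlam c (-u) v = cellMap hlam c (-u) v b := by
      rw [f, single_dotProduct, one_mul]
    rw [← h1, dotProduct_cellMap]
    refine mem_perp.1 hv _ ((mem_cellSpace_boxMatrix hlam hc).2 fun b' hb' => ?_)
    have h2 := boxMatrix_neg_mul hlam (c := c) (-u)
    rw [neg_neg] at h2
    rw [Matrix.mulVec_mulVec, h2, Matrix.one_mulVec, f, Pi.single_eq_of_ne]
    rintro rfl
    exact hb hb'
  · rintro ⟨w, hw, rfl⟩
    refine mem_perp.2 fun x hx => ?_
    rw [dotProduct_cellMap]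
    refine Finset.sum_eq_zero fun b _ => ?_
    by_cases hb : b ∈ boxesOf lam c
    · rw [(mem_cellSpace_boxMatrix hlam hc).1 hx b hb, zero_mul]
    · rw [(hcol w).1 hw b hb, mul_zero]

/-- Triangularity of g(U): a basis vector changes only by vectors further left in the same row,
which precede it in the reading order. -/
theorem cellMap_mem_initialSpan (u : CellIdx (pos lam) (boxesOf lam c) → ℂ) {m : ℕ}
    {v : BoxSpace lam} (hv : v ∈ initialSpan lam m) : cellMap hlam c u v ∈ initialSpan lam m := by
  rw [initialSpan, mem_span_f] at hv ⊢
  intro j hj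
  rw [cellMap, Matrix.mulVecLin_apply, Matrix.mulVec, dotProduct]
  refine Finset.sum_eq_zero fun b _ => ?_
  by_cases hb : pos lam b < m
  · refine mul_eq_zero_of_left ((coefMatrix_apply _ u b j).trans ?_) _
    rw [if_neg (by rintro rfl; exact hj hb), zero_add, boxCoef, dif_neg]
    · rfl
    · rintro ⟨h1, -, -, h2⟩
      refine hj (lt_trans ?_ hb)
      rw [pos_of_eq_zero rfl, pos_of_eq_zero rfl] at h2
      simp only [pos, h1]
      simp only [topBox] at h2
      omega
  · rw [hv b hb, mul_zero]

include hlam in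
theorem finrank_perp_cellSpace_inf (hc : Admissible lam c)
    (u : CellIdx (pos lam) (boxesOf lam c) → ℂ) (m : ℕ) :
    Module.finrank ℂ (perp lam (cellSpace (pos lam) (boxesOf lam c) u) ⊓ initialSpan lam m :
      Submodule ℂ (BoxSpace lam)) = c.countP (· < m) := by
  have h1 : perp lam (cellSpace (pos lam) (boxesOf lam c) u) ⊓ initialSpan lam m =
      (colSpan lam c ⊓ initialSpan lam m).map (cellMap hlam c u) := by
    rw [perp_cellSpace hlam hc]
    ext v
    constructor
    · rintro ⟨⟨w, hw, rfl⟩, hv⟩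
      refine ⟨w, ⟨hw, ?_⟩, rfl⟩
      have := cellMap_mem_initialSpan hlam (-u) hv
      have h2 := cellMap_neg_cellMap hlam (-u) w
      rw [neg_neg] at h2
      rwa [h2] at this
    · rintro ⟨w, hw, rfl⟩
      exact ⟨⟨w, hw.1, rfl⟩, cellMap_mem_initialSpan hlam u hw.2⟩
  rw [h1, finrank_map_cellMap, colSpan, initialSpan_inf_span,
    ← card_filter_boxesOf (hc.1.imp fun h => h.ne) hc.2.1]
  refine finrank_span_f _ fun b => ?_
  rw [Finset.mem_filter, mem_boxesOf]
  rfl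

include hlam in
-- The intersections with the initial spans have exactly the dimensions counted by c, so the
-- stronger inequalities of a properly smaller c' cannot hold.
theorem perp_cellSpace_mem_schubertCell (hc : Admissible lam c)
    (u : CellIdx (pos lam) (boxesOf lam c) → ℂ) :
    perp lam (cellSpace (pos lam) (boxesOf lam c) u) ∈ schubertCell lam c := by
  have hrank := finrank_perp_cellSpace_inf hlam hc u
  have hfull : Module.finrank ℂ (perp lam (cellSpace (pos lam) (boxesOf lam c) u)) = c.length := by
    rw [perp_cellSpace hlam hc, finrank_map_cellMap,
      ← card_boxesOf (hc.1.imp fun h => h.ne) hc.2.1, colSpan]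
    exact finrank_span_f _ fun b => mem_boxesOf.symm
  refine ⟨⟨hfull, fun i hi => ?_⟩, ?_⟩
  · rw [hrank]
    exact (lt_countP_iff hc.1 _ _).2 ⟨hi, Nat.lt_succ_self _⟩
  · intro h
    obtain ⟨c', ⟨⟨hlen, hc', -⟩, hlt⟩, hmem⟩ := Set.mem_iUnion₂.1 h
    have h1 := (partLT_iff hc' hc.1 hlen).1 hlt
    refine h1.2 (eq_of_countP_eq hc' hc.1 fun m => le_antisymm ?_ (h1.1 m))
    by_contra hcon
    obtain ⟨hi, h2⟩ := (lt_countP_iff hc' _ m).1 (not_le.1 hcon)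
    have h3 := hmem.2 _ hi
    rw [hrank] at h3
    obtain ⟨hi', h4⟩ := (lt_countP_iff hc.1 _ _).1 h3
    refine lt_irrefl _ ((lt_countP_iff hc.1 _ m).2 ⟨hi', h4.trans_le ?_⟩)
    exact h2

theorem cellMap_f_below (u : CellIdx (pos lam) (boxesOf lam c) → ℂ) {a b : Box lam}
    (h : b.1.val = a.1.val + 1) (h' : b.2.val = a.2.val) :
    cellMap hlam c u (f lam b) = nil lam (cellMap hlam c u (f lam a)) := by
  funext d
  rw [cellMap_f_apply]
  by_cases hd : d.1.val = 0
  · rw [nil_apply_eq_zero _ hd, if_neg, boxCoef, dif_neg]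
    · exact zero_add _
    · rintro ⟨h1, -⟩
      rw [h1] at h
      omega
    · rintro rfl
      omega
  · obtain ⟨e, he, he'⟩ := exists_above hlam hd
    rw [nil_apply _ he he', cellMap_f_apply,
      boxCoef_below hlam h h' he he']
    congr 1
    refine if_congr ⟨?_, ?_⟩ rfl rfl
    · rintro rfl
      exact box_ext (by omega) (by omega)
    · rintro rfl
      exact box_ext (by omega) (by omega)

theorem cellMap_f_of_mem (hc : Admissible lam c) (u : CellIdx (pos lam) (boxesOf lam c) → ℂ)
    {b : Box lam} (hb : b ∈ boxesOf lam c) (j : Box lam) :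
    cellMap hlam c u (f lam b) j = f lam b j +
      if h : b ∈ boxesOf lam c ∧ j ∉ boxesOf lam c ∧ pos lam j < pos lam b then u ⟨(b, j), h⟩
      else 0 := by
  rw [cellMap_f_apply]
  congr 1
  · rw [f, Pi.single_apply]
    exact if_congr eq_comm rfl rfl
  · split_ifs with h
    · rw [(boxCoef_eq_some hlam hc hb j ⟨(b, j), h⟩).2 rfl]
      rfl
    · have : boxCoef hlam c b j = none := by
        rw [Option.eq_none_iff_forall_ne_some]
        intro x hx
        have h1 := (boxCoef_eq_some hlam hc hb j x).1 hx
        have h2 := x.2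
        rw [h1] at h2
        exact h h2
      rw [this]
      rfl

theorem cellMap_f_of_notMem (u : CellIdx (pos lam) (boxesOf lam c) → ℂ)
    {b : Box lam} (hb : b ∉ boxesOf lam c) (h0 : b.1.val = 0) :
    cellMap hlam c u (f lam b) = f lam b := by
  funext j
  rw [cellMap_f_apply, boxCoef,
    dif_neg]
  · rw [f, Pi.single_apply, Option.elim_none, add_zero]
    exact if_congr eq_comm rfl rfl
  · rintro ⟨-, h1, -⟩
    rw [topBox_of_eq_zero hlam h0] at h1
    exact hb h1

/-- Existence and uniqueness of g(U): the columns of g at top-row boxes are prescribed by the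
echelon form, with free entries u, and commutation with x^λ determines the others row by row. -/
theorem isCellMatrix_iff (hc : Admissible lam c) {U : Submodule ℂ (BoxSpace lam)}
    {g : Matrix (Box lam) (Box lam) ℂ} :
    IsCellMatrix lam c U g ↔ ∃ u : CellIdx (pos lam) (boxesOf lam c) → ℂ,
      U = perp lam (cellSpace (pos lam) (boxesOf lam c) u) ∧
        g = (boxMatrix hlam c u).transpose := by
  constructor
  · rintro ⟨hU, hspan, hfix, hnil⟩
    let u : CellIdx (pos lam) (boxesOf lam c) → ℂ := fun x => g x.1.2 x.1.1
    have hcols : ∀ (i : ℕ) (b : Box lam), b.1.val = i →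
        g.mulVecLin (f lam b) = cellMap hlam c u (f lam b) := by
      intro i
      induction i with
      | zero =>
        intro b h0
        by_cases hb : b ∈ boxesOf lam c
        · funext j
          have h1 := mem_span_f.1 (hspan b (mem_boxesOf.1 hb)) j
          rw [Pi.sub_apply] at h1
          rw [cellMap_f_of_mem hlam hc u hb]
          split_ifs with h
          · rw [mulVec_f, f, Pi.single_eq_of_ne, zero_add]
            rintro rfl
            exact lt_irrefl _ h.2.2
          · rw [add_zero]
            refine sub_eq_zero.1 (h1 fun h2 => h ⟨hb, ?_, h2.1⟩)
            rw [mem_boxesOf]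
            exact h2.2
        · rw [cellMap_f_of_notMem hlam u hb h0]
          exact hfix b h0 fun h => hb (mem_boxesOf.2 h)
      | succ i ih =>
        intro b hbi
        obtain ⟨a, ha, ha'⟩ := exists_above hlam (b := b) (by omega)
        rw [cellMap_f_below hlam u ha ha', ← ih a (by omega), ← nil_f ha ha']
        refine hnil a fun h => ?_
        have := congrFun ((nil_f ha ha').symm.trans h) b
        simp [f] at this
    have hg : g = (boxMatrix hlam c u).transpose := by
      ext j b
      exact (mulVec_f g b j).symm.trans ((congrFun (hcols _ b rfl) j).trans (mulVec_f _ b j))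
    refine ⟨u, ?_, hg⟩
    rw [perp_cellSpace hlam hc, hU, hg, colSpan, Submodule.map_span]
  · rintro ⟨u, rfl, rfl⟩
    refine ⟨?_, fun b hb => ?_, fun b h0 hb => ?_, fun b hb => ?_⟩
    · rw [perp_cellSpace hlam hc, colSpan, Submodule.map_span]
    · refine mem_span_f.2 fun j hj => ?_
      rw [Pi.sub_apply, cellMap_f_of_mem hlam hc u (mem_boxesOf.2 hb), dif_neg, add_zero, sub_self]
      rintro ⟨-, h1, h2⟩
      exact hj ⟨h2, fun h => h1 (mem_boxesOf.2 h)⟩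
    · exact cellMap_f_of_notMem hlam u (fun h => hb (mem_boxesOf.1 h)) h0
    · obtain ⟨b', h, h'⟩ := exists_below_of_nil_f_ne_zero hb
      rw [nil_f h h']
      exact cellMap_f_below hlam u h h'

end CellMatrix

/-! ### The paving of the Spaltenstein variety -/

section Paving

theorem cell_subset (θ : ThetaFamily) {n : ℕ} (lam mu : Fin n → ℕ) (T : Tableau) :
    cell θ n lam mu T ⊆ spaltensteinSet lam mu := by
  cases n with
  | zero => exact subset_rfl
  | succ n => exact fun V hV => hV.1

/-- The recursion for the cells is the general construction over a Schubert cell. The existence of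
g(U) already places V_{n-1} there, so the explicit Schubert condition is redundant in one direction
and checked in the other. -/
theorem cell_succ {θ : ThetaFamily} (hθ : θ.IsAdapted) {n : ℕ} {lam : Fin (n + 1) → ℕ}
    (hlam : Antitone lam) (mu : Fin (n + 1) → ℕ) {T : Tableau}
    (hc : Admissible lam (colsWith (n + 1) T)) :
    cell θ (n + 1) lam mu T = partialFlags (Box lam) mu ∩
      (boxTrivialization hθ hlam hc).cellOver
        (cell θ n (lamBar lam (colsWith (n + 1) T)) (fun i => mu i.castSucc) (bar (n + 1) T)) := by
  have hfibre : ∀ (u : CellIdx (pos lam) (boxesOf lam (colsWith (n + 1) T)) → ℂ)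
      (V : Fin (n + 2) → Submodule ℂ (BoxSpace lam)),
      (fun i : Fin (n + 1) => ((V i.castSucc).map
        (boxMatrix hlam (colsWith (n + 1) T) u).transpose.transpose.mulVecLin).map
          (θ n lam (colsWith (n + 1) T))) = (boxTrivialization hθ hlam hc).fibreFlag u V := by
    intro u V
    funext i
    exact (Submodule.map_comp _ _ _).symm
  ext V
  constructor
  · rintro ⟨hV, -, g, hg, hcell⟩
    obtain ⟨u, hu, rfl⟩ := (isCellMatrix_iff hlam hc).1 hg
    refine ⟨hV.1, u, ?_, ?_⟩
    · rw [← perp_perp (V _), hu, perp_perp]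
    · rw [← hfibre]
      exact hcell
  · rintro ⟨hV, u, hu, hcell⟩
    refine ⟨(mem_spaltensteinSet_iff hθ hlam hc hV hu).2 (cell_subset _ _ _ _ hcell), ?_,
      (boxMatrix hlam _ u).transpose, (isCellMatrix_iff hlam hc).2 ⟨u, ?_, rfl⟩, ?_⟩
    · rw [hu]
      exact perp_cellSpace_mem_schubertCell hlam hc u
    · rw [hu]
    · rw [hfibre]
      exact hcell

/-- The admissible column sequences of length `k`. -/
abbrev AdmissibleSeq {n : ℕ} (lam : Fin (n + 1) → ℕ) (k : ℕ) : Type :=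
  {c : List ℕ // Admissible lam c ∧ c.length = k}

/-! ### Tableaux as pairs of an admissible sequence and a smaller tableau -/

section Succ

variable {n : ℕ} {lam mu : Fin (n + 1) → ℕ}

theorem boxesOf_injective (k : ℕ) :
    Function.Injective fun a : AdmissibleSeq lam k => boxesOf lam a.1 :=
  fun a b h => Subtype.ext (boxesOf_inj a.2.1 b.2.1 h)

theorem card_boxesOf_admissible {k : ℕ} (a : AdmissibleSeq lam k) :
    (boxesOf lam a.1).card = k :=
  (card_boxesOf (a.2.1.1.imp fun h => h.ne) a.2.1.2.1).trans a.2.2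

variable (hlam : Antitone lam) (hsum : ∑ i, mu i = ∑ i, lam i)
include hlam hsum

theorem sum_lamBar_eq (a : AdmissibleSeq lam (mu (Fin.last n))) :
    ∑ i : Fin n, mu i.castSucc = ∑ i, lamBar lam a.1 i := by
  have h := sum_lamBar hlam a.2.1
  rw [a.2.2, ← hsum, Fin.sum_univ_castSucc] at h
  omega

theorem exists_admissibleSeq {V : Fin (n + 2) → Submodule ℂ (BoxSpace lam)}
    (hV : V ∈ spaltensteinSet lam mu) : ∃ (a : AdmissibleSeq lam (mu (Fin.last n)))
      (u : CellIdx (pos lam) (boxesOf lam a.1) → ℂ),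
      V (Fin.last n).castSucc = cellSpace (pos lam) (boxesOf lam a.1) u := by
  obtain ⟨c, hc, hleads⟩ := admissible_of_mem_spaltensteinSet hlam hV
  have hlen : c.length = mu (Fin.last n) := by
    rw [← card_boxesOf (hc.1.imp fun h => h.ne) hc.2.1, hleads]
    exact card_compl_leads (card_box lam mu hsum) (pos_injective lam) hV.1
  have h := exists_eq_cellSpace (pos_injective lam) (V (Fin.last n).castSucc)
  rw [← hleads] at h
  obtain ⟨u, hu⟩ := h
  exact ⟨⟨c, hc, hlen⟩, u, hu⟩

/-- The tableaux in `Col^λ_μ` are determined by the columns with the largest entry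
and the tableau that is left when this entry is removed. -/
def splitCol (T : Col lam mu) : Σ a : AdmissibleSeq lam (mu (Fin.last n)),
    Col (lamBar lam a.1) (fun i : Fin n => mu i.castSucc) :=
  ⟨⟨colsWith (n + 1) T.1, admissible_colsWith hlam hsum T.2, length_colsWith T.2⟩,
    bar (n + 1) T.1, bar_mem_col hlam hsum T.2⟩

omit hlam hsum in
theorem sigma_col_ext {x y : Σ a : AdmissibleSeq lam (mu (Fin.last n)),
    Col (lamBar lam a.1) (fun i : Fin n => mu i.castSucc)} (h : x.1.1 = y.1.1)
    (h' : x.2.1 = y.2.1) : x = y := by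
  obtain ⟨⟨c, hc⟩, R, hR⟩ := x
  obtain ⟨⟨c', hc'⟩, R', hR'⟩ := y
  obtain rfl : c = c' := h
  obtain rfl : R = R' := h'
  rfl

omit hlam hsum in
-- The lexicographic order transports the second component along an equality of the first; on the
-- underlying tableaux this transport disappears.
theorem sigma_col_lex {r : AdmissibleSeq lam (mu (Fin.last n)) →
    AdmissibleSeq lam (mu (Fin.last n)) → Prop}
    (x y : Σ a : AdmissibleSeq lam (mu (Fin.last n)),
      Col (lamBar lam a.1) (fun i : Fin n => mu i.castSucc)) :
    Sigma.Lex r (fun _ R R' => TabLE n R.1 R'.1) x y ↔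
      r x.1 y.1 ∨ x.1 = y.1 ∧ TabLE n x.2.1 y.2.1 := by
  obtain ⟨a, R⟩ := x
  obtain ⟨b, R'⟩ := y
  rw [Sigma.lex_iff]
  refine or_congr_right ⟨?_, ?_⟩
  · rintro ⟨h, h'⟩
    obtain rfl : a = b := h
    exact ⟨rfl, h'⟩
  · rintro ⟨h, h'⟩
    obtain rfl : a = b := h
    exact ⟨rfl, h'⟩

theorem splitCol_bijective : Function.Bijective (splitCol hlam hsum) := by
  constructor
  · intro T T' h
    have h1 : ∀ x y : (Σ a : AdmissibleSeq lam (mu (Fin.last n)),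
        Col (lamBar lam a.1) (fun i : Fin n => mu i.castSucc)), x = y →
        x.1.1 = y.1.1 ∧ x.2.1 = y.2.1 := by
      rintro x _ rfl
      exact ⟨rfl, rfl⟩
    exact Subtype.ext (col_ext hsum T.2 T'.2 (h1 _ _ h).1 (h1 _ _ h).2)
  · rintro ⟨⟨c, hc⟩, R, hR⟩
    obtain ⟨T, hT, h1, h2⟩ := exists_mem_col hlam hsum hc.1 hc.2 hR
    exact ⟨⟨T, hT⟩, sigma_col_ext h1 h2⟩

end Succ

/-- The strata are the Schubert cells of admissible sequences, with smaller Spaltenstein varieties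
as fibres. For n = 0 there is one tableau, so the relation `TabLE 0`, which always holds, is
antisymmetric. -/
theorem isPaving_spaltensteinSet {θ : ThetaFamily} (hθ : θ.IsAdapted) (n : ℕ)
    (lam mu : Fin n → ℕ) (hlam : Antitone lam) (hsum : ∑ i, mu i = ∑ i, lam i) :
    IsPaving (Box lam) mu (spaltensteinSet lam mu)
      (fun T T' : Col lam mu => TabLE n T.1 T'.1) (fun T => cell θ n lam mu T.1)
      (fun T => tabDeg n T.1) := by
  induction n with
  | zero =>
    have hnil : ∀ T : Tableau, T ∈ Col lam mu ↔ T = [] := by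
      intro T
      constructor
      · intro hT
        have h := hT.1
        rwa [numCols, Finset.univ_eq_empty, Finset.sup_empty, Nat.bot_eq_zero, List.range_zero,
          List.map_nil, List.map_eq_nil_iff] at h
      · rintro rfl
        exact ⟨rfl, fun C hC => absurd hC List.not_mem_nil, fun i => i.elim0⟩
    have hS : spaltensteinSet lam mu = partialFlags (Box lam) mu :=
      Set.ext fun V => ⟨fun h => h.1, fun h => ⟨h, fun i => i.elim0⟩⟩
    let I : Unique (Col lam mu) :=
      { default := ⟨[], (hnil _).2 rfl⟩
        uniq := fun T => Subtype.ext ((hnil _).1 T.2) }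
    have h := isPaving_partialFlags_zero (I := Col lam mu) (le := fun T T' => TabLE 0 T.1 T'.1) mu
      (card_box lam mu hsum)
      { refl := fun _ => trivial
        trans := fun _ _ _ _ _ => trivial
        antisymm := fun _ _ _ _ => Subsingleton.elim _ _ }
    rw [← hS] at h
    exact h
  | succ n ih =>
    have hfin : Finite (AdmissibleSeq lam (mu (Fin.last n))) :=
      Finite.of_injective _ (boxesOf_injective _)
    have h := isPaving_bruhat (card_box lam mu hsum) (pos_injective lam)
      (fun a : AdmissibleSeq lam (mu (Fin.last n)) => boxesOf lam a.1) (boxesOf_injective _)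
      card_boxesOf_admissible (fun a => Box (lamBar lam a.1))
      (fun a => card_box _ _ (sum_lamBar_eq hlam hsum a))
      (fun a => boxTrivialization hθ hlam a.2.1) (spaltensteinSet lam mu)
      (fun a => spaltensteinSet (lamBar lam a.1) fun i : Fin n => mu i.castSucc) (fun V => ?_)
      (fun a => Col (lamBar lam a.1) fun i : Fin n => mu i.castSucc)
      (fun a R R' => TabLE n R.1 R'.1) (fun a R => cell θ n (lamBar lam a.1) _ R.1)
      (fun a R => tabDeg n R.1)
      (fun a => ih _ _ (lamBar_antitone _ _) (sum_lamBar_eq hlam hsum a))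
    -- The paving is indexed by pairs; transport along T ↦ (c, T̄) matches the order, the cells and
    -- the degrees.
    · refine h.reindex (Equiv.ofBijective _ (splitCol_bijective hlam hsum)) (fun T T' => ?_)
        (fun T => cell_succ hθ hlam mu (admissible_colsWith hlam hsum T.2)) (fun T => ?_)
      · rw [sigma_col_lex]
        have hc := admissible_colsWith hlam hsum T.2
        have hc' := admissible_colsWith hlam hsum T'.2
        have hlen := (length_colsWith T.2).trans (length_colsWith T'.2).symm
        rw [TabLE, partLT_iff hc.1 hc'.1 hlen, partOfCols_inj hc.1 hc'.1 hlen,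
          ← bruhatLE_boxesOf hc hc']
        refine or_congr (and_congr_right fun _ => not_congr ?_) (and_congr_left fun _ => ?_)
        · exact ⟨fun h => Subtype.ext h, fun h => congrArg Subtype.val h⟩
        · exact ⟨fun h => Subtype.ext h, fun h => congrArg Subtype.val h⟩
      · exact congrArg (· + _) (card_cellIdx (admissible_colsWith hlam hsum T.2)).symm
    · constructor
      · intro hV
        obtain ⟨a, u, hu⟩ := exists_admissibleSeq hlam hsum hV
        exact ⟨hV.1, a, u, hu, (mem_spaltensteinSet_iff hθ hlam a.2.1 hV.1 hu).1 hV⟩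
      · rintro ⟨hV, a, u, hu, hmem⟩
        exact (mem_spaltensteinSet_iff hθ hlam a.2.1 hV hu).2 hmem

/-- Here all Schubert cells of the Grassmannian occur as strata. For n = 0 there are no conditions,
so the complement is empty. -/
theorem exists_isPaving_compl (n : ℕ) (lam mu : Fin n → ℕ) (hlam : Antitone lam)
    (hsum : ∑ i, mu i = ∑ i, lam i) :
    ∃ (I : Type) (le : I → I → Prop) (cell : I → Set (Fin (n + 1) → Submodule ℂ (BoxSpace lam)))
      (dim : I → ℕ),
      IsPaving (Box lam) mu (partialFlags (Box lam) mu \ spaltensteinSet lam mu) le cell dim := by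
  -- Any adapted θ will do: it only identifies the fibres over admissible cells.
  obtain ⟨θ, hθ⟩ := exists_isAdapted
  induction n with
  | zero =>
    refine ⟨Empty, fun _ _ => True, Empty.elim, Empty.elim, inferInstance,
      { refl := fun i => i.elim, trans := fun i => i.elim, antisymm := fun i => i.elim },
      fun i => i.elim, ?_, fun i => i.elim, fun i => i.elim⟩
    rw [Set.iUnion_of_empty]
    refine (Set.sdiff_eq_empty.2 ?_).symm
    intro V h
    exact ⟨h, fun i => i.elim0⟩
  | succ n ih =>
    have hpos := pos_injective lam
    have hβ := card_box lam mu hsum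
    have key : ∀ a : {c : Finset (Box lam) // c.card = mu (Fin.last n)},
        ∃ (γ : Type) (_ : Fintype γ) (s : Trivialization (pos lam) a.1 γ)
          (M : Set (Fin (n + 1) → Submodule ℂ (γ → ℂ))) (I : Type) (le : I → I → Prop)
          (cell : I → Set (Fin (n + 1) → Submodule ℂ (γ → ℂ))) (dim : I → ℕ),
          Fintype.card γ = ∑ i : Fin n, mu i.castSucc ∧
          IsPaving γ (fun i : Fin n => mu i.castSucc) M le cell dim ∧
          ∀ V ∈ partialFlags (Box lam) mu, ∀ u,
            V (Fin.last n).castSucc = cellSpace (pos lam) a.1 u →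
              (V ∉ spaltensteinSet lam mu ↔ s.fibreFlag u V ∈ M) := by
      rintro ⟨c, hcard⟩
      -- Over an admissible cell the fibre is the complement of the smaller Spaltenstein variety,
      -- paved by induction. Over any other cell no flag lies in the Spaltenstein variety, and the
      -- fibre is the full flag variety.
      by_cases hadm : ∃ l : AdmissibleSeq lam (mu (Fin.last n)), boxesOf lam l.1 = c
      · obtain ⟨l, rfl⟩ := hadm
        have hl := sum_lamBar_eq hlam hsum l
        obtain ⟨I, le, cell, dim, h⟩ := ih _ _ (lamBar_antitone lam l.1) hl
        refine ⟨Box (lamBar lam l.1), inferInstance, boxTrivialization hθ hlam l.2.1, _, I, le,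
          cell, dim, card_box _ _ hl, h, fun V hV u hu => ?_⟩
        rw [mem_spaltensteinSet_iff hθ hlam l.2.1 hV hu]
        exact ⟨fun h => ⟨Trivialization.fibreFlag_mem _ hV hu, h⟩, fun h => h.2⟩
      · have hγ : Fintype.card {b // b ∉ c} = ∑ i : Fin n, mu i.castSucc := by
          rw [Fintype.card_subtype_compl, Fintype.card_coe, hβ, hcard, Fin.sum_univ_castSucc,
            Nat.add_sub_cancel_right]
        obtain ⟨I, le, cell, dim, h⟩ :=
          exists_isPaving_partialFlags n (fun i => mu i.castSucc) {b // b ∉ c} hγ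
        refine ⟨{b // b ∉ c}, inferInstance, Trivialization.standard (pos lam) c, _, I, le, cell,
          dim, hγ, h, fun V hV u hu => ⟨fun _ => Trivialization.fibreFlag_mem _ hV hu,
            fun _ hV' => hadm ?_⟩⟩
        obtain ⟨l, u', hu'⟩ := exists_admissibleSeq hlam hsum hV'
        exact ⟨l, cellSpace_eq_imp (hu'.symm.trans hu)⟩
    choose γ inst s M I le cell dim hγ hpav hmem using key
    have hS : ∀ V, V ∈ partialFlags (Box lam) mu \ spaltensteinSet lam mu ↔
        V ∈ partialFlags (Box lam) mu ∧ ∃ a, V ∈ (s a).cellOver (M a) := by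
      refine fun V => ⟨fun hV => ⟨hV.1, ?_⟩, fun ⟨hV, a, u, hu, h⟩ => ⟨hV, (hmem a V hV u hu).2 h⟩⟩
      obtain ⟨u, hu⟩ := exists_eq_cellSpace hpos (V (Fin.last n).castSucc)
      have hcard := card_compl_leads (pos := pos lam) hβ hpos hV.1
      exact ⟨⟨_, hcard⟩, u, hu, (hmem ⟨_, hcard⟩ V hV.1 u hu).1 hV.2⟩
    exact ⟨_, _, _, _, isPaving_bruhat hβ hpos Subtype.val Subtype.val_injective
      (fun a => a.2) γ hγ s _ M hS I le cell dim hpav⟩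

theorem exists_isAffinePaving_congr {M : SpaceWithFunctions} {Z Z' : Set M.carrier} (h : Z = Z')
    (hZ : ∃ (I : Type) (le : I → I → Prop) (cell : I → Set (M.sub Z).carrier) (dim : I → ℕ),
      (M.sub Z).IsAffinePaving le cell dim) :
    ∃ (I : Type) (le : I → I → Prop) (cell : I → Set (M.sub Z').carrier) (dim : I → ℕ),
      (M.sub Z').IsAffinePaving le cell dim :=
  h ▸ hZ

end Paving

end SpaltensteinPaving

open SpaltensteinPaving

theorem theorem2p3 (n d : ℕ) (lam mu : Fin n → ℕ) (hlam : Antitone lam)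
    (hlam_sum : ∑ i, lam i = d) (hmu_sum : ∑ i, mu i = d) :
    (∃ θ : SpaltensteinPaving.ThetaFamily, θ.IsAdapted) ∧
    (∀ θ : SpaltensteinPaving.ThetaFamily, θ.IsAdapted →
      (SpaltensteinPaving.spaltenstein lam mu (hmu_sum.trans hlam_sum.symm)).IsAffinePaving
        (fun T T' : SpaltensteinPaving.Col lam mu => SpaltensteinPaving.TabLE n T.1 T'.1)
        (fun T => SpaltensteinPaving.cellSubset θ lam mu (hmu_sum.trans hlam_sum.symm) T.1)
        (fun T => SpaltensteinPaving.tabDeg n T.1)) ∧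
    ∃ (I : Type) (le : I → I → Prop)
      (cell : I → Set (SpaltensteinPaving.spaltensteinCompl lam mu
        (hmu_sum.trans hlam_sum.symm)).carrier)
      (dim : I → ℕ),
      (SpaltensteinPaving.spaltensteinCompl lam mu
        (hmu_sum.trans hlam_sum.symm)).IsAffinePaving le cell dim := by
  have hsum := hmu_sum.trans hlam_sum.symm
  refine ⟨exists_isAdapted, fun θ hθ => ?_, ?_⟩
  · exact (isPaving_spaltensteinSet hθ n lam mu hlam hsum).isAffinePaving (card_box lam mu hsum)
  · obtain ⟨I, le, cell, dim, h⟩ := exists_isPaving_compl n lam mu hlam hsum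
    have h' := h.isAffinePaving (card_box lam mu hsum)
    -- The two descriptions differ by the redundant condition of being a flag. They are only
    -- propositionally equal, so the paving has to be transported.
    have hset : {V : partialFlags (Box lam) mu | V.1 ∈ partialFlags (Box lam) mu \
        spaltensteinSet lam mu} = (spaltensteinSubset lam mu hsum)ᶜ :=
      Set.ext fun V => ⟨fun hV => hV.2, fun hV => ⟨V.2, hV⟩⟩
    exact exists_isAffinePaving_congr hset ⟨I, le, _, dim, h'⟩
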